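/- Consider the two-component Burgers type system $$u_t=u_{xx}+2uu_x+v_x,\qquad v_t=(uv)_x. \tag{B}$$ **Setting.** Let $\mathbb k\in\{\mathbb R,\mathbb C\}$ and let $K\supseteq\mathbb k$ be an integral domain with two commuting $\mathbb k$-linear derivations $\partial_x,\partial_t$ (for instance a ring of convergent germs of functions of $(x,t)$). Let $R=K[u_j,v_j: j\ge 0]$, $u=u_0$, $v=v_0$, with the total derivative $D_x$ extending $\partial_x$, $D_xu_j=u_{j+1}$, $D_xv_j=v_{j+1}$, and the derivation $D_t$ extending $\partial_t$, commuting with $D_x$ and determined by (B): $D_tu=u_2+2uu_1+v_1$, $D_tv=u_1v+uv_1$. Let $F$ be the quotient field of $R$, with the induced derivations. For $\gamma\in F$ put $\delta\gamma/\delta u=\sum_j(-D_x)^j\partial\gamma/\partial u_j$ and similarly $\delta\gamma/\delta v$. Let $I\subseteq\mathbb R$ be an open interval of times. Smooth functions $u(x,t),v(x,t)$ below are real-valued and $C^\infty$ on $\mathbb R\times I$. For numbers $\lambda\ne0$ put $q=u+\lambda^{-1}v-\lambda$ and $$L=\begin{pmatrix} q/2&0\\1&-q/2\end{pmatrix},\qquad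 P_\beta=\begin{pmatrix}\tfrac12 D_x\beta+\tfrac12\beta q&0\\ \beta&-\tfrac12D_x\beta-\tfrac12\beta q\end{pmatrix},\qquad P=P_{u+\lambda}.$$ **Theorem.** (1) *Conservation laws.* An element $\gamma\in R$ is a conserved density, i.e. $D_t\gamma+D_x\rho=0$ for some $\rho\in R$, if and only if $\gamma=au+bv+k+D_xh$ with $h\in R$, $a,b\in K$ constants ($\partial_xa=\partial_ta=\partial_xb=\partial_tb=0$) and $k\in K$ with $\partial_tk\in\partial_xK$. If $a,b\in K$ are constants and $au+bv\in K+D_xR$, then $a=b=0$. Thus, up to trivial ones (total $x$-derivatives and terms not depending on $u,v$), $\int u\,dx$ and $\int v\,dx$ are independent and are the only local conserved quantities; in particular there is no infinite ordered family of further ones. Moreover, if $\gamma,\rho\in F$ are rational and $D_t\gamma+D_x\rho=0$, then $\delta\gamma/\delta u=a$ and $\delta\gamma/\delta v=b$ for some $a,b\in F$ with $D_xa=D_ta=D_xb=D_tb=0$. (2) *Hopf–Cole type linearization.* Smooth functions $u,v$ satisfy the first equation of (B) on $\mathbb R\times I$ if and only if there is a positive smooth $\tilde g$ on $\mathbb R\times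 I$ with $$u=D_x\ln\tilde g,\qquad \tilde g_t=\tilde g_{xx}+v\tilde g .$$ (3) *Lax pair.* For smooth $u,v$ the following are equivalent: (i) $(u,v)$ solves (B) on $\mathbb R\times I$; (ii) $D_tL-D_xP+[L,P]=0$ on $\mathbb R\times I$ for all $\lambda\in\mathbb C\setminus\{0\}$; (iii) for all $\lambda\in\mathbb C\setminus\{0\}$, all $(x_0,t_0)\in\mathbb R\times I$ and all $c,d\in\mathbb C$ the system $$D_x\binom{f}{\hat f}=L\binom{f}{\hat f},\qquad D_t\binom{f}{\hat f}=P\binom{f}{\hat f}$$ has a smooth complex solution on $\mathbb R\times I$ with $(f,\hat f)(x_0,t_0)=(c,d)$. *Adjoint extension.* If $v_t=(uv)_x$ and $\tilde g$ is as in (2), then there is a smooth $w$ with $w_x=v$, $w_t=uv$ such that for every $\lambda\in\mathbb C\setminus\{0\}$ the function $f=\tilde g^{1/2}\exp[\tfrac12(\lambda^{-1}w-\lambda x-\lambda^2t)]$ has a companion $\hat f$ with $D_x(\hat ff)=f^2$, $D_t(\hat ff)=(u+\lambda)f^2$, and $(f,\hat f)$ is a smooth solution of the Lax pair. *Differential-algebraic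 form.* For every $\lambda\in\mathbb k\setminus\{0\}$ one has $D_tL-D_xP+[L,P]=0$ over $R$, and there is a finitely generated commutative ring extension $E\supseteq R$ with commuting $\mathbb k$-linear derivations extending $D_x,D_t$, that contains an invertible $f$ and an element $\hat f$ solving both linear systems. (4) *Hierarchy.* Let $\lambda$ now be a formal parameter, extend derivations coefficientwise to formal Laurent series in $\lambda^{-1}$ over $R$, and let $(\cdot)_+$ be the part of nonnegative degree in $\lambda$. An asymptotic solution is a series $\alpha=\sum_{j\ge0}\lambda^{-j}\alpha_j$, $\alpha_j\in R$, with $$D_x^2\alpha+D_x\big((u+\lambda^{-1}v-\lambda)\alpha\big)=0.$$ A flow is a $K$-linear derivation of $R$ commuting with $D_x$. (a) Let $D$ be a flow and $\beta\in R[\lambda]$ of degree at most $n$ in $\lambda$. Then $DL-D_xP_\beta+[L,P_\beta]=0$ if and only if $\beta=(\lambda^n\alpha)_+$ for some asymptotic solution $\alpha$ and $D(u+\lambda^{-1}v-\lambda)=D_x[D_x\beta+(u+\lambda^{-1}v-\lambda)\beta]$. (b) For every asymptotic solution $\alpha$ and every $n\ge0$, with $\alpha_n(\lambda):=(\lambda^n\alpha)_+$,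 there is exactly one flow $D_{t_n}$ with $$D_{t_n}(u+\lambda^{-1}v-\lambda)=D_x\big[D_x\alpha_n(\lambda)+(u+\lambda^{-1}v-\lambda)\,\alpha_n(\lambda)\big].$$ (c) There is exactly one asymptotic solution with $\alpha_0=1$ and all $\alpha_j$, $j\ge1$, without constant term. For it $\alpha_1(\lambda)=u+\lambda$; $D_{t_0}(u,v)=(u_x,v_x)$; $D_{t_1}$ on $(u,v)$ is the right-hand side of (B); $D_{t_{n+1}}(u,v)^{\top}=\Phi\,D_{t_n}(u,v)^{\top}$ with $$\Phi=\begin{pmatrix}D_x+D_xuD_x^{-1}&1\\D_xvD_x^{-1}&0\end{pmatrix},$$ where $D_x^{-1}D_{t_n}u$ is the primitive in $R$ without constant term; and the flows $D_{t_n}$, $n\ge0$, are linearly independent over $K$. -/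

import Mathlib

open scoped ContDiff nonZeroDivisors

noncomputable section

namespace Burgers

universe u

/-! ## Differential polynomials in two unknowns over a coefficient ring -/

section Algebra

variable {𝕜 : Type*} [RCLike 𝕜] {K : Type u} [CommRing K] [Algebra 𝕜 K]

/-- Differential polynomials in `u, v` with coefficients in `K`. The variable `(0, j)` is the
`j`-th `x`-derivative of `u` and `(1, j)` the `j`-th `x`-derivative of `v`. The `t`-derivatives
have been eliminated by means of the evolution equations, so this is the reduced ring. -/
abbrev DiffPoly (K : Type u) [CommRing K] : Type u := MvPolynomial (Fin 2 × ℕ) K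

/-- The unknown `u`. -/
def uu (K : Type u) [CommRing K] : DiffPoly K := MvPolynomial.X (0, 0)

/-- The unknown `v`. -/
def vv (K : Type u) [CommRing K] : DiffPoly K := MvPolynomial.X (1, 0)

theorem coeff_sum_monomial (d : Derivation 𝕜 K K) (p : DiffPoly K) (s : Fin 2 × ℕ →₀ ℕ) :
    (∑ s ∈ p.support, MvPolynomial.monomial s (d (p.coeff s))).coeff s = d (p.coeff s) := by
  simp only [MvPolynomial.coeff_sum, MvPolynomial.coeff_monomial]
  rw [Finset.sum_ite_eq']
  split_ifs with hs
  · rfl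
  · rw [MvPolynomial.notMem_support_iff.mp hs, map_zero]

/-- Apply a derivation of `K` to every coefficient, as a linear map. -/
def coeffLinear (d : Derivation 𝕜 K K) : DiffPoly K →ₗ[𝕜] DiffPoly K where
  toFun p := ∑ s ∈ p.support, MvPolynomial.monomial s (d (p.coeff s))
  map_add' p q := by
    ext s
    rw [MvPolynomial.coeff_add, coeff_sum_monomial, coeff_sum_monomial, coeff_sum_monomial,
      MvPolynomial.coeff_add, map_add]
  map_smul' c p := by
    ext s
    rw [RingHom.id_apply, MvPolynomial.coeff_smul, coeff_sum_monomial, coeff_sum_monomial,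
      MvPolynomial.coeff_smul, Derivation.map_smul]

theorem coeff_coeffLinear (d : Derivation 𝕜 K K) (p : DiffPoly K) (s : Fin 2 × ℕ →₀ ℕ) :
    (coeffLinear d p).coeff s = d (p.coeff s) :=
  coeff_sum_monomial d p s

/-- The derivation of `DiffPoly K` that acts on coefficients by `d` and kills all jet variables. -/
def coeffDer (d : Derivation 𝕜 K K) : Derivation 𝕜 (DiffPoly K) (DiffPoly K) :=
  Derivation.mk' (coeffLinear d) (by
    intro p q
    ext s
    simp only [coeff_coeffLinear, smul_eq_mul, MvPolynomial.coeff_add, MvPolynomial.coeff_mul,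
      map_sum, Derivation.leibniz, Finset.sum_add_distrib]
    congr 1
    refine Finset.sum_nbij' Prod.swap Prod.swap ?_ ?_ ?_ ?_ ?_ <;>
      simp [add_comm])

/-- The total `x`-derivative: `∂x` on coefficients, and `u_j ↦ u_{j+1}`, `v_j ↦ v_{j+1}`. -/
def totalX (dx : Derivation 𝕜 K K) : Derivation 𝕜 (DiffPoly K) (DiffPoly K) :=
  coeffDer dx +
    (MvPolynomial.mkDerivation K (fun p : Fin 2 × ℕ =>
      (MvPolynomial.X (p.1, p.2 + 1) : DiffPoly K))).restrictScalars 𝕜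

/-- The right-hand side `(u_xx + 2 u u_x + v_x, u_x v + u v_x)` of the Burgers type system. -/
def burgersField (dx : Derivation 𝕜 K K) : Fin 2 → DiffPoly K :=
  ![totalX dx (totalX dx (uu K)) + 2 * uu K * totalX dx (uu K) + totalX dx (vv K),
    totalX dx (uu K) * vv K + uu K * totalX dx (vv K)]

/-- The evolutionary derivation with characteristic `Q`: it kills the coefficients and sends
`u_j` to `D_x^j Q_0` and `v_j` to `D_x^j Q_1`. -/
def evolutionary (dx : Derivation 𝕜 K K) (Q : Fin 2 → DiffPoly K) :
    Derivation K (DiffPoly K) (DiffPoly K) :=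
  MvPolynomial.mkDerivation K (fun p : Fin 2 × ℕ => (totalX dx)^[p.2] (Q p.1))

/-- The total `t`-derivative on the reduced ring. -/
def totalT (dx dt : Derivation 𝕜 K K) : Derivation 𝕜 (DiffPoly K) (DiffPoly K) :=
  coeffDer dt + (evolutionary dx (burgersField dx)).restrictScalars 𝕜

/-! ## Rational differential functions -/

/-- The quotient field of the ring of differential polynomials. -/
abbrev DiffFrac (K : Type u) [CommRing K] : Type u := FractionRing (DiffPoly K)

/-- The extension of a derivation of `DiffPoly K` to the quotient field by the quotient rule. -/
def fracDer (d : Derivation 𝕜 (DiffPoly K) (DiffPoly K)) [IsDomain K] (z : DiffFrac K) :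
    DiffFrac K :=
  let n := (IsLocalization.sec (DiffPoly K)⁰ z).1
  let s : DiffPoly K := (IsLocalization.sec (DiffPoly K)⁰ z).2
  (algebraMap _ (DiffFrac K) (d n * s - n * d s)) / (algebraMap _ (DiffFrac K) s) ^ 2

/-- The quotient rule holds for every representation as a fraction. -/
theorem fracDer_div [IsDomain K] (d : Derivation 𝕜 (DiffPoly K) (DiffPoly K)) (p q : DiffPoly K)
    (hq : q ≠ 0) :
    fracDer d (algebraMap _ (DiffFrac K) p / algebraMap _ (DiffFrac K) q) =
      algebraMap _ (DiffFrac K) (d p * q - p * d q) / (algebraMap _ (DiffFrac K) q) ^ 2 := by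
  set φ := algebraMap (DiffPoly K) (DiffFrac K) with hφ
  have hinj : Function.Injective φ := IsFractionRing.injective (DiffPoly K) (DiffFrac K)
  have hne : ∀ a : DiffPoly K, a ≠ 0 → φ a ≠ 0 := fun a ha h => ha (hinj (by rw [h, map_zero]))
  unfold fracDer
  set z := φ p / φ q with hz
  have hsec := IsLocalization.sec_spec (DiffPoly K)⁰ z
  set n := (IsLocalization.sec (DiffPoly K)⁰ z).1
  set s := (IsLocalization.sec (DiffPoly K)⁰ z).2 with hs
  have hs0 : (s : DiffPoly K) ≠ 0 := nonZeroDivisors.coe_ne_zero s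
  have hrel : p * s = n * q := by
    apply hinj
    rw [map_mul, map_mul, ← hsec, hz]
    have h0 : φ q ≠ 0 := hne q hq
    change φ p * φ s = φ p / φ q * φ s * φ q
    field_simp
  have hd : d p * s + p * d s = d n * q + n * d q := by
    have h := congrArg d hrel
    simp only [Derivation.leibniz, smul_eq_mul] at h
    linear_combination h
  rw [div_eq_div_iff (pow_ne_zero 2 (hne _ hs0)) (pow_ne_zero 2 (hne q hq))]
  rw [← map_pow, ← map_pow, ← map_mul, ← map_mul]
  congr 1
  linear_combination (-(q : DiffPoly K) * s) * hd + (d s * q + s * d q) * hrel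

/-- The component `i` of the functional gradient: `∑_j (-D_x)^j ∂γ/∂w_j` where `w = u` for `i = 0`
and `w = v` for `i = 1` (only finitely many summands are nonzero). -/
def grad [IsDomain K] (dx : Derivation 𝕜 K K) (i : Fin 2) (γ : DiffFrac K) : DiffFrac K :=
  ∑ᶠ j : ℕ, (-1) ^ j * (fracDer (totalX dx))^[j]
    (fracDer ((MvPolynomial.pderiv (R := K) (i, j)).restrictScalars 𝕜) γ)

/-! ## Lax matrices -/

/-- The matrix of the `x`-part of the Lax pair, with `q = u + λ⁻¹ v - λ`. -/
def laxL (𝕜 : Type*) [RCLike 𝕜] {A : Type*} [CommRing A] [Algebra 𝕜 A] (q : A) :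
    Matrix (Fin 2) (Fin 2) A :=
  !![(2⁻¹ : 𝕜) • q, 0;
     1, (2⁻¹ : 𝕜) • (-q)]

/-- The matrix of the `t`-part of the Lax pair, with `q = u + λ⁻¹ v - λ`, an element `α`, which is
`u + λ` for the Burgers type system itself, and its `x`-derivative `αx`. -/
def laxP (𝕜 : Type*) [RCLike 𝕜] {A : Type*} [CommRing A] [Algebra 𝕜 A] (q α αx : A) :
    Matrix (Fin 2) (Fin 2) A :=
  !![(2⁻¹ : 𝕜) • αx + (2⁻¹ : 𝕜) • (α * q), 0;
     α, -((2⁻¹ : 𝕜) • αx) + (2⁻¹ : 𝕜) • (α * (-q))]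

/-- The zero-curvature expression `D_t L - D_x P + [L, P]`; the matrices `L`, `P` are
differentiated entrywise. -/
def curvature {A : Type*} [CommRing A] (Dx Dt : A → A) (L P : Matrix (Fin 2) (Fin 2) A) :
    Matrix (Fin 2) (Fin 2) A :=
  L.map Dt - P.map Dx + (L * P - P * L)

/-- `u + λ⁻¹ v - λ` for a nonzero number `λ`. -/
def spectralQ (K : Type u) [CommRing K] [Algebra 𝕜 K] (lam : 𝕜) : DiffPoly K :=
  uu K + algebraMap 𝕜 (DiffPoly K) lam⁻¹ * vv K - algebraMap 𝕜 (DiffPoly K) lam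

/-- `u + λ`. -/
def spectralAlpha (K : Type u) [CommRing K] [Algebra 𝕜 K] (lam : 𝕜) : DiffPoly K :=
  uu K + algebraMap 𝕜 (DiffPoly K) lam

/-- The Lax pair with parameter `lam` is solvable in a finitely generated differential extension
`E` of the reduced ring: `E` contains the ring, its two commuting derivations extend `D_x`, `D_t`,
and there are `f, fh ∈ E`, with `f` invertible, solving both linear systems. -/
def LaxSolvableInExtension (dx dt : Derivation 𝕜 K K) (lam : 𝕜) : Prop :=
  ∃ (E : Type u) (_ : CommRing E) (_ : Algebra 𝕜 E) (_ : Algebra (DiffPoly K) E)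
    (_ : IsScalarTower 𝕜 (DiffPoly K) E) (Ex Et : Derivation 𝕜 E E) (f fh : E),
    Algebra.FiniteType (DiffPoly K) E ∧
    Function.Injective (algebraMap (DiffPoly K) E) ∧
    (∀ p, Ex (algebraMap _ E p) = algebraMap _ E (totalX dx p)) ∧
    (∀ p, Et (algebraMap _ E p) = algebraMap _ E (totalT dx dt p)) ∧
    (∀ z, Ex (Et z) = Et (Ex z)) ∧
    IsUnit f ∧
    ![Ex f, Ex fh] =
      ((laxL 𝕜 (spectralQ K lam)).map (algebraMap _ E)).mulVec ![f, fh] ∧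
    ![Et f, Et fh] =
      ((laxP 𝕜 (spectralQ K lam) (spectralAlpha K lam)
        (totalX dx (spectralAlpha K lam))).map (algebraMap _ E)).mulVec ![f, fh]

/-! ## Formal series in `λ⁻¹` and the hierarchy -/

/-- Formal Laurent series in `z = λ⁻¹` with differential polynomial coefficients:
the coefficient with index `k : ℤ` belongs to `λ^(-k)`. -/
abbrev Series (K : Type u) [CommRing K] : Type u := LaurentSeries (DiffPoly K)

/-- `λ^n`, for an integer `n`. -/
def lamPow (K : Type u) [CommRing K] (n : ℤ) : Series K := HahnSeries.single (-n) 1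

/-- `u + λ⁻¹ v - λ` as a formal series. -/
def formalQ (K : Type u) [CommRing K] : Series K :=
  HahnSeries.C (uu K) + lamPow K (-1) * HahnSeries.C (vv K) - lamPow K 1

/-- The total `x`-derivative, coefficientwise. -/
def seriesX (dx : Derivation 𝕜 K K) (s : Series K) : Series K := s.map (totalX dx)

/-- The part of nonnegative degree in `λ`. -/
def polyPart (s : Series K) : Series K where
  coeff k := if k ≤ 0 then s.coeff k else 0
  isPWO_support' := s.isPWO_support.mono (by
    intro k hk
    by_contra h
    apply hk
    have h0 : s.coeff k = 0 := by simpa using h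
    simp [h0])

/-- `α = ∑_{j ≥ 0} λ^(-j) α_j` is a formal (asymptotic) solution of
`D_x² α + D_x ((u + λ⁻¹ v - λ) α) = 0`. -/
def IsAsymptoticSolution (dx : Derivation 𝕜 K K) (α : Series K) : Prop :=
  (∀ k < 0, α.coeff k = 0) ∧
    seriesX dx (seriesX dx α) + seriesX dx (formalQ K * α) = 0

/-- The solution with `α_0 = 1` and zero integration constants. -/
def IsNormalizedSolution (dx : Derivation 𝕜 K K) (α : Series K) : Prop :=
  IsAsymptoticSolution dx α ∧ α.coeff 0 = 1 ∧
    ∀ k > 0, MvPolynomial.constantCoeff (α.coeff k) = 0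

/-- A flow of the form `(u, v)_τ = Q[u, v]`: a `K`-linear derivation commuting with `D_x`. -/
def IsFlow (dx : Derivation 𝕜 K K) (D : Derivation K (DiffPoly K) (DiffPoly K)) : Prop :=
  ∀ p, D (totalX dx p) = totalX dx (D p)

/-- The equation `D (u + λ⁻¹ v - λ) = D_x [D_x β + (u + λ⁻¹ v - λ) β]`. -/
def FlowEquation (dx : Derivation 𝕜 K K) (β : Series K)
    (D : Derivation K (DiffPoly K) (DiffPoly K)) : Prop :=
  (formalQ K).map D = seriesX dx (seriesX dx β + formalQ K * β)

end Algebra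

/-! ## Smooth solutions on `ℝ × I` -/

section Smooth

variable {E : Type*} [NormedAddCommGroup E] [NormedSpace ℝ E]

/-- Smoothness of `w (x, t)` on `ℝ × I`. -/
def SmoothOn (I : Set ℝ) (w : ℝ → ℝ → E) : Prop :=
  ContDiffOn ℝ ∞ (Function.uncurry w) (Set.univ ×ˢ I)

/-- The partial derivative in `x`. -/
def dX (w : ℝ → ℝ → E) (x t : ℝ) : E := deriv (fun y => w y t) x

/-- The partial derivative in `t`. -/
def dT (w : ℝ → ℝ → E) (x t : ℝ) : E := deriv (fun s => w x s) t

/-- The first equation, `u_t = u_xx + 2 u u_x + v_x`. -/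
def FirstEquation (I : Set ℝ) (u v : ℝ → ℝ → ℝ) : Prop :=
  ∀ x, ∀ t ∈ I, dT u x t = dX (dX u) x t + 2 * u x t * dX u x t + dX v x t

/-- The second equation, `v_t = (u v)_x`. -/
def SecondEquation (I : Set ℝ) (u v : ℝ → ℝ → ℝ) : Prop :=
  ∀ x, ∀ t ∈ I, dT v x t = dX u x t * v x t + u x t * dX v x t

/-- `g` is a positive smooth function with `u = D_x ln g` and `g_t = g_xx + v g`. -/
def IsHopfCole (I : Set ℝ) (u v g : ℝ → ℝ → ℝ) : Prop :=
  SmoothOn I g ∧ (∀ x, ∀ t ∈ I, 0 < g x t) ∧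
  (∀ x, ∀ t ∈ I, u x t = dX (fun x t => Real.log (g x t)) x t) ∧
  (∀ x, ∀ t ∈ I, dT g x t = dX (dX g) x t + v x t * g x t)

/-- The matrix `L[u, v; λ]` at `(x, t)`. -/
def matL (u v : ℝ → ℝ → ℝ) (lam : ℂ) (x t : ℝ) : Matrix (Fin 2) (Fin 2) ℂ :=
  laxL ℂ ((u x t : ℂ) + lam⁻¹ * v x t - lam)

/-- The matrix `P[u, v; λ]` at `(x, t)`, where `α = u + λ`. -/
def matP (u v : ℝ → ℝ → ℝ) (lam : ℂ) (x t : ℝ) : Matrix (Fin 2) (Fin 2) ℂ :=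
  laxP ℂ ((u x t : ℂ) + lam⁻¹ * v x t - lam) ((u x t : ℂ) + lam)
    (dX (fun x t => (u x t : ℂ) + lam) x t)

/-- `D_t L - D_x P + [L, P] = 0` on `ℝ × I`. -/
def ZeroCurvature (I : Set ℝ) (u v : ℝ → ℝ → ℝ) (lam : ℂ) : Prop :=
  ∀ x, ∀ t ∈ I,
    (Matrix.of fun i j => dT (fun x t => matL u v lam x t i j) x t)
      - (Matrix.of fun i j => dX (fun x t => matP u v lam x t i j) x t)
      + (matL u v lam x t * matP u v lam x t - matP u v lam x t * matL u v lam x t) = 0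

/-- `(f, fh)` is a smooth solution on `ℝ × I` of both linear systems of the Lax pair. -/
def SolvesLax (I : Set ℝ) (u v : ℝ → ℝ → ℝ) (lam : ℂ) (f fh : ℝ → ℝ → ℂ) : Prop :=
  SmoothOn I f ∧ SmoothOn I fh ∧
  ∀ x, ∀ t ∈ I,
    ![dX f x t, dX fh x t] = (matL u v lam x t).mulVec ![f x t, fh x t] ∧
    ![dT f x t, dT fh x t] = (matP u v lam x t).mulVec ![f x t, fh x t]

end Smooth

end Burgers

end

open scoped ContDiff nonZeroDivisors

noncomputable section

namespace Burgers

universe u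

/-! ## Basic rules for the derivations of the ring of differential polynomials -/

section Basic

variable {𝕜 : Type*} [RCLike 𝕜] {K : Type u} [CommRing K] [Algebra 𝕜 K]

open MvPolynomial

/-! Conservation laws. The gradient $(f,g)$ of a conserved density is killed by the Euler operator
applied to the conservation law, which gives the adjoint linearized system
$D_tf+f_{xx}-2uf_x-vg_x=0$, $D_tg-f_x-ug_x=0$ (`grad_fracT`, `grad_equations`). A rational solution
of it involves no jet variables, by descent on the order (`OrderBound.descend`). If $G=\partial
g/\partial v_m$ is the top coefficient, comparing leading terms gives $\partial f/\partial
v_{m-1}=vG=-\partial g/\partial u_{m-1}$, and then $(D_t-uD_x)G=(2v-(m+1)u_x)G$. Give every $u_j$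
weight 1 and every $v_j$ weight 2. The operator on the left raises weight by at most 1, while
multiplication on the right raises it by exactly 2, so $G=0$ (`eq_zero_of_transport`), and the other
top coefficients vanish with it. Once no jet variables are left, differentiating the system in $u$
gives $g_x=f_x=0$, and then the $t$-derivatives vanish too.

For polynomial densities the gradient is thus a pair of constants $a,b\in K$, and $\gamma-au-bv$ has
zero gradient. Such a polynomial is a total derivative plus an element of $K$: modulo $D_x$,
integration by parts turns the degree derivation $\sum w_j\,\partial/\partial w_j$ into $\sum_w
w\,\delta/\delta w$, and in characteristic zero the degree can be inverted
(`exists_eq_C_add_totalX_of_grad`).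

Lax pair. All Lax matrices here are lower triangular and trace free, so the curvature collapses to
one scalar conservation law $q_t=(\beta_x+q\beta)_x$ (`curvature_lax`). For $\beta=u+\lambda$ the
bracket is $(u_x+u^2+v)+\lambda^{-1}uv-\lambda^2$, and separating powers of $\lambda$ yields the two
equations. On $\mathbb R\times I$ the conservation law says that a one-form is closed; since the
strip is convex it has a potential $\Phi$ (`exists_potential`). Then $f=e^{\Phi/2}$, and $\hat ff$
is a potential of the closed form $f^2\,(dx+(u+\lambda)\,dt)$. The Hopf–Cole function is the
exponential of a potential of $u\,dx+(u_x+u^2+v)\,dt$. Algebraically, the same $f$ and $\hat ff$ are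
adjoined as Laurent generators with prescribed logarithmic derivatives (`laxSolvableInExtension`).

Hierarchy. Everything is read off coefficientwise from
$D_x\alpha_k+u\alpha_k+v\alpha_{k-1}-\alpha_{k+1}$ (`recur`): its $D_x$-derivative vanishes for
asymptotic solutions, and truncating $\lambda^n\alpha$ leaves defects only at $\lambda^0$ and
$\lambda^{-1}$, which are the flows of $u$ and $v$. With zero integration constants the recursion
holds without $D_x$, whence the recursion operator. The linear part of $\alpha_{m+1}$ in the $u_j$
is $u_m$, whence independence. -/

theorem coeff_coeffDer (d : Derivation 𝕜 K K) (p : DiffPoly K) (s : Fin 2 × ℕ →₀ ℕ) :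
    (coeffDer d p).coeff s = d (p.coeff s) :=
  coeff_coeffLinear d p s

@[simp]
theorem coeffDer_monomial (d : Derivation 𝕜 K K) (s : Fin 2 × ℕ →₀ ℕ) (c : K) :
    coeffDer d (monomial s c : DiffPoly K) = monomial s (d c) := by
  ext m
  rw [coeff_coeffDer, coeff_monomial, coeff_monomial]
  split_ifs <;> simp

@[simp]
theorem coeffDer_C (d : Derivation 𝕜 K K) (c : K) :
    coeffDer d (C c : DiffPoly K) = C (d c) :=
  coeffDer_monomial d 0 c

@[simp]
theorem coeffDer_X (d : Derivation 𝕜 K K) (i : Fin 2 × ℕ) :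
    coeffDer d (X i : DiffPoly K) = 0 := by
  simp [X]

@[simp]
theorem totalX_C (dx : Derivation 𝕜 K K) (c : K) :
    totalX dx (C c : DiffPoly K) = C (dx c) := by
  simp [totalX]

@[simp]
theorem totalX_X (dx : Derivation 𝕜 K K) (i : Fin 2) (j : ℕ) :
    totalX dx (X (i, j) : DiffPoly K) = X (i, j + 1) := by
  simp [totalX]

@[simp]
theorem evolutionary_X (dx : Derivation 𝕜 K K) (Q : Fin 2 → DiffPoly K) (i : Fin 2) (j : ℕ) :
    evolutionary dx Q (X (i, j)) = (totalX dx)^[j] (Q i) := by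
  simp [evolutionary]

@[simp]
theorem totalT_C (dx dt : Derivation 𝕜 K K) (c : K) :
    totalT dx dt (C c : DiffPoly K) = C (dt c) := by
  simp [totalT]

@[simp]
theorem totalT_X (dx dt : Derivation 𝕜 K K) (i : Fin 2) (j : ℕ) :
    totalT dx dt (X (i, j) : DiffPoly K) = (totalX dx)^[j] (burgersField dx i) := by
  simp [totalT]

theorem burgersField_zero (dx : Derivation 𝕜 K K) :
    burgersField dx 0 = (X (0, 2) + 2 * X (0, 0) * X (0, 1) + X (1, 1) : DiffPoly K) := by
  simp [burgersField, uu, vv]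

theorem burgersField_one (dx : Derivation 𝕜 K K) :
    burgersField dx 1 = (X (0, 1) * X (1, 0) + X (0, 0) * X (1, 1) : DiffPoly K) := by
  simp [burgersField, uu, vv]

/-- Two derivations over the ground field agree once they agree on coefficients and on the jet
variables. -/
theorem derivation_ext_C_X {M : Type*} [AddCommGroup M] [Module 𝕜 M] [Module (DiffPoly K) M]
    {D₁ D₂ : Derivation 𝕜 (DiffPoly K) M} (hC : ∀ c, D₁ (C c) = D₂ (C c))
    (hX : ∀ i j, D₁ (X (i, j)) = D₂ (X (i, j))) : D₁ = D₂ := by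
  ext p
  induction p using MvPolynomial.induction_on with
  | C c => exact hC c
  | add p q hp hq => rw [map_add, map_add, hp, hq]
  | mul_X p i hp => rw [Derivation.leibniz, Derivation.leibniz, hp, hX]

/-- Two derivations commute once they commute on coefficients and on the jet variables. -/
theorem derivation_comm_of_C_X {D₁ D₂ : Derivation 𝕜 (DiffPoly K) (DiffPoly K)}
    (hC : ∀ c, D₁ (D₂ (C c)) = D₂ (D₁ (C c)))
    (hX : ∀ i j, D₁ (D₂ (X (i, j))) = D₂ (D₁ (X (i, j)))) (p : DiffPoly K) :
    D₁ (D₂ p) = D₂ (D₁ p) := by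
  have h : ⁅D₁, D₂⁆ = 0 := by
    apply derivation_ext_C_X
    · intro c; rw [Derivation.commutator_apply, hC, sub_self]; rfl
    · intro i j; rw [Derivation.commutator_apply, hX, sub_self]; rfl
  have := DFunLike.congr_fun h p
  rwa [Derivation.commutator_apply, Derivation.zero_apply, sub_eq_zero] at this

theorem isFlow_evolutionary (dx : Derivation 𝕜 K K) (Q : Fin 2 → DiffPoly K) :
    IsFlow dx (evolutionary dx Q) := by
  refine derivation_comm_of_C_X (D₁ := (evolutionary dx Q).restrictScalars 𝕜) ?_ ?_
  · intro c; simp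
  · intro i j; simp [Function.iterate_succ_apply', -Function.iterate_succ]

theorem totalT_totalX (dx dt : Derivation 𝕜 K K) (hcomm : ∀ c, dx (dt c) = dt (dx c))
    (p : DiffPoly K) : totalT dx dt (totalX dx p) = totalX dx (totalT dx dt p) := by
  refine derivation_comm_of_C_X ?_ ?_ p
  · intro c; simp [hcomm]
  · intro i j; simp [Function.iterate_succ_apply', -Function.iterate_succ]

/-- A flow is determined by its values on `u` and `v`. -/
theorem IsFlow.ext {dx : Derivation 𝕜 K K} {D₁ D₂ : Derivation K (DiffPoly K) (DiffPoly K)}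
    (h₁ : IsFlow dx D₁) (h₂ : IsFlow dx D₂) (hu : D₁ (uu K) = D₂ (uu K))
    (hv : D₁ (vv K) = D₂ (vv K)) : D₁ = D₂ := by
  refine MvPolynomial.derivation_ext fun ⟨i, j⟩ => ?_
  induction j with
  | zero => fin_cases i <;> assumption
  | succ j ih => rw [← totalX_X dx, h₁, h₂, ih]

theorem pderiv_totalX_zero (dx : Derivation 𝕜 K K) (i : Fin 2) (p : DiffPoly K) :
    pderiv (i, 0) (totalX dx p) = totalX dx (pderiv (i, 0) p) := by
  refine derivation_comm_of_C_X (D₁ := (pderiv (i, 0)).restrictScalars 𝕜) ?_ ?_ p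
  · intro c; simp
  · intro k l
    simp only [Derivation.restrictScalars_apply, totalX_X, pderiv_X, Pi.single_apply, Prod.mk.injEq]
    split_ifs <;> simp_all

/-- The commutator of two derivations is a derivation, so comparison on generators suffices. The
extra term $\partial p/\partial w_j$ is what every later argument on orders exploits: $D_x$ shifts
the leading coefficient up by one. -/
theorem pderiv_totalX_succ (dx : Derivation 𝕜 K K) (i : Fin 2) (j : ℕ) (p : DiffPoly K) :
    pderiv (i, j + 1) (totalX dx p) = totalX dx (pderiv (i, j + 1) p) + pderiv (i, j) p := by
  have h : ⁅((pderiv (i, j + 1)).restrictScalars 𝕜 : Derivation 𝕜 (DiffPoly K) (DiffPoly K)),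
      totalX dx⁆ = (pderiv (i, j)).restrictScalars 𝕜 := by
    apply derivation_ext_C_X
    · intro c; simp [Derivation.commutator_apply]
    · intro k l
      simp only [Derivation.commutator_apply, Derivation.restrictScalars_apply, totalX_X, pderiv_X,
        Pi.single_apply, Prod.mk.injEq]
      split_ifs <;> simp_all
  have := DFunLike.congr_fun h p
  rw [Derivation.commutator_apply, sub_eq_iff_eq_add'] at this
  exact this

theorem constantCoeff_totalX (dx : Derivation 𝕜 K K) (p : DiffPoly K) :
    constantCoeff (totalX dx p) = dx (constantCoeff p) := by
  induction p using MvPolynomial.induction_on with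
  | C c => simp
  | add p q hp hq => simp [hp, hq]
  | mul_X p i hp => obtain ⟨i, j⟩ := i; simp [Derivation.leibniz]

theorem exists_forall_pderiv_eq_zero (p : DiffPoly K) :
    ∃ N, ∀ i j, N ≤ j → pderiv (i, j) p = 0 := by
  refine ⟨p.vars.sup (fun i => i.2 + 1), fun i j hj => pderiv_eq_zero_of_notMem_vars fun hmem => ?_⟩
  have := Finset.le_sup (f := fun i : Fin 2 × ℕ => i.2 + 1) hmem
  simp only at this
  omega

end Basic

/-! ### Kernels of the partial derivatives and of $D_x$ -/

section Domain

variable {𝕜 : Type*} [RCLike 𝕜] {K : Type u} [CommRing K] [IsDomain K] [Algebra 𝕜 K]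

open MvPolynomial

theorem charZero_of_algebra (𝕜 : Type*) [RCLike 𝕜] (K : Type*) [CommRing K] [IsDomain K]
    [Algebra 𝕜 K] : CharZero K :=
  charZero_of_injective_algebraMap (algebraMap 𝕜 K).injective

theorem eq_C_of_pderiv_eq_zero [CharZero K] {p : DiffPoly K}
    (h : ∀ i, pderiv i p = 0) : p = C (constantCoeff p) := by
  ext s
  rw [coeff_C]
  split_ifs with hs
  · rw [← hs]; rfl
  obtain ⟨i, hi⟩ : ∃ i, s i ≠ 0 := by
    by_contra! hne
    exact hs (Finsupp.ext fun i => (hne i).symm)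
  have hle : Finsupp.single i 1 ≤ s := Finsupp.single_le_iff.mpr (Nat.one_le_iff_ne_zero.mpr hi)
  have h1 := coeff_pderiv (i := i) p (s - Finsupp.single i 1)
  rw [h i, coeff_zero, tsub_add_cancel_of_le hle] at h1
  have h2 : (((s - Finsupp.single i 1 : Fin 2 × ℕ →₀ ℕ) i + 1 : ℕ) : K) ≠ 0 :=
    Nat.cast_ne_zero.mpr (Nat.succ_ne_zero _)
  push_cast at h2
  exact (mul_eq_zero.mp h1.symm).resolve_right h2

/-- If $D_xp=0$, the commutation rule gives $\partial p/\partial w_j=-D_x(\partial p/\partial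
w_{j+1})$. All partials of high order vanish, hence by downward induction on $j$ all partials do. -/
theorem eq_C_of_totalX_eq_zero (dx : Derivation 𝕜 K K) {p : DiffPoly K} (h : totalX dx p = 0) :
    p = C (constantCoeff p) ∧ dx (constantCoeff p) = 0 := by
  have := charZero_of_algebra 𝕜 K
  obtain ⟨N, hN⟩ := exists_forall_pderiv_eq_zero p
  have key : ∀ n, n ≤ N → ∀ i j, N - n ≤ j → pderiv (i, j) p = 0 := by
    intro n
    induction n with
    | zero => intro _ i j hj; exact hN i j hj
    | succ n ih =>
      intro hn i j hj
      have h1 := pderiv_totalX_succ dx i j p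
      rw [h, map_zero, ih (by omega) i (j + 1) (by omega), map_zero, zero_add] at h1
      exact h1.symm
  refine ⟨eq_C_of_pderiv_eq_zero fun i => key N le_rfl i.1 i.2 (by omega), ?_⟩
  rw [← constantCoeff_totalX, h, map_zero]

end Domain

/-! ## Derivations of the quotient field -/

open MvPolynomial

theorem algebraMap_frac_ne_zero {K : Type u} [CommRing K] {q : DiffPoly K} (hq : q ≠ 0) :
    algebraMap (DiffPoly K) (DiffFrac K) q ≠ 0 :=
  (map_ne_zero_iff _ (IsFractionRing.injective (DiffPoly K) (DiffFrac K))).mpr hq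

section Frac

variable {𝕜 : Type*} [RCLike 𝕜] {K : Type u} [CommRing K] [IsDomain K] [Algebra 𝕜 K]

theorem exists_frac_eq_div (z : DiffFrac K) : ∃ p q : DiffPoly K, q ≠ 0 ∧
    z = algebraMap (DiffPoly K) (DiffFrac K) p / algebraMap (DiffPoly K) (DiffFrac K) q := by
  obtain ⟨p, q, hq, rfl⟩ := IsFractionRing.div_surjective (A := DiffPoly K) z
  exact ⟨p, q, nonZeroDivisors.ne_zero hq, rfl⟩

@[simp]
theorem fracDer_algebraMap (d : Derivation 𝕜 (DiffPoly K) (DiffPoly K)) (p : DiffPoly K) :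
    fracDer d (algebraMap (DiffPoly K) (DiffFrac K) p) = algebraMap _ _ (d p) := by
  have h := fracDer_div d p 1 one_ne_zero
  simpa using h

theorem fracDer_add (d : Derivation 𝕜 (DiffPoly K) (DiffPoly K)) (y z : DiffFrac K) :
    fracDer d (y + z) = fracDer d y + fracDer d z := by
  obtain ⟨a, b, hb, rfl⟩ := exists_frac_eq_div y
  obtain ⟨p, q, hq, rfl⟩ := exists_frac_eq_div z
  have hb' := algebraMap_frac_ne_zero hb
  have hq' := algebraMap_frac_ne_zero hq
  rw [div_add_div _ _ hb' hq', ← map_mul, ← map_mul, ← map_mul, ← map_add,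
    fracDer_div d _ _ (mul_ne_zero hb hq), fracDer_div d _ _ hb, fracDer_div d _ _ hq]
  simp only [Derivation.leibniz, map_add, map_sub, map_mul, smul_eq_mul]
  field_simp
  ring

theorem fracDer_mul (d : Derivation 𝕜 (DiffPoly K) (DiffPoly K)) (y z : DiffFrac K) :
    fracDer d (y * z) = y * fracDer d z + z * fracDer d y := by
  obtain ⟨a, b, hb, rfl⟩ := exists_frac_eq_div y
  obtain ⟨p, q, hq, rfl⟩ := exists_frac_eq_div z
  have hb' := algebraMap_frac_ne_zero hb
  have hq' := algebraMap_frac_ne_zero hq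
  rw [div_mul_div_comm, ← map_mul, ← map_mul, fracDer_div d _ _ (mul_ne_zero hb hq),
    fracDer_div d _ _ hb, fracDer_div d _ _ hq]
  simp only [Derivation.leibniz, map_add, map_sub, map_mul, smul_eq_mul]
  field_simp
  ring

/-- The extension of a derivation to the quotient field, as a derivation. -/
def fracDeriv (d : Derivation 𝕜 (DiffPoly K) (DiffPoly K)) :
    Derivation 𝕜 (DiffFrac K) (DiffFrac K) :=
  Derivation.mk'
    { toFun := fracDer d
      map_add' := fracDer_add d
      map_smul' := fun c z => by
        have h : algebraMap 𝕜 (DiffFrac K) c =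
            algebraMap (DiffPoly K) (DiffFrac K) (algebraMap 𝕜 (DiffPoly K) c) :=
          IsScalarTower.algebraMap_apply _ _ _ _
        rw [RingHom.id_apply, Algebra.smul_def, Algebra.smul_def, fracDer_mul, h,
          fracDer_algebraMap, Derivation.map_algebraMap, map_zero, mul_zero, add_zero] }
    (fracDer_mul d)

theorem fracDer_eq_fracDeriv (d : Derivation 𝕜 (DiffPoly K) (DiffPoly K)) :
    fracDer d = fracDeriv d := rfl

@[simp]
theorem fracDeriv_algebraMap (d : Derivation 𝕜 (DiffPoly K) (DiffPoly K)) (p : DiffPoly K) :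
    fracDeriv d (algebraMap (DiffPoly K) (DiffFrac K) p) = algebraMap _ _ (d p) :=
  fracDer_algebraMap d p

/-- Derivations of the quotient field agree once they agree on coefficients and jet variables. -/
theorem fracDerivation_ext {M : Type*} [AddCommGroup M] [Module 𝕜 M] [Module (DiffFrac K) M]
    {D₁ D₂ : Derivation 𝕜 (DiffFrac K) M}
    (hC : ∀ c, D₁ (algebraMap (DiffPoly K) _ (C c)) = D₂ (algebraMap (DiffPoly K) _ (C c)))
    (hX : ∀ i j, D₁ (algebraMap (DiffPoly K) _ (X (i, j))) =
      D₂ (algebraMap (DiffPoly K) _ (X (i, j)))) : D₁ = D₂ := by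
  have hpoly : ∀ p : DiffPoly K, D₁ (algebraMap _ _ p) = D₂ (algebraMap _ _ p) := by
    intro p
    induction p using MvPolynomial.induction_on with
    | C c => exact hC c
    | add p q hp hq => rw [map_add, map_add, map_add, hp, hq]
    | mul_X p i hp => rw [map_mul, Derivation.leibniz, Derivation.leibniz, hp, hX]
  ext z
  obtain ⟨p, q, hq, rfl⟩ := exists_frac_eq_div z
  have hq' := algebraMap_frac_ne_zero hq
  -- The quotient rule in a module: apply the Leibniz rule to $(p/q)\cdot q=p$ and solve for the
  -- derivative of the fraction.
  have key : ∀ D : Derivation 𝕜 (DiffFrac K) M, algebraMap (DiffPoly K) (DiffFrac K) q •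
      D (algebraMap (DiffPoly K) (DiffFrac K) p / algebraMap (DiffPoly K) (DiffFrac K) q) =
      D (algebraMap (DiffPoly K) (DiffFrac K) p) -
      (algebraMap (DiffPoly K) (DiffFrac K) p / algebraMap (DiffPoly K) (DiffFrac K) q) •
        D (algebraMap (DiffPoly K) (DiffFrac K) q) := by
    intro D
    rw [eq_sub_iff_add_eq, add_comm, ← Derivation.leibniz, div_mul_cancel₀ _ hq']
  have h := (key D₁).trans (((key D₂).trans (by rw [hpoly, hpoly])).symm)
  exact (smul_right_inj hq').mp h

/-- The partial derivative with respect to a jet variable, on the quotient field. -/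
def fracPD (𝕜 : Type*) [RCLike 𝕜] (K : Type u) [CommRing K] [IsDomain K] [Algebra 𝕜 K]
    (i : Fin 2 × ℕ) : Derivation 𝕜 (DiffFrac K) (DiffFrac K) :=
  fracDeriv ((pderiv i).restrictScalars 𝕜)

@[simp]
theorem fracPD_algebraMap (i : Fin 2 × ℕ) (p : DiffPoly K) :
    fracPD 𝕜 K i (algebraMap (DiffPoly K) (DiffFrac K) p) = algebraMap _ _ (pderiv i p) :=
  fracDeriv_algebraMap _ p

theorem exists_forall_fracPD_eq_zero (z : DiffFrac K) :
    ∃ N, ∀ i j, N ≤ j → fracPD 𝕜 K (i, j) z = 0 := by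
  obtain ⟨p, q, hq, rfl⟩ := exists_frac_eq_div z
  obtain ⟨N, hN⟩ := exists_forall_pderiv_eq_zero p
  obtain ⟨M, hM⟩ := exists_forall_pderiv_eq_zero q
  refine ⟨max N M, fun i j hj => ?_⟩
  change fracDer _ _ = 0
  rw [fracDer_div _ _ _ hq]
  simp [hN i j (le_of_max_le_left hj), hM i j (le_of_max_le_right hj)]

/-- The total `x`-derivative of the quotient field. -/
abbrev fracX (dx : Derivation 𝕜 K K) : Derivation 𝕜 (DiffFrac K) (DiffFrac K) :=
  fracDeriv (totalX dx)

/-- The total `t`-derivative of the quotient field. -/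
abbrev fracT (dx dt : Derivation 𝕜 K K) : Derivation 𝕜 (DiffFrac K) (DiffFrac K) :=
  fracDeriv (totalT dx dt)

theorem fracDerivation_comm {D₁ D₂ : Derivation 𝕜 (DiffPoly K) (DiffPoly K)}
    (h : ∀ p, D₁ (D₂ p) = D₂ (D₁ p)) (z : DiffFrac K) :
    fracDeriv D₁ (fracDeriv D₂ z) = fracDeriv D₂ (fracDeriv D₁ z) := by
  have h : ⁅fracDeriv D₁, fracDeriv D₂⁆ = 0 := by
    apply fracDerivation_ext
    · intro c; simp [Derivation.commutator_apply, h]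
    · intro i j; simp [Derivation.commutator_apply, h]
  have := DFunLike.congr_fun h z
  rwa [Derivation.commutator_apply, Derivation.zero_apply, sub_eq_zero] at this

theorem fracT_fracX (dx dt : Derivation 𝕜 K K) (hcomm : ∀ c, dx (dt c) = dt (dx c))
    (z : DiffFrac K) : fracT dx dt (fracX dx z) = fracX dx (fracT dx dt z) :=
  fracDerivation_comm (totalT_totalX dx dt hcomm) z

theorem fracPD_fracX_zero (dx : Derivation 𝕜 K K) (i : Fin 2) (z : DiffFrac K) :
    fracPD 𝕜 K (i, 0) (fracX dx z) = fracX dx (fracPD 𝕜 K (i, 0) z) :=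
  fracDerivation_comm (D₁ := (pderiv (i, 0)).restrictScalars 𝕜) (pderiv_totalX_zero dx i) z

theorem fracPD_fracX_succ (dx : Derivation 𝕜 K K) (i : Fin 2) (j : ℕ) (z : DiffFrac K) :
    fracPD 𝕜 K (i, j + 1) (fracX dx z) =
      fracX dx (fracPD 𝕜 K (i, j + 1) z) + fracPD 𝕜 K (i, j) z := by
  have h : ⁅fracPD 𝕜 K (i, j + 1), fracX dx⁆ = fracPD 𝕜 K (i, j) := by
    apply fracDerivation_ext
    · intro c; simp [Derivation.commutator_apply]
    · intro k l; simp [Derivation.commutator_apply, pderiv_totalX_succ, -totalX_X]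
  have := DFunLike.congr_fun h z
  rwa [Derivation.commutator_apply, sub_eq_iff_eq_add'] at this

/-! ## Symbols and the adjoint pairing -/

/-- The symbol of the linearization of `z` in direction `i`: the partial derivatives with respect
to the `j`-th derivative of the `i`-th unknown, as a finitely supported family in `j`. -/
def symbol (𝕜 : Type*) [RCLike 𝕜] {K : Type u} [CommRing K] [IsDomain K] [Algebra 𝕜 K]
    (i : Fin 2) : Derivation 𝕜 (DiffFrac K) (ℕ →₀ DiffFrac K) :=
  Derivation.mk'
    { toFun := fun z => Finsupp.ofSupportFinite (fun j => fracPD 𝕜 K (i, j) z) (by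
        obtain ⟨N, hN⟩ := exists_forall_fracPD_eq_zero (𝕜 := 𝕜) z
        refine (Finset.range N).finite_toSet.subset fun j hj => ?_
        by_contra h
        exact hj (hN i j (by simpa using h)))
      map_add' := fun y z => by ext j; simp [Finsupp.ofSupportFinite_coe]
      map_smul' := fun c z => by ext j; simp [Finsupp.ofSupportFinite_coe] }
    (fun y z => by ext j; simp [Finsupp.ofSupportFinite_coe])

@[simp]
theorem symbol_apply (i : Fin 2) (z : DiffFrac K) (j : ℕ) :
    symbol 𝕜 i z j = fracPD 𝕜 K (i, j) z := rfl

theorem symbol_X (i k : Fin 2) (l : ℕ) :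
    symbol 𝕜 i (algebraMap (DiffPoly K) (DiffFrac K) (X (k, l))) =
      if i = k then Finsupp.single l 1 else 0 := by
  ext j
  rw [symbol_apply, fracPD_algebraMap, pderiv_X]
  by_cases h : i = k
  · subst h
    by_cases hj : j = l
    · subst hj; simp
    · rw [if_pos rfl, Finsupp.single_eq_of_ne hj, Pi.single_eq_of_ne, map_zero]
      simpa using fun h => hj h.symm
  · rw [if_neg h, Pi.single_eq_of_ne, map_zero]; rfl
    simpa using fun h' : k = i => absurd h'.symm h

theorem symbol_fracX (dx : Derivation 𝕜 K K) (i : Fin 2) (z : DiffFrac K) :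
    symbol 𝕜 i (fracX dx z) = (symbol 𝕜 i z).mapRange (fracX dx) (map_zero _) +
      (symbol 𝕜 i z).mapDomain Nat.succ := by
  ext j
  cases j with
  | zero =>
    rw [Finsupp.add_apply, Finsupp.mapRange_apply, Finsupp.mapDomain_of_notMem_range _ _ (by simp),
      symbol_apply, symbol_apply, fracPD_fracX_zero, add_zero]
  | succ j =>
    rw [Finsupp.add_apply, Finsupp.mapRange_apply,
      Finsupp.mapDomain_apply Nat.succ_injective, symbol_apply, symbol_apply, symbol_apply,
      fracPD_fracX_succ]

/-- The sum on the right is the chain rule for the evolutionary field. The commutator and the sum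
are both derivations of the quotient field (this is why `symbol` is packaged as a derivation), so it
suffices to compare them on $K$ and on the jet variables. -/
theorem fracPD_fracT (dx dt : Derivation 𝕜 K K) (i : Fin 2 × ℕ) (z : DiffFrac K) :
    fracPD 𝕜 K i (fracT dx dt z) = fracT dx dt (fracPD 𝕜 K i z) +
      ∑ k, (symbol 𝕜 k z).sum fun l a => a *
        fracPD 𝕜 K i (algebraMap _ _ ((totalX dx)^[l] (burgersField dx k))) := by
  have h : ⁅fracPD 𝕜 K i, fracT dx dt⁆ = ∑ k, (Finsupp.linearCombination (DiffFrac K) (fun l =>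
      fracPD 𝕜 K i (algebraMap _ _ ((totalX dx)^[l] (burgersField dx k))))).compDer
        (symbol 𝕜 k) := by
    apply fracDerivation_ext
    · intro c
      have : ∀ k, symbol 𝕜 k (algebraMap (DiffPoly K) (DiffFrac K) (C c)) = 0 := by
        intro k; ext j; simp
      simp [Derivation.commutator_apply, this]
    · intro k l
      have : fracT dx dt (fracPD 𝕜 K i (algebraMap (DiffPoly K) (DiffFrac K) (X (k, l)))) = 0 := by
        rw [fracPD_algebraMap, pderiv_X]
        by_cases h : i = (k, l)
        · subst h; simp
        · rw [Pi.single_eq_of_ne (fun h' => h h'.symm)]; simp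
      rw [Derivation.commutator_apply, this, sub_zero, fracDeriv_algebraMap, totalT_X]
      fin_cases k <;> simp [symbol_X]
  have := DFunLike.congr_fun h z
  rw [Derivation.commutator_apply, sub_eq_iff_eq_add'] at this
  rw [this]
  simp [Finsupp.linearCombination_apply]

end Frac

open MvPolynomial

/-! ### The Euler operator and the adjoint linearized system -/

section Euler

variable {𝕜 : Type*} [RCLike 𝕜] {K : Type u} [CommRing K] [IsDomain K] [Algebra 𝕜 K]

/-- The operator `-D_x` on the quotient field. -/
def negX (dx : Derivation 𝕜 K K) : Module.End 𝕜 (DiffFrac K) :=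
  -(fracX dx : DiffFrac K →ₗ[𝕜] DiffFrac K)

@[simp]
theorem negX_apply (dx : Derivation 𝕜 K K) (z : DiffFrac K) : negX dx z = -fracX dx z := rfl

/-- Apply the formal adjoint of the differential operator with the given symbol to `h`. -/
def adjointApply (dx : Derivation 𝕜 K K) (h : DiffFrac K) :
    (ℕ →₀ DiffFrac K) →ₗ[𝕜] DiffFrac K :=
  Finsupp.lsum 𝕜 fun j => (negX dx ^ j) ∘ₗ LinearMap.mulLeft 𝕜 h

@[simp]
theorem adjointApply_single (dx : Derivation 𝕜 K K) (h a : DiffFrac K) (j : ℕ) :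
    adjointApply dx h (Finsupp.single j a) = (negX dx ^ j) (h * a) := by
  simp [adjointApply]

theorem adjointApply_eq_sum (dx : Derivation 𝕜 K K) (h : DiffFrac K) (P : ℕ →₀ DiffFrac K) :
    adjointApply dx h P = P.sum fun j a => (negX dx ^ j) (h * a) := by
  simp [adjointApply, Finsupp.lsum_apply, Function.comp_def]

theorem adjointApply_zero_left (dx : Derivation 𝕜 K K) (P : ℕ →₀ DiffFrac K) :
    adjointApply dx 0 P = 0 := by
  simp [adjointApply_eq_sum]

theorem adjointApply_add_left (dx : Derivation 𝕜 K K) (h₁ h₂ : DiffFrac K)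
    (P : ℕ →₀ DiffFrac K) :
    adjointApply dx (h₁ + h₂) P = adjointApply dx h₁ P + adjointApply dx h₂ P := by
  simp [adjointApply_eq_sum, add_mul, Finsupp.sum_add]

/-- Integration by parts: the adjoint of `D_x ∘ P` is `P* ∘ (-D_x)`. -/
theorem adjointApply_symbol_fracX (dx : Derivation 𝕜 K K) (i : Fin 2) (z h : DiffFrac K) :
    adjointApply dx h (symbol 𝕜 i (fracX dx z)) =
      adjointApply dx (negX dx h) (symbol 𝕜 i z) := by
  rw [symbol_fracX]
  induction symbol 𝕜 i z using Finsupp.induction_linear with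
  | zero => simp
  | add P Q hP hQ =>
    rw [Finsupp.mapRange_add (map_add _), Finsupp.mapDomain_add, map_add (adjointApply dx _) P Q,
      ← hP, ← hQ]
    simp only [map_add]
    abel
  | single j a =>
    rw [Finsupp.mapRange_single, Finsupp.mapDomain_single, map_add, adjointApply_single,
      adjointApply_single, adjointApply_single, pow_succ, Module.End.mul_apply, ← map_add]
    congr 1
    simp [mul_comm]

theorem adjointApply_symbol_iterate (dx : Derivation 𝕜 K K) (i : Fin 2) (p : DiffPoly K) (l : ℕ)
    (h : DiffFrac K) :
    adjointApply dx h (symbol 𝕜 i (algebraMap _ _ ((totalX dx)^[l] p))) =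
      adjointApply dx ((negX dx ^ l) h) (symbol 𝕜 i (algebraMap _ _ p)) := by
  induction l generalizing h with
  | zero => rfl
  | succ l ih =>
    rw [Function.iterate_succ_apply', ← fracDeriv_algebraMap, adjointApply_symbol_fracX, ih,
      pow_succ, Module.End.mul_apply]

/-- The Euler operator. -/
theorem grad_eq_adjointApply (dx : Derivation 𝕜 K K) (i : Fin 2) (z : DiffFrac K) :
    grad dx i z = adjointApply dx 1 (symbol 𝕜 i z) := by
  have hterm : ∀ (j : ℕ) (a : DiffFrac K), (negX dx ^ j) a = (-1) ^ j * (fracX dx)^[j] a := by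
    intro j a
    induction j with
    | zero => simp
    | succ j ih =>
      rw [pow_succ', Module.End.mul_apply, ih, negX_apply, Derivation.leibniz,
        Function.iterate_succ_apply', Derivation.leibniz_pow]
      simp [pow_succ]
  rw [adjointApply_eq_sum, Finsupp.sum, grad]
  rw [finsum_eq_sum_of_support_subset (s := (symbol 𝕜 i z).support)]
  · refine Finset.sum_congr rfl fun j _ => ?_
    rw [hterm, one_mul]
    rfl
  · intro j hj
    rw [Finset.mem_coe, Finsupp.mem_support_iff]
    intro h0
    apply hj
    rw [symbol_apply] at h0
    change (-1) ^ j * (fracX dx)^[j] (fracPD 𝕜 K (i, j) z) = 0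
    rw [h0, ← hterm, map_zero]

/-- Integration by parts moves $D_x$ onto the constant 1, where it vanishes. -/
theorem grad_fracX (dx : Derivation 𝕜 K K) (i : Fin 2) (z : DiffFrac K) :
    grad dx i (fracX dx z) = 0 := by
  rw [grad_eq_adjointApply, adjointApply_symbol_fracX, negX_apply, Derivation.map_one_eq_zero,
    neg_zero, adjointApply_zero_left]

theorem grad_add (dx : Derivation 𝕜 K K) (i : Fin 2) (y z : DiffFrac K) :
    grad dx i (y + z) = grad dx i y + grad dx i z := by
  simp [grad_eq_adjointApply]

/-- The gradient of the `t`-derivative: `E(D_t γ) = D_t (E γ) + (adjoint linearized field) (E γ)`. -/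
theorem grad_fracT (dx dt : Derivation 𝕜 K K) (hcomm : ∀ c, dx (dt c) = dt (dx c)) (i : Fin 2)
    (z : DiffFrac K) :
    grad dx i (fracT dx dt z) = fracT dx dt (grad dx i z) +
      ∑ k, adjointApply dx (grad dx k z) (symbol 𝕜 i (algebraMap _ _ (burgersField dx k))) := by
  have hsym : symbol 𝕜 i (fracT dx dt z) =
      (symbol 𝕜 i z).mapRange (fracT dx dt) (map_zero _) +
      ∑ k, (symbol 𝕜 k z).sum fun l a =>
        a • symbol 𝕜 i (algebraMap _ _ ((totalX dx)^[l] (burgersField dx k))) := by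
    ext j
    rw [symbol_apply, fracPD_fracT]
    simp [Finsupp.sum]
  -- The adjoint of $a\circ P$ is $P^*\circ a$; evaluated at 1 it is $P^*a$.
  have hsmul : ∀ (a : DiffFrac K) (P : ℕ →₀ DiffFrac K),
      adjointApply dx 1 (a • P) = adjointApply dx a P := by
    intro a P
    induction P using Finsupp.induction_linear with
    | zero => simp
    | add P Q hP hQ => rw [smul_add, map_add, hP, hQ, map_add]
    | single j b => simp [-Finsupp.single_mul]
  have hcommA : ∀ (j : ℕ) (a : DiffFrac K),
      (negX dx ^ j) (fracT dx dt a) = fracT dx dt ((negX dx ^ j) a) := by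
    intro j a
    induction j with
    | zero => simp
    | succ j ih =>
      rw [pow_succ', Module.End.mul_apply, Module.End.mul_apply, ih, negX_apply, negX_apply,
        map_neg, fracT_fracX dx dt hcomm]
  have hrange : ∀ P : ℕ →₀ DiffFrac K,
      adjointApply dx 1 (P.mapRange (fracT dx dt) (map_zero _)) =
        fracT dx dt (adjointApply dx 1 P) := by
    intro P
    induction P using Finsupp.induction_linear with
    | zero => simp
    | add P Q hP hQ => rw [Finsupp.mapRange_add (map_add _), map_add, hP, hQ, map_add, map_add]
    | single j b => simp [hcommA]
  rw [grad_eq_adjointApply, hsym, map_add, hrange, ← grad_eq_adjointApply, map_sum]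
  congr 1
  refine Finset.sum_congr rfl fun k _ => ?_
  rw [map_finsuppSum, grad_eq_adjointApply, adjointApply_eq_sum dx 1]
  simp only [hsmul, adjointApply_symbol_iterate, one_mul]
  -- Additivity in the left argument collects the terms $(-D_x)^l a_l$ into the gradient itself.
  let Φ : DiffFrac K →+ DiffFrac K :=
    { toFun := fun h => adjointApply dx h (symbol 𝕜 i (algebraMap _ _ (burgersField dx k)))
      map_zero' := adjointApply_zero_left dx _
      map_add' := fun x y => adjointApply_add_left dx x y _ }
  exact (map_finsuppSum Φ (symbol 𝕜 k z) fun l a => (negX dx ^ l) a).symm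

/-- The jet variables as elements of the quotient field. -/
abbrev jet (K : Type u) [CommRing K] (i : Fin 2) (j : ℕ) : DiffFrac K :=
  algebraMap (DiffPoly K) (DiffFrac K) (X (i, j))

@[simp]
theorem fracX_jet (dx : Derivation 𝕜 K K) (i : Fin 2) (j : ℕ) :
    fracX dx (jet K i j) = jet K i (j + 1) := by
  simp

/-- The equations satisfied by the gradient of a rational conserved density. -/
theorem grad_equations (dx dt : Derivation 𝕜 K K) (hcomm : ∀ c, dx (dt c) = dt (dx c))
    {γ ρ : DiffFrac K} (h : fracT dx dt γ + fracX dx ρ = 0) :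
    (fracT dx dt (grad dx 0 γ) + fracX dx (fracX dx (grad dx 0 γ))
      - 2 * jet K 0 0 * fracX dx (grad dx 0 γ) - jet K 1 0 * fracX dx (grad dx 1 γ) = 0) ∧
    (fracT dx dt (grad dx 1 γ) - fracX dx (grad dx 0 γ)
      - jet K 0 0 * fracX dx (grad dx 1 γ) = 0) := by
  have hE : ∀ i, fracT dx dt (grad dx i γ) +
      ∑ k, adjointApply dx (grad dx k γ) (symbol 𝕜 i (algebraMap _ _ (burgersField dx k))) = 0 := by
    intro i
    rw [← grad_fracT dx dt hcomm, eq_neg_of_add_eq_zero_left h, ← map_neg, grad_fracX]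
  have h0 := hE 0
  have h1 := hE 1
  have two : ∀ i, symbol 𝕜 i (2 : DiffFrac K) = 0 := fun i => by
    have := Derivation.map_natCast (symbol 𝕜 (K := K) i) 2
    simpa using this
  simp only [Fin.sum_univ_two, burgersField_zero, burgersField_one, map_add, map_mul, map_ofNat,
    Derivation.leibniz, symbol_X, two, Finsupp.smul_single, smul_eq_mul, mul_one, smul_zero,
    add_zero, zero_add, if_true, zero_ne_one, one_ne_zero, if_false, adjointApply_single, pow_zero,
    pow_one, pow_two, Module.End.mul_apply, Module.End.one_apply, negX_apply, map_neg, neg_neg,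
    fracX_jet] at h0 h1
  constructor
  · have e2 : fracX dx (2 : DiffFrac K) = 0 := by
      have := Derivation.map_natCast (fracX dx) 2
      simpa using this
    simp only [e2, mul_zero] at h0
    linear_combination h0
  · linear_combination h1

end Euler

open MvPolynomial

/-! ## A weighted degree -/

section Weight

variable {K : Type u} [CommRing K]

/-- The weights: each `u_j` has weight `1` and each `v_j` has weight `2`. -/
def jetWeight (i : Fin 2 × ℕ) : ℕ := i.1 + 1

/-- Scale every jet variable by the power of an auxiliary variable given by its weight. -/
def scaling (K : Type u) [CommRing K] : DiffPoly K →ₐ[K] Polynomial (DiffPoly K) :=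
  aeval fun i => Polynomial.monomial (jetWeight i) (X i)

theorem scaling_X (i : Fin 2 × ℕ) :
    scaling K (X i) = Polynomial.monomial (jetWeight i) (X i) := by
  simp [scaling]

theorem scaling_monomial (s : Fin 2 × ℕ →₀ ℕ) (c : K) :
    scaling K (monomial s c) =
      Polynomial.monomial (Finsupp.weight jetWeight s) (monomial s c) := by
  induction s using Finsupp.induction_linear generalizing c with
  | zero =>
    rw [map_zero, Polynomial.monomial_zero_left]
    exact (scaling K).commutes c
  | add s t hs ht =>
    rw [← mul_one c, ← monomial_mul, map_mul, hs, ht, map_add, Polynomial.monomial_mul_monomial]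
  | single i n =>
    rw [← C_mul_X_pow_eq_monomial, map_mul, map_pow, scaling_X, Polynomial.monomial_pow,
      Finsupp.weight_single, smul_eq_mul, mul_comm n]
    have : scaling K (C c) = Polynomial.C (C c) := (scaling K).commutes c
    rw [this, Polynomial.C_mul_monomial]

/-- The coefficients of the scaled polynomial are the weighted homogeneous components. This
identifies `wdeg` with the maximal weight of a monomial while keeping it a `natDegree`. -/
theorem coeff_scaling (p : DiffPoly K) (n : ℕ) (s : Fin 2 × ℕ →₀ ℕ) :
    ((scaling K p).coeff n).coeff s =
      if Finsupp.weight jetWeight s = n then p.coeff s else 0 := by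
  induction p using MvPolynomial.induction_on' with
  | monomial t c =>
    rw [scaling_monomial, Polynomial.coeff_monomial, coeff_monomial]
    by_cases hts : t = s
    · subst hts
      by_cases hn : Finsupp.weight jetWeight t = n <;> simp [hn]
    · split_ifs <;> simp [hts]
  | add p q hp hq =>
    rw [map_add, Polynomial.coeff_add, coeff_add, hp, hq, coeff_add]
    split_ifs <;> simp

theorem scaling_injective : Function.Injective (scaling K) := by
  intro p q h
  ext s
  have := congrArg (fun P => (P.coeff (Finsupp.weight jetWeight s)).coeff s) h
  simpa [coeff_scaling] using this

/-- The weighted degree of a differential polynomial. -/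
def wdeg (p : DiffPoly K) : ℕ := (scaling K p).natDegree

theorem wdeg_le_iff {p : DiffPoly K} {n : ℕ} :
    wdeg p ≤ n ↔ ∀ s ∈ p.support, Finsupp.weight jetWeight s ≤ n := by
  rw [wdeg, Polynomial.natDegree_le_iff_coeff_eq_zero]
  constructor
  · intro h s hs
    by_contra! hlt
    have := congrArg (coeff s) (h _ hlt)
    rw [coeff_scaling, if_pos rfl, coeff_zero] at this
    exact mem_support_iff.mp hs this
  · intro h m hm
    ext s
    rw [coeff_scaling, coeff_zero]
    split_ifs with hs
    · by_contra hne
      have := h s (mem_support_iff.mpr hne)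
      omega
    · rfl

theorem wdeg_C (c : K) : wdeg (C c : DiffPoly K) = 0 := by
  have : scaling K (C c) = Polynomial.C (C c) := (scaling K).commutes c
  rw [wdeg, this, Polynomial.natDegree_C]

theorem wdeg_X_le (i : Fin 2 × ℕ) : wdeg (X i : DiffPoly K) ≤ jetWeight i := by
  rw [wdeg, scaling_X]
  exact Polynomial.natDegree_monomial_le _

theorem wdeg_add_le {p q : DiffPoly K} {n : ℕ} (hp : wdeg p ≤ n) (hq : wdeg q ≤ n) :
    wdeg (p + q) ≤ n := by
  rw [wdeg, map_add]
  exact Polynomial.natDegree_add_le_of_degree_le hp hq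

theorem wdeg_sub_le {p q : DiffPoly K} {n : ℕ} (hp : wdeg p ≤ n) (hq : wdeg q ≤ n) :
    wdeg (p - q) ≤ n := by
  rw [wdeg, map_sub]
  exact Polynomial.natDegree_sub_le_of_le hp hq |>.trans (max_self n).le

theorem wdeg_mul_le {p q : DiffPoly K} {m n : ℕ} (hp : wdeg p ≤ m) (hq : wdeg q ≤ n) :
    wdeg (p * q) ≤ m + n := by
  rw [wdeg, map_mul]
  exact Polynomial.natDegree_mul_le_of_le hp hq

theorem wdeg_sum_le {ι : Type*} (S : Finset ι) (f : ι → DiffPoly K) {n : ℕ}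
    (h : ∀ i ∈ S, wdeg (f i) ≤ n) : wdeg (∑ i ∈ S, f i) ≤ n := by
  rw [wdeg, map_sum]
  exact Polynomial.natDegree_sum_le_of_forall_le S _ h

variable [IsDomain K]

/-- Additivity is inherited from the degree of univariate polynomials over a domain; realizing the
weight through `scaling` makes this immediate. -/
theorem wdeg_mul {p q : DiffPoly K} (hp : p ≠ 0) (hq : q ≠ 0) :
    wdeg (p * q) = wdeg p + wdeg q := by
  rw [wdeg, map_mul, Polynomial.natDegree_mul] <;>
    first | rfl | rwa [map_ne_zero_iff _ scaling_injective]

theorem wdeg_X (i : Fin 2 × ℕ) : wdeg (X i : DiffPoly K) = jetWeight i := by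
  rw [wdeg, scaling_X]
  exact Polynomial.natDegree_monomial_eq _ (X_ne_zero i)

variable {𝕜 : Type*} [RCLike 𝕜] [Algebra 𝕜 K]

/-- A derivation that raises the weight of coefficients and variables by at most `e` raises the
weighted degree by at most `e`. -/
theorem wdeg_derivation_le (D : Derivation 𝕜 (DiffPoly K) (DiffPoly K)) {e : ℕ}
    (hC : ∀ c, wdeg (D (C c)) ≤ e) (hX : ∀ i, wdeg (D (X i)) ≤ jetWeight i + e)
    (p : DiffPoly K) : wdeg (D p) ≤ wdeg p + e := by
  have hmono : ∀ s c, wdeg (D (monomial s c)) ≤ wdeg (monomial s c : DiffPoly K) + e := by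
    refine MvPolynomial.induction_on_monomial (fun c => ?_) (fun p i hp => ?_)
    · rw [wdeg_C, zero_add]; exact hC c
    · rcases eq_or_ne p 0 with rfl | hp0
      · simp [wdeg]
      · rw [wdeg_mul hp0 (X_ne_zero i), wdeg_X, Derivation.leibniz, smul_eq_mul, smul_eq_mul]
        refine wdeg_add_le ?_ ?_
        · exact (wdeg_mul_le le_rfl (hX i)).trans (by omega)
        · exact (wdeg_mul_le (wdeg_X_le i) hp).trans (by omega)
  conv_lhs => rw [p.as_sum, map_sum]
  refine wdeg_sum_le _ _ fun s hs => (hmono _ _).trans (Nat.add_le_add_right ?_ e)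
  rw [wdeg_le_iff]
  intro t ht
  have := (support_monomial_subset ht)
  rw [Finset.mem_singleton.mp this]
  exact wdeg_le_iff.mp le_rfl s hs

theorem wdeg_totalX_le (dx : Derivation 𝕜 K K) (p : DiffPoly K) :
    wdeg (totalX dx p) ≤ wdeg p := by
  refine wdeg_derivation_le (totalX dx) (e := 0) (fun c => ?_) (fun i => ?_) p
  · rw [totalX_C, wdeg_C]
  · rw [← Prod.mk.eta (p := i), totalX_X, wdeg_X]; rfl

theorem wdeg_iterate_totalX_le (dx : Derivation 𝕜 K K) (p : DiffPoly K) (l : ℕ) :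
    wdeg ((totalX dx)^[l] p) ≤ wdeg p := by
  induction l with
  | zero => rfl
  | succ l ih => rw [Function.iterate_succ_apply']; exact (wdeg_totalX_le dx _).trans ih

theorem wdeg_burgersField_le (dx : Derivation 𝕜 K K) (k : Fin 2) :
    wdeg (burgersField dx k) ≤ k + 2 := by
  have h2 : wdeg (2 : DiffPoly K) ≤ 0 := by
    have := wdeg_C (2 : K)
    rw [map_ofNat] at this
    exact this.le
  fin_cases k
  · change wdeg (burgersField dx 0) ≤ 0 + 2
    rw [burgersField_zero]
    refine wdeg_add_le (wdeg_add_le ?_ ?_) ?_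
    · rw [wdeg_X]; simp [jetWeight]
    · exact (wdeg_mul_le (wdeg_mul_le h2 (wdeg_X_le _)) (wdeg_X_le _)).trans (by simp [jetWeight])
    · rw [wdeg_X]; simp [jetWeight]
  · change wdeg (burgersField dx 1) ≤ 1 + 2
    rw [burgersField_one]
    refine wdeg_add_le ?_ ?_ <;>
      exact (wdeg_mul_le (wdeg_X_le _) (wdeg_X_le _)).trans (by simp [jetWeight])

/-- With weights 1 for $u_j$ and 2 for $v_j$, the terms $uu_x$, $v_x$ in $u_t$ have weight 2 and the
terms of $v_t$ have weight 3. Thus $D_t$ raises weight by at most 1, as does multiplication by $u$;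
$D_x$ itself does not raise it. -/
theorem wdeg_transport_le (dx dt : Derivation 𝕜 K K) (p : DiffPoly K) :
    wdeg (totalT dx dt p - uu K * totalX dx p) ≤ wdeg p + 1 := by
  refine wdeg_derivation_le (totalT dx dt - uu K • totalX dx) (fun c => ?_) (fun i => ?_) p
  · have : (totalT dx dt - uu K • totalX dx) (C c : DiffPoly K) =
        C (dt c) - X (0, 0) * C (dx c) := by simp [uu]
    rw [this]
    refine wdeg_sub_le ((wdeg_C _).le.trans (by omega)) ?_
    exact (wdeg_mul_le (wdeg_X_le _) (wdeg_C _).le).trans (by simp [jetWeight])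
  · obtain ⟨i, j⟩ := i
    have : (totalT dx dt - uu K • totalX dx) (X (i, j) : DiffPoly K) =
        (totalX dx)^[j] (burgersField dx i) - X (0, 0) * X (i, j + 1) := by simp [uu]
    rw [this]
    refine wdeg_sub_le ?_ ?_
    · exact (wdeg_iterate_totalX_le dx _ j).trans (wdeg_burgersField_le dx i)
    · refine (wdeg_mul_le (wdeg_X_le _) (wdeg_X_le _)).trans ?_
      simp only [jetWeight, Fin.val_zero]
      omega

/-- The transport equation `(D_t - u D_x) G = (2 v - c u_x) G` has no nonzero rational solution. -/
theorem eq_zero_of_transport (dx dt : Derivation 𝕜 K K) (c : ℕ) {G : DiffFrac K}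
    (h : fracT dx dt G - jet K 0 0 * fracX dx G = (2 * jet K 1 0 - c * jet K 0 1) * G) : G = 0 := by
  have := charZero_of_algebra 𝕜 K
  obtain ⟨a, b, hb, rfl⟩ := exists_frac_eq_div G
  have hb' := algebraMap_frac_ne_zero hb
  suffices a = 0 by rw [this, map_zero, zero_div]
  by_contra ha
  -- The transport equation for $G=a/b$ after clearing denominators.
  have hpoly : (totalT dx dt a - uu K * totalX dx a) * b
      - a * (totalT dx dt b - uu K * totalX dx b) =
      (2 * (X (1, 0) : DiffPoly K) - (c : DiffPoly K) * X (0, 1)) * (a * b) := by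
    apply IsFractionRing.injective (DiffPoly K) (DiffFrac K)
    rw [← fracDer_eq_fracDeriv, ← fracDer_eq_fracDeriv, fracDer_div _ _ _ hb,
      fracDer_div _ _ _ hb] at h
    simp only [map_sub, map_mul, map_natCast, map_ofNat] at h ⊢
    field_simp at h
    have e : algebraMap (DiffPoly K) (DiffFrac K) (uu K) = jet K 0 0 := rfl
    rw [e]
    linear_combination h
  set m : DiffPoly K := 2 * (X (1, 0) : DiffPoly K) - (c : DiffPoly K) * X (0, 1) with hm
  -- The factor has weight 2 because of its term $2v$, which is nonzero in characteristic zero; the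
  -- $u_x$ term has weight 1 only.
  have hcoeff : (scaling K m).coeff 2 ≠ 0 := by
    intro h0
    have h1 := congrArg (coeff (Finsupp.single (1, 0) 1)) h0
    have hne : ¬ (Finsupp.single ((0 : Fin 2), 1) 1 : Fin 2 × ℕ →₀ ℕ) =
        Finsupp.single (1, 0) 1 := by
      rw [Finsupp.single_left_inj one_ne_zero]; simp
    have e2 : (2 : DiffPoly K) = C 2 := (map_ofNat _ 2).symm
    have ec : (c : DiffPoly K) = C (c : K) := (map_natCast _ c).symm
    have hw : Finsupp.weight jetWeight (Finsupp.single ((1 : Fin 2), 0) 1 : Fin 2 × ℕ →₀ ℕ) = 2 := by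
      rw [Finsupp.weight_single]; rfl
    rw [coeff_scaling, if_pos hw, coeff_zero, hm, e2, ec, coeff_sub,
      coeff_C_mul, coeff_C_mul, coeff_X, coeff_X, if_neg hne] at h1
    simp at h1
  have hm2 : 2 ≤ wdeg m := Polynomial.le_natDegree_of_ne_zero hcoeff
  have hm0 : m ≠ 0 := fun h0 => hcoeff (by rw [h0, map_zero, Polynomial.coeff_zero])
  -- The right side has weight at least $\operatorname{wdeg}a+\operatorname{wdeg}b+2$, the left side
  -- at most $\operatorname{wdeg}a+\operatorname{wdeg}b+1$.
  have h1 := congrArg wdeg hpoly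
  rw [wdeg_mul hm0 (mul_ne_zero ha hb), wdeg_mul ha hb] at h1
  have h2 := wdeg_sub_le (n := wdeg a + wdeg b + 1)
    ((wdeg_mul_le (wdeg_transport_le dx dt a) (le_refl (wdeg b))).trans (by omega))
    ((wdeg_mul_le (le_refl (wdeg a)) (wdeg_transport_le dx dt b)).trans (by omega))
  omega

end Weight

open MvPolynomial

/-! ## Leading coefficients of the prolonged Burgers field -/

section Order

variable {𝕜 : Type*} [RCLike 𝕜] {K : Type u} [CommRing K] [Algebra 𝕜 K]

theorem pderiv_iterate_of_lt (dx : Derivation 𝕜 K K) {i : Fin 2} {m : ℕ} {p : DiffPoly K}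
    (hp : ∀ j, m < j → pderiv (i, j) p = 0) (l j : ℕ) (hj : m + l < j) :
    pderiv (i, j) ((totalX dx)^[l] p) = 0 := by
  induction l generalizing j with
  | zero => exact hp j hj
  | succ l ih =>
    obtain ⟨j, rfl⟩ : ∃ j', j = j' + 1 := ⟨j - 1, by omega⟩
    rw [Function.iterate_succ_apply', pderiv_totalX_succ, ih _ (by omega), ih _ (by omega),
      map_zero, add_zero]

theorem pderiv_iterate_top (dx : Derivation 𝕜 K K) {i : Fin 2} {m : ℕ} {p : DiffPoly K}
    (hp : ∀ j, m < j → pderiv (i, j) p = 0) (l : ℕ) :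
    pderiv (i, m + l) ((totalX dx)^[l] p) = pderiv (i, m) p := by
  induction l with
  | zero => rfl
  | succ l ih =>
    rw [Function.iterate_succ_apply', ← add_assoc, pderiv_totalX_succ, ih,
      pderiv_iterate_of_lt dx hp l _ (by omega), map_zero, zero_add]

/-- Each of the $l$ applications of $D_x$ shifts the next-to-leading coefficient up by one order and
adds one copy of $D_x$ of the leading coefficient. -/
theorem pderiv_iterate_subtop (dx : Derivation 𝕜 K K) {i : Fin 2} {m : ℕ} {p : DiffPoly K}
    (hp : ∀ j, m + 1 < j → pderiv (i, j) p = 0) (l : ℕ) :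
    pderiv (i, m + l) ((totalX dx)^[l] p) =
      pderiv (i, m) p + l * totalX dx (pderiv (i, m + 1) p) := by
  induction l with
  | zero => simp
  | succ l ih =>
    have := pderiv_iterate_top dx hp l
    rw [show m + 1 + l = m + l + 1 by ring] at this
    rw [Function.iterate_succ_apply', ← add_assoc, pderiv_totalX_succ, ih, this]
    push_cast
    ring

theorem pderiv_burgersField_zero_zero (dx : Derivation 𝕜 K K) (j : ℕ) :
    pderiv (0, j) (burgersField dx 0) = if j = 2 then 1 else if j = 1 then 2 * X (0, 0)
      else if j = 0 then 2 * X (0, 1) else (0 : DiffPoly K) := by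
  have e2 : pderiv (0, j) (2 : DiffPoly K) = 0 := by
    rw [← map_ofNat C]; exact pderiv_C
  rw [burgersField_zero]
  simp only [map_add, Derivation.leibniz, pderiv_X, Pi.single_apply, Prod.mk.injEq, true_and, e2,
    one_ne_zero, false_and, if_false, smul_eq_mul, eq_comm (b := j)]
  rcases j with _ | _ | _ | j <;> simp [mul_comm]

theorem pderiv_burgersField_zero_one (dx : Derivation 𝕜 K K) (j : ℕ) :
    pderiv (1, j) (burgersField dx 0) = if j = 1 then 1 else (0 : DiffPoly K) := by
  have e2 : pderiv (1, j) (2 : DiffPoly K) = 0 := by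
    rw [← map_ofNat C]; exact pderiv_C
  rw [burgersField_zero]
  simp only [map_add, Derivation.leibniz, pderiv_X, Pi.single_apply, Prod.mk.injEq, true_and, e2,
    zero_ne_one, false_and, if_false, smul_eq_mul, eq_comm (b := j)]
  rcases j with _ | _ | j <;> simp

theorem pderiv_burgersField_one_zero (dx : Derivation 𝕜 K K) (j : ℕ) :
    pderiv (0, j) (burgersField dx 1) = if j = 1 then X (1, 0) else if j = 0 then X (1, 1)
      else (0 : DiffPoly K) := by
  rw [burgersField_one]
  simp only [map_add, Derivation.leibniz, pderiv_X, Pi.single_apply, Prod.mk.injEq, true_and,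
    one_ne_zero, false_and, if_false, smul_eq_mul, eq_comm (b := j)]
  rcases j with _ | _ | j <;> simp

theorem pderiv_burgersField_one_one (dx : Derivation 𝕜 K K) (j : ℕ) :
    pderiv (1, j) (burgersField dx 1) = if j = 1 then X (0, 0) else if j = 0 then X (0, 1)
      else (0 : DiffPoly K) := by
  rw [burgersField_one]
  simp only [map_add, Derivation.leibniz, pderiv_X, Pi.single_apply, Prod.mk.injEq, true_and,
    zero_ne_one, false_and, if_false, smul_eq_mul, eq_comm (b := j)]
  rcases j with _ | _ | j <;> simp

/-- The partial derivatives of the prolonged field, as elements of the quotient field. -/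
def fieldPD (𝕜 : Type*) [RCLike 𝕜] {K : Type u} [CommRing K] [Algebra 𝕜 K]
    (dx : Derivation 𝕜 K K) (k i : Fin 2) (l j : ℕ) : DiffFrac K :=
  algebraMap (DiffPoly K) (DiffFrac K) (pderiv (i, j) ((totalX dx)^[l] (burgersField dx k)))

section Values

variable (dx : Derivation 𝕜 K K)

theorem fieldPD_uu_of_lt {l j : ℕ} (h : l + 2 < j) : fieldPD 𝕜 dx 0 0 l j = 0 := by
  rw [fieldPD, pderiv_iterate_of_lt dx (m := 2) _ l j (by omega), map_zero]
  intro j hj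
  rw [pderiv_burgersField_zero_zero, if_neg (by omega), if_neg (by omega), if_neg (by omega)]

theorem fieldPD_uu_top (l : ℕ) : fieldPD 𝕜 dx 0 0 l (l + 2) = 1 := by
  rw [fieldPD, add_comm l, pderiv_iterate_top dx, pderiv_burgersField_zero_zero, if_pos rfl,
    map_one]
  intro j hj
  rw [pderiv_burgersField_zero_zero, if_neg (by omega), if_neg (by omega), if_neg (by omega)]

theorem fieldPD_uv_of_lt {l j : ℕ} (h : l + 1 < j) : fieldPD 𝕜 dx 0 1 l j = 0 := by
  rw [fieldPD, pderiv_iterate_of_lt dx (m := 1) _ l j (by omega), map_zero]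
  intro j hj
  rw [pderiv_burgersField_zero_one, if_neg (by omega)]

theorem fieldPD_uv_top (l : ℕ) : fieldPD 𝕜 dx 0 1 l (l + 1) = 1 := by
  rw [fieldPD, add_comm l, pderiv_iterate_top dx, pderiv_burgersField_zero_one, if_pos rfl, map_one]
  intro j hj
  rw [pderiv_burgersField_zero_one, if_neg (by omega)]

theorem fieldPD_vu_of_lt {l j : ℕ} (h : l + 1 < j) : fieldPD 𝕜 dx 1 0 l j = 0 := by
  rw [fieldPD, pderiv_iterate_of_lt dx (m := 1) _ l j (by omega), map_zero]
  intro j hj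
  rw [pderiv_burgersField_one_zero, if_neg (by omega), if_neg (by omega)]

theorem fieldPD_vu_top (l : ℕ) : fieldPD 𝕜 dx 1 0 l (l + 1) = jet K 1 0 := by
  rw [fieldPD, add_comm l, pderiv_iterate_top dx, pderiv_burgersField_one_zero, if_pos rfl]
  intro j hj
  rw [pderiv_burgersField_one_zero, if_neg (by omega), if_neg (by omega)]

theorem fieldPD_vv_of_lt {l j : ℕ} (h : l + 1 < j) : fieldPD 𝕜 dx 1 1 l j = 0 := by
  rw [fieldPD, pderiv_iterate_of_lt dx (m := 1) _ l j (by omega), map_zero]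
  intro j hj
  rw [pderiv_burgersField_one_one, if_neg (by omega), if_neg (by omega)]

theorem fieldPD_vv_top (l : ℕ) : fieldPD 𝕜 dx 1 1 l (l + 1) = jet K 0 0 := by
  rw [fieldPD, add_comm l, pderiv_iterate_top dx, pderiv_burgersField_one_one, if_pos rfl]
  intro j hj
  rw [pderiv_burgersField_one_one, if_neg (by omega), if_neg (by omega)]

/-- The factor $l+1$ counts one $u_x$ from the undifferentiated term $u_xv$ and $l$ more from
differentiating the coefficient $u$ of $v_x$. -/
theorem fieldPD_vv_subtop (l : ℕ) :
    fieldPD 𝕜 dx 1 1 l l = ((l + 1 : ℕ) : DiffFrac K) * jet K 0 1 := by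
  have h := pderiv_iterate_subtop dx (i := 1) (m := 0) (p := burgersField dx 1)
    (fun j hj => by
      rw [pderiv_burgersField_one_one, if_neg (by omega), if_neg (by omega)]) l
  rw [zero_add] at h
  rw [fieldPD, h, pderiv_burgersField_one_one, pderiv_burgersField_one_one]
  simp
  ring

end Values

/-! ### Order descent for the gradient system -/

variable [IsDomain K]

/-- The contribution of the `k`-th unknown to the commutator of a partial derivative with the total
`t`-derivative. -/
def linTerm (dx : Derivation 𝕜 K K) (k i : Fin 2) (j : ℕ) (z : DiffFrac K) : DiffFrac K :=
  (symbol 𝕜 k z).sum fun l a => a * fieldPD 𝕜 dx k i l j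

theorem fracPD_fracT_eq (dx dt : Derivation 𝕜 K K) (i : Fin 2) (j : ℕ) (z : DiffFrac K) :
    fracPD 𝕜 K (i, j) (fracT dx dt z) =
      fracT dx dt (fracPD 𝕜 K (i, j) z) + linTerm dx 0 i j z + linTerm dx 1 i j z := by
  rw [fracPD_fracT, Fin.sum_univ_two, add_assoc]
  simp only [fracPD_algebraMap, linTerm, fieldPD]

theorem linTerm_eq_sum_range (dx : Derivation 𝕜 K K) (k i : Fin 2) (j N : ℕ) {z : DiffFrac K}
    (hz : ∀ l, N ≤ l → fracPD 𝕜 K (k, l) z = 0) :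
    linTerm dx k i j z = ∑ l ∈ Finset.range N, fracPD 𝕜 K (k, l) z * fieldPD 𝕜 dx k i l j := by
  rw [linTerm, Finsupp.sum_of_support_subset (s := Finset.range N)]
  · rfl
  · intro l hl
    rw [Finset.mem_range]
    by_contra! h
    exact Finsupp.mem_support_iff.mp hl (hz l h)
  · intro l _; rw [zero_mul]

theorem linTerm_eq_zero (dx : Derivation 𝕜 K K) (k i : Fin 2) (j N : ℕ) {z : DiffFrac K}
    (hz : ∀ l, N ≤ l → fracPD 𝕜 K (k, l) z = 0)
    (hF : ∀ l, l < N → fieldPD 𝕜 dx k i l j = 0) : linTerm dx k i j z = 0 := by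
  rw [linTerm_eq_sum_range dx k i j N hz]
  exact Finset.sum_eq_zero fun l hl => by rw [hF l (Finset.mem_range.mp hl), mul_zero]

theorem linTerm_eq_top (dx : Derivation 𝕜 K K) (k i : Fin 2) (j N : ℕ) {z : DiffFrac K}
    (hz : ∀ l, N + 1 ≤ l → fracPD 𝕜 K (k, l) z = 0)
    (hF : ∀ l, l < N → fieldPD 𝕜 dx k i l j = 0) :
    linTerm dx k i j z = fracPD 𝕜 K (k, N) z * fieldPD 𝕜 dx k i N j := by
  rw [linTerm_eq_sum_range dx k i j (N + 1) hz, Finset.sum_range_succ, add_eq_right]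
  exact Finset.sum_eq_zero fun l hl => by rw [hF l (Finset.mem_range.mp hl), mul_zero]

theorem linTerm_eq_top_two (dx : Derivation 𝕜 K K) (k i : Fin 2) (j N : ℕ) {z : DiffFrac K}
    (hz : ∀ l, N + 2 ≤ l → fracPD 𝕜 K (k, l) z = 0)
    (hF : ∀ l, l < N → fieldPD 𝕜 dx k i l j = 0) :
    linTerm dx k i j z = fracPD 𝕜 K (k, N) z * fieldPD 𝕜 dx k i N j +
      fracPD 𝕜 K (k, N + 1) z * fieldPD 𝕜 dx k i (N + 1) j := by
  rw [linTerm_eq_sum_range dx k i j (N + 2) hz, Finset.sum_range_succ, Finset.sum_range_succ,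
    add_assoc, add_eq_right]
  exact Finset.sum_eq_zero fun l hl => by rw [hF l (Finset.mem_range.mp hl), mul_zero]

/-- The system satisfied by the gradient of a rational conserved density. -/
def GradientSystem (dx dt : Derivation 𝕜 K K) (f g : DiffFrac K) : Prop :=
  (fracT dx dt f + fracX dx (fracX dx f) - 2 * jet K 0 0 * fracX dx f
    - jet K 1 0 * fracX dx g = 0) ∧
  (fracT dx dt g - fracX dx f - jet K 0 0 * fracX dx g = 0)

/-- The bounds on the orders of `f` and `g` in the jet variables used for the descent. -/
structure OrderBound (𝕜 : Type*) [RCLike 𝕜] {K : Type u} [CommRing K] [IsDomain K] [Algebra 𝕜 K]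
    (n : ℕ) (f g : DiffFrac K) : Prop where
  gv : ∀ j, n ≤ j → fracPD 𝕜 K (1, j) g = 0
  gu : ∀ j, n ≤ j + 1 → fracPD 𝕜 K (0, j) g = 0
  fv : ∀ j, n ≤ j + 1 → fracPD 𝕜 K (1, j) f = 0
  fu : ∀ j, n ≤ j + 2 → fracPD 𝕜 K (0, j) f = 0

theorem fracPD_jet_mul {i k : Fin 2} {j l : ℕ} (h : (i, j) ≠ (k, l)) (z : DiffFrac K) :
    fracPD 𝕜 K (i, j) (jet K k l * z) = jet K k l * fracPD 𝕜 K (i, j) z := by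
  rw [Derivation.leibniz, fracPD_algebraMap, pderiv_X_of_ne h.symm, map_zero, smul_zero, add_zero,
    smul_eq_mul]

theorem fracPD_two_mul (i : Fin 2 × ℕ) (z : DiffFrac K) :
    fracPD 𝕜 K i (2 * z) = 2 * fracPD 𝕜 K i z := by
  rw [two_mul, map_add, two_mul]

/-- Differentiate the first equation of the gradient system with respect to a jet variable of
positive order. -/
theorem GradientSystem.pd_fst {dx dt : Derivation 𝕜 K K} {f g : DiffFrac K}
    (h : GradientSystem dx dt f g) (i : Fin 2) (j : ℕ) :
    fracT dx dt (fracPD 𝕜 K (i, j + 1) f) + linTerm dx 0 i (j + 1) f + linTerm dx 1 i (j + 1) f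
      + fracPD 𝕜 K (i, j + 1) (fracX dx (fracX dx f))
      - 2 * (jet K 0 0 * fracPD 𝕜 K (i, j + 1) (fracX dx f))
      - jet K 1 0 * fracPD 𝕜 K (i, j + 1) (fracX dx g) = 0 := by
  have h1 := congrArg (fracPD 𝕜 K (i, j + 1)) h.1
  rw [map_sub, map_sub, map_add, map_zero, fracPD_fracT_eq, mul_assoc, fracPD_two_mul,
    fracPD_jet_mul (by simp), fracPD_jet_mul (by simp)] at h1
  exact h1

/-- Only the coefficient $u$ occurs in the second equation, so excluding the variable $u_0$ is
enough for it to pass through the partial derivative. -/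
theorem GradientSystem.pd_snd {dx dt : Derivation 𝕜 K K} {f g : DiffFrac K}
    (h : GradientSystem dx dt f g) (i : Fin 2) (j : ℕ) (hij : (i, j) ≠ (0, 0)) :
    fracT dx dt (fracPD 𝕜 K (i, j) g) + linTerm dx 0 i j g + linTerm dx 1 i j g
      - fracPD 𝕜 K (i, j) (fracX dx f)
      - jet K 0 0 * fracPD 𝕜 K (i, j) (fracX dx g) = 0 := by
  have h1 := congrArg (fracPD 𝕜 K (i, j)) h.2
  rw [map_sub, map_sub, map_zero, fracPD_fracT_eq, fracPD_jet_mul hij] at h1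
  exact h1

theorem jet_ne_zero (i : Fin 2) (j : ℕ) : jet K i j ≠ 0 :=
  algebraMap_frac_ne_zero (X_ne_zero _)

/-- The four bounds are staggered so that in each differentiated equation only the top partials
survive. In the main case these are $G=\partial g/\partial v_{n+1}$, $\partial g/\partial u_n$,
$\partial f/\partial v_n$ and $\partial f/\partial u_{n-1}$ (the last only if $n\ge1$). Two
relations express $\partial f/\partial v_n$ and $\partial g/\partial u_n$ through $vG$, a third
becomes the transport equation for $G$. After $G=0$, the last partial is removed using $u_{xx}$ in
$u_t$ and $f_{xx}$ in the first equation, which contribute with the same sign. -/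
theorem OrderBound.descend {dx dt : Derivation 𝕜 K K} {f g : DiffFrac K}
    (h : GradientSystem dx dt f g) {n : ℕ} (hb : OrderBound 𝕜 (n + 1) f g) :
    OrderBound 𝕜 n f g := by
  have := charZero_of_algebra 𝕜 K
  have : CharZero (DiffFrac K) :=
    charZero_of_injective_algebraMap (R := DiffPoly K) (IsFractionRing.injective _ _)
  -- the first equation, differentiated with respect to `v_{n+1}`
  have e1 := h.pd_fst 1 n
  rw [hb.fv _ (by omega), map_zero, fracPD_fracX_succ, fracPD_fracX_succ, fracPD_fracX_succ,
    hb.fv _ (by omega), hb.fv n (by omega), hb.gv (n + 1) (by omega),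
    linTerm_eq_zero dx 0 1 (n + 1) n (fun l hl => hb.fu l (by omega))
      (fun l hl => fieldPD_uv_of_lt dx (by omega)),
    linTerm_eq_zero dx 1 1 (n + 1) n (fun l hl => hb.fv l (by omega))
      (fun l hl => fieldPD_vv_of_lt dx (by omega))] at e1
  simp only [map_zero, add_zero, zero_add, mul_zero, sub_zero] at e1
  -- For the lowest bound, $g$ depends at most on $v_0$ and $f$ on no jet variable, so `e1` reduces
  -- to $v\,\partial g/\partial v_0=0$ and no transport equation is needed.
  rcases n with _ | n
  · rw [fracPD_fracX_zero, hb.fv 0 (by omega), map_zero, zero_sub, neg_eq_zero] at e1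
    have hG := (mul_eq_zero.mp e1).resolve_left (jet_ne_zero 1 0)
    refine ⟨fun j _ => ?_, fun j _ => hb.gu j (by omega), fun j _ => hb.fv j (by omega),
      fun j _ => hb.fu j (by omega)⟩
    rcases j with _ | j
    · exact hG
    · exact hb.gv _ (by omega)
  · rw [fracPD_fracX_succ, hb.fv (n + 1) (by omega), map_zero, zero_add] at e1
    -- the second equation, differentiated with respect to `u_{n+2}`
    have e2 := h.pd_snd 0 (n + 2) (by simp)
    rw [hb.gu _ (by omega), map_zero, fracPD_fracX_succ, fracPD_fracX_succ,
      hb.fu _ (by omega), hb.fu _ (by omega), hb.gu _ (by omega), hb.gu (n + 1) (by omega),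
      linTerm_eq_top dx 0 0 (n + 2) n (fun l hl => hb.gu l (by omega))
        (fun l hl => fieldPD_uu_of_lt dx (by omega)),
      linTerm_eq_top dx 1 0 (n + 2) (n + 1) (fun l hl => hb.gv l (by omega))
        (fun l hl => fieldPD_vu_of_lt dx (by omega)), fieldPD_uu_top, fieldPD_vu_top] at e2
    -- the second equation, differentiated with respect to `v_{n+1}`
    have e3 := h.pd_snd 1 (n + 1) (by simp)
    rw [fracPD_fracX_succ, fracPD_fracX_succ, hb.fv (n + 1) (by omega),
      linTerm_eq_top dx 0 1 (n + 1) n (fun l hl => hb.gu l (by omega))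
        (fun l hl => fieldPD_uv_of_lt dx (by omega)),
      linTerm_eq_top_two dx 1 1 (n + 1) n (fun l hl => hb.gv l (by omega))
        (fun l hl => fieldPD_vv_of_lt dx (by omega)), fieldPD_uv_top, fieldPD_vv_top,
      fieldPD_vv_subtop] at e3
    simp only [map_zero, add_zero, zero_add, mul_zero, sub_zero, mul_one] at e2 e3
    have hG : fracPD 𝕜 K (1, n + 1) g = 0 := by
      -- The terms $u\,\partial g/\partial v_n$ in `e3` cancel. Inserting $\partial f/\partial
      -- v_n=vG$ from `e1` and $\partial g/\partial u_n=-vG$ from `e2` produces the coefficient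
      -- $2v$; the constant $n+2$ comes from the next-to-leading coefficient of $D_x^{n+1}v_t$.
      refine eq_zero_of_transport dx dt (n + 2) ?_
      push_cast at e3 ⊢
      linear_combination e3 - e2 + e1
    rw [hG, mul_zero, sub_zero] at e1
    rw [hG, zero_mul, add_zero] at e2
    -- the first equation, differentiated with respect to `u_{n+1}`
    have e4 := h.pd_fst 0 n
    rw [hb.fu _ (by omega), map_zero, fracPD_fracX_succ, fracPD_fracX_succ, fracPD_fracX_succ,
      hb.fu (n + 1) (by omega), hb.fu n (by omega), hb.gu (n + 1) (by omega), e2,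
      linTerm_eq_zero dx 1 0 (n + 1) n
        (fun l hl => by
          rcases hl.eq_or_lt with rfl | hl
          · exact e1
          · exact hb.fv l (by omega))
        (fun l hl => fieldPD_vu_of_lt dx (by omega))] at e4
    simp only [map_zero, add_zero, zero_add, mul_zero, sub_zero] at e4
    refine ⟨fun j hj => ?_, fun j hj => ?_, fun j hj => ?_, fun j hj => ?_⟩
    · rcases hj.eq_or_lt with rfl | hj
      · exact hG
      · exact hb.gv _ (by omega)
    · rcases (Nat.le_of_succ_le_succ hj).eq_or_lt with rfl | hj
      · exact e2
      · exact hb.gu _ (by omega)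
    · rcases (Nat.le_of_succ_le_succ hj).eq_or_lt with rfl | hj
      · exact e1
      · exact hb.fv _ (by omega)
    · rcases (Nat.le_of_succ_le_succ hj).eq_or_lt with rfl | hj
      · rw [linTerm_eq_top dx 0 0 (j + 1 + 1) j (fun l hl => hb.fu l (by omega))
          (fun l hl => fieldPD_uu_of_lt dx (by omega)), fieldPD_uu_top, mul_one,
          fracPD_fracX_succ, hb.fu (j + 1) (by omega), map_zero, zero_add, ← two_mul] at e4
        exact (mul_eq_zero.mp e4).resolve_left two_ne_zero
      · exact hb.fu _ (by omega)

/-- A rational solution of the gradient system is constant. -/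
theorem GradientSystem.constant {dx dt : Derivation 𝕜 K K} {f g : DiffFrac K}
    (h : GradientSystem dx dt f g) :
    fracX dx f = 0 ∧ fracX dx g = 0 ∧ fracT dx dt f = 0 ∧ fracT dx dt g = 0 := by
  have := charZero_of_algebra 𝕜 K
  have : CharZero (DiffFrac K) :=
    charZero_of_injective_algebraMap (R := DiffPoly K) (IsFractionRing.injective _ _)
  -- A common bound for the orders of $f$ and $g$, increased by 2 because the bound on $u_j$ in $f$
  -- lags by 2, is brought down to 0 by descent.
  have hb : OrderBound 𝕜 0 f g := by
    obtain ⟨N, hN⟩ := exists_forall_fracPD_eq_zero (𝕜 := 𝕜) f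
    obtain ⟨M, hM⟩ := exists_forall_fracPD_eq_zero (𝕜 := 𝕜) g
    have hmax : OrderBound 𝕜 (max N M + 2) f g :=
      ⟨fun j hj => hM _ _ (by omega), fun j hj => hM _ _ (by omega), fun j hj => hN _ _ (by omega),
        fun j hj => hN _ _ (by omega)⟩
    generalize max N M + 2 = n at hmax
    induction n with
    | zero => exact hmax
    | succ n ih => exact ih (hmax.descend h)
  have hlin : ∀ z : DiffFrac K, (∀ i j, fracPD 𝕜 K (i, j) z = 0) → ∀ k i j,
      linTerm dx k i j z = 0 := fun z hz k i j =>
    linTerm_eq_zero dx k i j 0 (fun l _ => hz k l) (fun l hl => absurd hl (Nat.not_lt_zero l))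
  have hf : ∀ i j, fracPD 𝕜 K (i, j) f = 0 := fun i j => by
    fin_cases i
    exacts [hb.fu j (by omega), hb.fv j (by omega)]
  have hg : ∀ i j, fracPD 𝕜 K (i, j) g = 0 := fun i j => by
    fin_cases i
    exacts [hb.gu j (by omega), hb.gv j (by omega)]
  have hX : ∀ z : DiffFrac K, (∀ i j, fracPD 𝕜 K (i, j) z = 0) →
      fracPD 𝕜 K (0, 0) (fracX dx z) = 0 := fun z hz => by
    rw [fracPD_fracX_zero, hz, map_zero]
  have hT : ∀ z : DiffFrac K, (∀ i j, fracPD 𝕜 K (i, j) z = 0) →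
      fracPD 𝕜 K (0, 0) (fracT dx dt z) = 0 := fun z hz => by
    rw [fracPD_fracT_eq, hz, hlin z hz, hlin z hz, map_zero, add_zero, add_zero]
  -- With no jet variables left in $f$ and $g$, the explicit coefficient $u$ is the only place where
  -- $u$ occurs, so $\partial/\partial u$ isolates $g_x$ in the second equation and then $2f_x$ in
  -- the first.
  have hu : fracPD 𝕜 K (0, 0) (jet K 0 0) = 1 := by rw [fracPD_algebraMap, pderiv_X_self, map_one]
  have hgx : fracX dx g = 0 := by
    have e := congrArg (fracPD 𝕜 K (0, 0)) h.2
    rw [map_sub, map_sub, map_zero, hT g hg, hX f hf, Derivation.leibniz, hX g hg, hu, smul_zero,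
      smul_eq_mul] at e
    simpa using e
  have hfx : fracX dx f = 0 := by
    have e := congrArg (fracPD 𝕜 K (0, 0)) h.1
    rw [map_sub, map_sub, map_add, map_zero, hT f hf, fracPD_fracX_zero, hX f hf, hgx, mul_zero,
      map_zero, map_zero, mul_assoc, fracPD_two_mul, Derivation.leibniz, hX f hf, hu, smul_zero,
      smul_eq_mul] at e
    simpa using e
  refine ⟨hfx, hgx, ?_, ?_⟩
  · simpa [hfx, hgx] using h.1
  · simpa [hfx, hgx] using h.2

theorem gradientSystem_grad (dx dt : Derivation 𝕜 K K) (hcomm : ∀ c, dx (dt c) = dt (dx c))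
    {γ ρ : DiffFrac K} (h : fracT dx dt γ + fracX dx ρ = 0) :
    GradientSystem dx dt (grad dx 0 γ) (grad dx 1 γ) :=
  grad_equations dx dt hcomm h

end Order

open MvPolynomial

/-! ## Conserved densities -/

section EulerDerivation

variable {K : Type u} [CommRing K]

/-- The derivation multiplying a monomial by its degree. -/
def eulerDer (K : Type u) [CommRing K] : Derivation K (DiffPoly K) (DiffPoly K) :=
  MvPolynomial.mkDerivation K X

theorem coeff_eulerDer (p : DiffPoly K) (s : Fin 2 × ℕ →₀ ℕ) :
    (eulerDer K p).coeff s = s.degree * p.coeff s := by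
  have hmono : ∀ (t : Fin 2 × ℕ →₀ ℕ) (c : K),
      eulerDer K (monomial t c) = C (t.degree : K) * monomial t c := by
    intro t c
    rw [eulerDer, mkDerivation_monomial, Finsupp.sum, Finsupp.degree_apply, Nat.cast_sum, map_sum,
      Finset.smul_sum, Finset.sum_mul]
    refine Finset.sum_congr rfl fun i hi => ?_
    have hle : Finsupp.single i 1 ≤ t := Finsupp.single_le_iff.mpr
      (Nat.one_le_iff_ne_zero.mpr (Finsupp.mem_support_iff.mp hi))
    rw [smul_eq_mul, X, monomial_mul, tsub_add_cancel_of_le hle, smul_monomial, C_mul_monomial,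
      mul_one, smul_eq_mul, mul_comm]
  induction p using MvPolynomial.induction_on' with
  | monomial t c =>
    rw [hmono, coeff_C_mul, coeff_monomial]
    split_ifs with h
    · rw [h]
    · rw [mul_zero, mul_zero]
  | add p q hp hq => rw [map_add, coeff_add, hp, hq, coeff_add, mul_add]

theorem derivation_sum_apply {ι : Type*} (S : Finset ι)
    (D : ι → Derivation K (DiffPoly K) (DiffPoly K)) (p : DiffPoly K) :
    (∑ i ∈ S, D i) p = ∑ i ∈ S, D i p := by
  classical
  induction S using Finset.induction_on with
  | empty => simp
  | insert a S ha ih => rw [Finset.sum_insert ha, Finset.sum_insert ha, Derivation.add_apply, ih]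

theorem eulerDer_eq_sum (p : DiffPoly K) {N : ℕ} (hN : ∀ i ∈ p.vars, i.2 < N) :
    eulerDer K p = ∑ i, ∑ j ∈ Finset.range N, X (i, j) * pderiv (i, j) p := by
  have h : eulerDer K p = (∑ i : Fin 2, ∑ j ∈ Finset.range N,
      (X (i, j) : DiffPoly K) • (pderiv (i, j) : Derivation K (DiffPoly K) (DiffPoly K))) p := by
    refine derivation_eq_of_forall_mem_vars fun i hi => ?_
    obtain ⟨k, l⟩ := i
    have hl : l < N := hN _ hi
    simp only [eulerDer, mkDerivation_X, derivation_sum_apply, Derivation.smul_apply,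
      smul_eq_mul, pderiv_X, Pi.single_apply, Prod.mk.injEq]
    fin_cases k <;> simp [hl]
  rw [h]
  simp only [derivation_sum_apply, Derivation.smul_apply, smul_eq_mul]

variable {𝕜 : Type*} [RCLike 𝕜] [Algebra 𝕜 K]

theorem eulerDer_totalX (dx : Derivation 𝕜 K K) (p : DiffPoly K) :
    eulerDer K (totalX dx p) = totalX dx (eulerDer K p) := by
  refine derivation_comm_of_C_X (D₁ := (eulerDer K).restrictScalars 𝕜) ?_ ?_ p
  · intro c; simp [eulerDer]
  · intro i j; simp [eulerDer]

/-- Up to total derivatives and constants, every polynomial is in the range of `eulerDer`. -/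
theorem exists_eulerDer_eq (𝕜 : Type*) [RCLike 𝕜] [Algebra 𝕜 K] (p : DiffPoly K) :
    ∃ q, eulerDer K q = p - C (constantCoeff p) := by
  induction p using MvPolynomial.induction_on' with
  | monomial s c =>
    rcases eq_or_ne s 0 with rfl | hs
    · exact ⟨0, by simp⟩
    · refine ⟨monomial s ((s.degree : 𝕜)⁻¹ • c), ?_⟩
      have hdeg : (s.degree : 𝕜) ≠ 0 := by
        rw [Nat.cast_ne_zero, Ne, Finsupp.degree_eq_zero_iff]; exact hs
      have h0 : constantCoeff (monomial s c : DiffPoly K) = 0 := by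
        rw [constantCoeff_monomial, if_neg hs]
      rw [h0, map_zero, sub_zero]
      ext t
      rw [coeff_eulerDer, coeff_monomial, coeff_monomial]
      split_ifs with h
      · subst h
        have e : (s.degree : K) = algebraMap 𝕜 K s.degree := (map_natCast _ _).symm
        rw [e, ← Algebra.smul_def, smul_smul, mul_inv_cancel₀ hdeg, one_smul]
      · rw [mul_zero]
  | add p q hp hq =>
    obtain ⟨p', hp'⟩ := hp
    obtain ⟨q', hq'⟩ := hq
    refine ⟨p' + q', ?_⟩
    rw [map_add, hp', hq', map_add, map_add]
    ring

/-- Write $h$ as a constant plus the image of some $q$ under the degree derivation, which commutes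
with $D_x$. Then $p-D_xq$ is sent into $K$, so its components of positive degree vanish. -/
theorem exists_eq_C_add_totalX_of_eulerDer [IsDomain K] (dx : Derivation 𝕜 K K) {p h : DiffPoly K}
    (hp : eulerDer K p = totalX dx h) : ∃ (k : K) (h' : DiffPoly K), p = C k + totalX dx h' := by
  have := charZero_of_algebra 𝕜 K
  obtain ⟨q, hq⟩ := exists_eulerDer_eq 𝕜 h
  have h1 : eulerDer K (p - totalX dx q) = C (dx (constantCoeff h)) := by
    rw [map_sub, eulerDer_totalX, hq, map_sub, hp, totalX_C]
    ring
  refine ⟨constantCoeff (p - totalX dx q), q, ?_⟩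
  rw [← sub_eq_iff_eq_add]
  ext s
  have h2 := congrArg (coeff s) h1
  rw [coeff_eulerDer, coeff_C] at h2
  rw [coeff_C]
  split_ifs at h2 ⊢ with h0
  · rw [← h0]; rfl
  · have : (s.degree : K) ≠ 0 := by
      rw [Nat.cast_ne_zero, Ne, Finsupp.degree_eq_zero_iff]; exact fun h => h0 h.symm
    exact (mul_eq_zero.mp h2).resolve_left this

/-- Moving `x`-derivatives from a jet variable to its cofactor. -/
theorem exists_X_mul_eq (dx : Derivation 𝕜 K K) (i : Fin 2) (j : ℕ) (q : DiffPoly K) :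
    ∃ h, X (i, j) * q = X (i, 0) * ((-1) ^ j * (totalX dx)^[j] q) + totalX dx h := by
  induction j generalizing q with
  | zero => exact ⟨0, by simp⟩
  | succ j ih =>
    obtain ⟨h, hh⟩ := ih (totalX dx q)
    refine ⟨X (i, j) * q - h, ?_⟩
    rw [Function.iterate_succ_apply, map_sub, Derivation.leibniz, totalX_X, smul_eq_mul,
      smul_eq_mul, pow_succ]
    linear_combination -hh

theorem exists_vars_bound {K : Type u} [CommRing K] (p : DiffPoly K) : ∃ N, ∀ i ∈ p.vars, i.2 < N :=
  ⟨p.vars.sup (fun i => i.2 + 1), fun _ hi => Finset.le_sup (f := fun i => i.2 + 1) hi⟩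

/-- `a u + b v` is a conserved density for constants `a`, `b`. -/
theorem exists_totalT_linear (dx dt : Derivation 𝕜 K K) {a b : K} (hxa : dx a = 0) (hta : dt a = 0)
    (hxb : dx b = 0) (htb : dt b = 0) :
    ∃ σ, totalT dx dt (C a * uu K + C b * vv K) = totalX dx σ := by
  refine ⟨C a * (X (0, 1) + X (0, 0) * X (0, 0) + X (1, 0)) + C b * (X (0, 0) * X (1, 0)), ?_⟩
  simp only [uu, vv, map_add, Derivation.leibniz, totalT_C, totalT_X, totalX_C, totalX_X, hxa, hta,
    hxb, htb, map_zero, Function.iterate_zero, id, burgersField_zero,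
    burgersField_one, smul_eq_mul]
  ring

end EulerDerivation

/-! ### The Euler operator on polynomials and the classification of densities -/

section Conserved

variable {𝕜 : Type*} [RCLike 𝕜] {K : Type u} [CommRing K] [IsDomain K] [Algebra 𝕜 K]

theorem grad_algebraMap (dx : Derivation 𝕜 K K) (i : Fin 2) (p : DiffPoly K) {N : ℕ}
    (hN : ∀ i ∈ p.vars, i.2 < N) :
    grad dx i (algebraMap _ _ p) = algebraMap (DiffPoly K) (DiffFrac K)
      (∑ j ∈ Finset.range N, (-1) ^ j * (totalX dx)^[j] (pderiv (i, j) p)) := by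
  have hit : ∀ (j : ℕ) (q : DiffPoly K), (fracDer (totalX dx))^[j] (algebraMap _ _ q) =
      algebraMap (DiffPoly K) (DiffFrac K) ((totalX dx)^[j] q) := by
    intro j q
    induction j with
    | zero => rfl
    | succ j ih =>
      rw [Function.iterate_succ_apply', Function.iterate_succ_apply', ih, fracDer_algebraMap]
  rw [grad, finsum_eq_sum_of_support_subset (s := Finset.range N), map_sum]
  · refine Finset.sum_congr rfl fun j _ => ?_
    rw [fracDer_algebraMap, hit]
    simp
  · intro j hj
    rw [Finset.mem_coe, Finset.mem_range]
    by_contra hlt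
    apply hj
    have h0 : pderiv (i, j) p = 0 := pderiv_eq_zero_of_notMem_vars fun hmem => hlt (hN _ hmem)
    have hz : ∀ j, (totalX dx)^[j] 0 = 0 := fun j => iterate_map_zero _ _
    simp only
    rw [fracDer_algebraMap, Derivation.restrictScalars_apply, h0, hit, hz, map_zero, mul_zero]

/-- Exactness of the variational complex at differential polynomials. -/
theorem exists_eq_C_add_totalX_of_grad (dx : Derivation 𝕜 K K) {p : DiffPoly K}
    (hp : ∀ i, grad dx i (algebraMap _ (DiffFrac K) p) = 0) :
    ∃ (k : K) (h : DiffPoly K), p = C k + totalX dx h := by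
  obtain ⟨N, hN⟩ := exists_vars_bound p
  choose H hH using fun (i : Fin 2) (j : ℕ) => exists_X_mul_eq dx i j (pderiv (i, j) p)
  refine exists_eq_C_add_totalX_of_eulerDer dx (h := ∑ i, ∑ j ∈ Finset.range N, H i j) ?_
  -- After moving all $x$-derivatives off the jet variables, the terms of each unknown add up to the
  -- unknown times its variational derivative, which is zero, plus total derivatives.
  rw [eulerDer_eq_sum p hN, map_sum]
  refine Finset.sum_congr rfl fun i _ => ?_
  have h0 := hp i
  rw [grad_algebraMap dx i p hN,
    map_eq_zero_iff _ (IsFractionRing.injective (DiffPoly K) (DiffFrac K))] at h0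
  rw [map_sum, Finset.sum_congr rfl fun j _ => hH i j, Finset.sum_add_distrib, ← Finset.mul_sum, h0,
    mul_zero, zero_add]

theorem grad_C_mul_X (dx : Derivation 𝕜 K K) (i k : Fin 2) (a : K) :
    grad dx i (algebraMap (DiffPoly K) (DiffFrac K) (C a * X (k, 0))) =
      if i = k then algebraMap (DiffPoly K) (DiffFrac K) (C a) else 0 := by
  have hC : symbol 𝕜 i (algebraMap (DiffPoly K) (DiffFrac K) (C a)) = 0 := by
    ext j; simp
  rw [grad_eq_adjointApply, map_mul, Derivation.leibniz, hC, smul_zero, add_zero, symbol_X]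
  split_ifs <;> simp [-Finsupp.single_mul, Algebra.smul_def]

theorem grad_C (dx : Derivation 𝕜 K K) (i : Fin 2) (a : K) :
    grad dx i (algebraMap (DiffPoly K) (DiffFrac K) (C a)) = 0 := by
  have hC : symbol 𝕜 i (algebraMap (DiffPoly K) (DiffFrac K) (C a)) = 0 := by
    ext j; simp
  rw [grad_eq_adjointApply, hC, map_zero]

theorem linear_density_independent (dx : Derivation 𝕜 K K) (a b k : K) (h : DiffPoly K)
    (heq : C a * uu K + C b * vv K = C k + totalX dx h) : a = 0 ∧ b = 0 := by
  have hg : ∀ i, grad dx i (algebraMap (DiffPoly K) (DiffFrac K) (C a * uu K + C b * vv K)) = 0 := by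
    intro i
    rw [heq, map_add, grad_add, grad_C, zero_add, ← fracDeriv_algebraMap, grad_fracX]
  have key : ∀ c : K, algebraMap (DiffPoly K) (DiffFrac K) (C c) = 0 → c = 0 := by
    intro c hc
    rw [map_eq_zero_iff _ (IsFractionRing.injective (DiffPoly K) (DiffFrac K))] at hc
    exact C_eq_zero.mp hc
  constructor
  · have := hg 0
    rw [map_add, grad_add, uu, vv, grad_C_mul_X, grad_C_mul_X] at this
    exact key a (by simpa using this)
  · have := hg 1
    rw [map_add, grad_add, uu, vv, grad_C_mul_X, grad_C_mul_X] at this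
    exact key b (by simpa using this)

/-- The gradient of a polynomial is a polynomial, and one killed by $D_x$ lies in $K$; so the
rational rigidity result yields honest constants $a,b$. Subtracting $au+bv$ leaves zero gradient and
exactness applies. -/
theorem conserved_iff (dx dt : Derivation 𝕜 K K) (hcomm : ∀ c, dx (dt c) = dt (dx c))
    (γ : DiffPoly K) : (∃ ρ, totalT dx dt γ + totalX dx ρ = 0) ↔
      ∃ (a b k l : K) (h : DiffPoly K),
        dx a = 0 ∧ dt a = 0 ∧ dx b = 0 ∧ dt b = 0 ∧ dt k = dx l ∧
        γ = C a * uu K + C b * vv K + C k + totalX dx h := by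
  constructor
  · rintro ⟨ρ, hρ⟩
    have hF : fracT dx dt (algebraMap _ _ γ) +
        fracX dx (algebraMap (DiffPoly K) (DiffFrac K) ρ) = 0 := by
      rw [fracDeriv_algebraMap, fracDeriv_algebraMap, ← map_add, hρ, map_zero]
    obtain ⟨h0x, h1x, h0t, h1t⟩ := (gradientSystem_grad dx dt hcomm hF).constant
    have hconst : ∀ i, fracX dx (grad dx i (algebraMap (DiffPoly K) (DiffFrac K) γ)) = 0 →
        fracT dx dt (grad dx i (algebraMap (DiffPoly K) (DiffFrac K) γ)) = 0 →
        ∃ a : K, dx a = 0 ∧ dt a = 0 ∧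
          grad dx i (algebraMap (DiffPoly K) (DiffFrac K) γ) =
            algebraMap (DiffPoly K) (DiffFrac K) (C a) := by
      intro i hx ht
      obtain ⟨N, hN⟩ := exists_vars_bound γ
      rw [grad_algebraMap dx i γ hN] at hx ht ⊢
      rw [fracDeriv_algebraMap,
        map_eq_zero_iff _ (IsFractionRing.injective (DiffPoly K) (DiffFrac K))] at hx ht
      obtain ⟨hC, ha⟩ := eq_C_of_totalX_eq_zero dx hx
      rw [hC, totalT_C, C_eq_zero] at ht
      exact ⟨_, ha, ht, congrArg _ hC⟩
    obtain ⟨a, hxa, hta, ha⟩ := hconst 0 h0x h0t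
    obtain ⟨b, hxb, htb, hb⟩ := hconst 1 h1x h1t
    obtain ⟨k, h, hk⟩ := exists_eq_C_add_totalX_of_grad dx
      (p := γ - (C a * uu K + C b * vv K)) (by
        intro i
        have e : algebraMap (DiffPoly K) (DiffFrac K) γ =
            algebraMap _ _ (γ - (C a * uu K + C b * vv K)) +
              (algebraMap _ _ (C a * uu K) + algebraMap _ _ (C b * vv K)) := by
          rw [← map_add, ← map_add, sub_add_cancel]
        rw [e, grad_add, grad_add, uu, vv, grad_C_mul_X, grad_C_mul_X] at ha hb
        fin_cases i
        · simpa [uu, vv] using ha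
        · simpa [uu, vv] using hb)
    obtain ⟨σ, hσ⟩ := exists_totalT_linear dx dt hxa hta hxb htb
    have hγ : γ = C a * uu K + C b * vv K + C k + totalX dx h := by linear_combination hk
    -- The conservation law gives $\partial_tk=-D_x(\sigma+D_th+\rho)$ in $R$. Taking constant
    -- terms, on which $D_x$ acts as $\partial_x$, exhibits the primitive of $\partial_tk$ inside
    -- $K$.
    refine ⟨a, b, k, constantCoeff (-(σ + totalT dx dt h + ρ)), h, hxa, hta, hxb, htb, ?_, hγ⟩
    rw [hγ, map_add, map_add, hσ, totalT_C, totalT_totalX dx dt hcomm] at hρ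
    rw [← constantCoeff_totalX, map_neg, map_add, map_add]
    have : C (dt k) = -(totalX dx σ + totalX dx (totalT dx dt h) + totalX dx ρ) := by
      linear_combination hρ
    rw [← this, constantCoeff_C]
  · rintro ⟨a, b, k, l, h, hxa, hta, hxb, htb, hkl, rfl⟩
    obtain ⟨σ, hσ⟩ := exists_totalT_linear dx dt hxa hta hxb htb
    refine ⟨-(σ + C l + totalT dx dt h), ?_⟩
    rw [map_add, map_add, hσ, totalT_C, totalT_totalX dx dt hcomm, map_neg, map_add, map_add,
      totalX_C, hkl]
    ring

end Conserved

open MvPolynomial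

/-! ## The zero-curvature equation -/

section Curvature

variable {𝕜 : Type*} [RCLike 𝕜] {A : Type*} [CommRing A] [Algebra 𝕜 A]

/-- An additive map commutes with division by 2 automatically, so the curvature computation needs
neither linearity nor the Leibniz rule for $D_x$, $D_t$, only $D_t1=0$. -/
theorem map_two_inv_smul (f : A →+ A) (x : A) : f ((2⁻¹ : 𝕜) • x) = (2⁻¹ : 𝕜) • f x := by
  simpa using map_inv_natCast_smul f 𝕜 𝕜 2 x

/-- The zero-curvature expression of a Lax pair is determined by a single scalar. -/
theorem curvature_lax (Dx Dt : A →+ A) (h1 : Dt 1 = 0) (q α : A) :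
    curvature Dx Dt (laxL 𝕜 q) (laxP 𝕜 q α (Dx α)) =
      !![(2⁻¹ : 𝕜) • (Dt q - Dx (Dx α + q * α)), 0;
         0, -((2⁻¹ : 𝕜) • (Dt q - Dx (Dx α + q * α)))] := by
  have half : ∀ x : A, (2⁻¹ : 𝕜) • x + (2⁻¹ : 𝕜) • x = x := fun x => by
    rw [← add_smul, ← two_mul, mul_inv_cancel₀ two_ne_zero, one_smul]
  rw [mul_comm q α]
  ext i j
  fin_cases i <;> fin_cases j
  · simp [curvature, laxL, laxP, smul_sub, map_two_inv_smul]
    simp only [Algebra.smul_def]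
    ring
  · simp [curvature, laxL, laxP]
  · simp [curvature, laxL, laxP, h1]
    have hc : (2⁻¹ : 𝕜) • (q * α) = (2⁻¹ : 𝕜) • (α * q) := by rw [mul_comm]
    linear_combination half (Dx α) - hc
  · simp [curvature, laxL, laxP, smul_sub, map_two_inv_smul]
    simp only [Algebra.smul_def]
    ring

theorem curvature_lax_eq_zero_iff (Dx Dt : A →+ A) (h1 : Dt 1 = 0) (q α : A) :
    curvature Dx Dt (laxL 𝕜 q) (laxP 𝕜 q α (Dx α)) = 0 ↔ Dt q = Dx (Dx α + q * α) := by
  rw [curvature_lax Dx Dt h1]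
  constructor
  · intro h
    have h00 := congrFun (congrFun h 0) 0
    simpa [sub_eq_zero] using h00
  · intro h
    rw [h]
    ext i j
    fin_cases i <;> fin_cases j <;> simp

end Curvature

/-! ## The hierarchy -/

section Hierarchy

variable {𝕜 : Type*} [RCLike 𝕜] {K : Type u} [CommRing K] [Algebra 𝕜 K]

/-- The defect in the recursion for the coefficients of an asymptotic solution. -/
def recur (dx : Derivation 𝕜 K K) (α : Series K) (k : ℤ) : DiffPoly K :=
  totalX dx (α.coeff k) + uu K * α.coeff k + vv K * α.coeff (k - 1) - α.coeff (k + 1)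

theorem coeff_formalQ_mul (α : Series K) (k : ℤ) :
    (formalQ K * α).coeff k =
      uu K * α.coeff k + vv K * α.coeff (k - 1) - α.coeff (k + 1) := by
  rw [formalQ, lamPow, lamPow, sub_mul, add_mul, HahnSeries.coeff_sub, HahnSeries.coeff_add,
    mul_assoc, HahnSeries.coeff_single_mul, HahnSeries.coeff_single_mul, HahnSeries.C_apply,
    HahnSeries.C_apply, HahnSeries.coeff_single_zero_mul, HahnSeries.coeff_single_zero_mul]
  simp

theorem coeff_seriesX (dx : Derivation 𝕜 K K) (α : Series K) (k : ℤ) :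
    (seriesX dx α).coeff k = totalX dx (α.coeff k) := rfl

theorem coeff_lamPow_mul (n k : ℤ) (α : Series K) :
    (lamPow K n * α).coeff k = α.coeff (k + n) := by
  rw [lamPow, HahnSeries.coeff_single_mul, one_mul, sub_neg_eq_add]

theorem coeff_polyPart (n k : ℤ) (α : Series K) :
    (polyPart (lamPow K n * α)).coeff k = if k ≤ 0 then α.coeff (k + n) else 0 := by
  rw [← coeff_lamPow_mul]; rfl

theorem coeff_formalQ (k : ℤ) : (formalQ K).coeff k =
    if k = 0 then uu K else if k = 1 then vv K else if k = -1 then -1 else 0 := by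
  have h := coeff_formalQ_mul (1 : Series K) k
  have h1 : ∀ m : ℤ, (1 : Series K).coeff m = if m = 0 then 1 else 0 := fun m => by
    rw [HahnSeries.coeff_one]; congr
  rw [mul_one, h1, h1, h1] at h
  rw [h]
  split_ifs <;> first | omega | simp

theorem isAsymptoticSolution_iff (dx : Derivation 𝕜 K K) (α : Series K) :
    IsAsymptoticSolution dx α ↔
      (∀ k < 0, α.coeff k = 0) ∧ ∀ k, totalX dx (recur dx α k) = 0 := by
  refine and_congr_right fun _ => ?_
  have hk : ∀ k, (seriesX dx (seriesX dx α) + seriesX dx (formalQ K * α)).coeff k =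
      totalX dx (recur dx α k) := by
    intro k
    rw [HahnSeries.coeff_add, coeff_seriesX, coeff_seriesX, coeff_seriesX, coeff_formalQ_mul,
      ← map_add, recur]
    congr 1
    ring
  constructor
  · intro h k
    rw [← hk, h, HahnSeries.coeff_zero]
  · intro h
    ext1
    funext k
    rw [hk, h, HahnSeries.coeff_zero]

theorem flowEquation_iff (dx : Derivation 𝕜 K K) (β : Series K)
    (D : Derivation K (DiffPoly K) (DiffPoly K)) :
    FlowEquation dx β D ↔ ∀ k, D ((formalQ K).coeff k) = totalX dx (recur dx β k) := by
  have hk : ∀ k, (seriesX dx (seriesX dx β + formalQ K * β)).coeff k =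
      totalX dx (recur dx β k) := by
    intro k
    rw [coeff_seriesX, HahnSeries.coeff_add, coeff_seriesX, coeff_formalQ_mul, recur]
    congr 1
    ring
  constructor
  · intro h k
    rw [← hk, ← h]
    rfl
  · intro h
    unfold FlowEquation
    ext1
    funext k
    rw [hk, ← h]
    rfl

/-- The flow equation of an asymptotic solution gives the values of the flow on `u` and `v`. -/
theorem flowEquation_polyPart_iff (dx : Derivation 𝕜 K K) {α : Series K}
    (hα : IsAsymptoticSolution dx α) (n : ℕ) (D : Derivation K (DiffPoly K) (DiffPoly K)) :
    FlowEquation dx (polyPart (lamPow K n * α)) D ↔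
      D (uu K) = totalX dx (totalX dx (α.coeff n) + uu K * α.coeff n + vv K * α.coeff (n - 1)) ∧
      D (vv K) = totalX dx (vv K * α.coeff n) := by
  rw [isAsymptoticSolution_iff] at hα
  have h0 : recur dx (polyPart (lamPow K n * α)) 0 =
      totalX dx (α.coeff n) + uu K * α.coeff n + vv K * α.coeff (n - 1) := by
    simp only [recur, coeff_polyPart]
    norm_num
    rw [neg_add_eq_sub]
  have h1 : recur dx (polyPart (lamPow K n * α)) 1 = vv K * α.coeff n := by
    simp only [recur, coeff_polyPart]
    norm_num
  -- At negative indices the truncation is not felt, so the defect is that of $\alpha$; at 0 the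
  -- term $\alpha_{n+1}$ is cut off, at 1 only $v\alpha_n$ survives.
  have hneg : ∀ k < 0, recur dx (polyPart (lamPow K n * α)) k = recur dx α (k + n) := by
    intro k hk
    simp only [recur, coeff_polyPart]
    rw [if_pos (by omega), if_pos (by omega), if_pos (by omega), sub_add_eq_add_sub,
      add_right_comm k 1]
  have hpos : ∀ k, 1 < k → recur dx (polyPart (lamPow K n * α)) k = 0 := by
    intro k hk
    simp only [recur, coeff_polyPart]
    rw [if_neg (by omega), if_neg (by omega), if_neg (by omega)]
    simp
  rw [flowEquation_iff, ← h0, ← h1]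
  constructor
  · intro h
    have e0 := h 0
    have e1 := h 1
    rw [coeff_formalQ, if_pos rfl] at e0
    rw [coeff_formalQ, if_neg one_ne_zero, if_pos rfl] at e1
    exact ⟨e0, e1⟩
  · rintro ⟨e0, e1⟩ k
    rcases lt_trichotomy k 0 with hk | rfl | hk
    · rw [hneg k hk, hα.2, coeff_formalQ, if_neg (by omega), if_neg (by omega)]
      split_ifs <;> simp
    · rw [coeff_formalQ, if_pos rfl, e0]
    · rcases eq_or_ne k 1 with rfl | hk1
      · rw [coeff_formalQ, if_neg one_ne_zero, if_pos rfl, e1]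
      · rw [hpos k (by omega), coeff_formalQ, if_neg (by omega), if_neg (by omega),
          if_neg (by omega), map_zero, map_zero]

theorem existsUnique_flow (dx : Derivation 𝕜 K K) {α : Series K}
    (hα : IsAsymptoticSolution dx α) (n : ℕ) :
    ∃! D : Derivation K (DiffPoly K) (DiffPoly K), IsFlow dx D ∧
      FlowEquation dx (polyPart (lamPow K n * α)) D := by
  refine ⟨evolutionary dx ![totalX dx (totalX dx (α.coeff n) + uu K * α.coeff n
    + vv K * α.coeff (n - 1)), totalX dx (vv K * α.coeff n)], ⟨isFlow_evolutionary dx _, ?_⟩, ?_⟩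
  · rw [flowEquation_polyPart_iff dx hα]
    constructor
    · rw [uu, evolutionary_X]; rfl
    · rw [vv, evolutionary_X]; rfl
  · rintro D ⟨hD, hDeq⟩
    rw [flowEquation_polyPart_iff dx hα] at hDeq
    refine hD.ext (isFlow_evolutionary dx _) ?_ ?_
    · rw [hDeq.1, uu, evolutionary_X]; rfl
    · rw [hDeq.2, vv, evolutionary_X]; rfl

/-- Iterate the recursion, starting from two consecutive coefficients. -/
def recurPair (dx : Derivation 𝕜 K K) (a b : DiffPoly K) : ℕ → DiffPoly K × DiffPoly K
  | 0 => (a, b)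
  | m + 1 => (totalX dx (recurPair dx a b m).1 + uu K * (recurPair dx a b m).1
      + vv K * (recurPair dx a b m).2, (recurPair dx a b m).1)

/-- The first coefficients of a series can be continued by the recursion. -/
theorem exists_series_extending (dx : Derivation 𝕜 K K) (n : ℕ) (b : ℤ → DiffPoly K)
    (hb : ∀ k < 0, b k = 0) :
    ∃ α : Series K, (∀ k ≤ (n : ℤ), α.coeff k = b k) ∧ ∀ k, (n : ℤ) ≤ k → recur dx α k = 0 := by
  -- The recursion has depth two, hence starts from the pair of coefficients at $n$ and $n-1$.
  set S := recurPair dx (b n) (b (n - 1)) with hS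
  let c : ℤ → DiffPoly K := fun k => if k ≤ n then b k else (S (k - n).toNat).1
  have hbdd : BddBelow (Function.support c) := by
    refine ⟨0, fun k hk => ?_⟩
    by_contra! hlt
    apply hk
    simp only [c]
    rw [if_pos (by omega), hb k hlt]
  have hle : ∀ k ≤ (n : ℤ), c k = b k := fun k hk => if_pos hk
  have hfst : ∀ m : ℕ, c (n + m) = (S m).1 := by
    intro m
    rcases m with _ | m
    · rw [Nat.cast_zero, add_zero, hle _ le_rfl]; rfl
    · simp only [c]
      rw [if_neg (by omega), add_sub_cancel_left, Int.toNat_natCast]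
  have hsnd : ∀ m : ℕ, c (n + m - 1) = (S m).2 := by
    intro m
    rcases m with _ | m
    · rw [Nat.cast_zero, add_zero, hle _ (by omega)]; rfl
    · rw [Nat.cast_succ, ← add_assoc, add_sub_cancel_right, hfst]; rfl
  refine ⟨HahnSeries.ofSuppBddBelow c hbdd, fun k hk => hle k hk, fun k hk => ?_⟩
  obtain ⟨m, rfl⟩ : ∃ m : ℕ, k = n + m := ⟨(k - n).toNat, by omega⟩
  change totalX dx (c (n + m)) + uu K * c (n + m) + vv K * c (n + m - 1) - c (n + m + 1) = 0
  have h1 : c (n + m + 1) = (S (m + 1)).1 := by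
    rw [← hfst, Nat.cast_succ, add_assoc]
  rw [h1, hfst, hsnd, sub_eq_zero]
  rfl

/-- Coefficientwise application of a derivation, as an additive map. -/
def seriesMap {R : Type*} [CommRing R] [Algebra R (DiffPoly K)]
    (D : Derivation R (DiffPoly K) (DiffPoly K)) : Series K →+ Series K where
  toFun s := s.map D
  map_zero' := by ext1; funext k; exact map_zero D
  map_add' s t := by ext1; funext k; exact map_add D _ _

theorem curvature_series_iff (dx : Derivation 𝕜 K K) (β : Series K)
    (D : Derivation K (DiffPoly K) (DiffPoly K)) :
    curvature (seriesX dx) (fun s => s.map D) (laxL 𝕜 (formalQ K))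
      (laxP 𝕜 (formalQ K) β (seriesX dx β)) = 0 ↔ FlowEquation dx β D := by
  have h1 : seriesMap D (1 : Series K) = 0 := by
    ext1
    funext k
    change D ((1 : Series K).coeff k) = 0
    rw [HahnSeries.coeff_one]
    split_ifs <;> simp
  exact curvature_lax_eq_zero_iff (𝕜 := 𝕜) (seriesMap (totalX dx)) (seriesMap D) h1 (formalQ K) β

/-- Zero curvature is the flow equation; what remains is that it forces $\beta$ to be a truncation.
Below index 0 the series $u+\lambda^{-1}v-\lambda$ has only the constant coefficients $-1$ and $0$,
killed by $D$, so the coefficients of $\lambda^{-n}\beta$ satisfy the asymptotic equation as far as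
they reach. They are then continued by solving the recursion exactly. -/
theorem isospectral_iff (dx : Derivation 𝕜 K K) (n : ℕ) (β : Series K)
    (hβ : ∀ k : ℤ, β.coeff k ≠ 0 → -(n : ℤ) ≤ k ∧ k ≤ 0)
    (D : Derivation K (DiffPoly K) (DiffPoly K)) :
    curvature (seriesX dx) (fun s => s.map D) (laxL 𝕜 (formalQ K))
      (laxP 𝕜 (formalQ K) β (seriesX dx β)) = 0 ↔
      (∃ α, IsAsymptoticSolution dx α ∧ β = polyPart (lamPow K n * α)) ∧ FlowEquation dx β D := by
  rw [curvature_series_iff]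
  refine ⟨fun h => ⟨?_, h⟩, fun h => h.2⟩
  have hlow : ∀ k, k < -(n : ℤ) → β.coeff k = 0 := fun k hk => by
    by_contra hne
    have := hβ k hne
    omega
  have hhigh : ∀ k, 0 < k → β.coeff k = 0 := fun k hk => by
    by_contra hne
    have := hβ k hne
    omega
  obtain ⟨α, hα, hrec⟩ := exists_series_extending dx n (fun k => β.coeff (k - n))
    (fun k hk => hlow _ (by omega))
  refine ⟨α, (isAsymptoticSolution_iff dx α).mpr ⟨fun k hk => ?_, fun k => ?_⟩, ?_⟩
  · rw [hα k (by omega)]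
    exact hlow _ (by omega)
  · rcases le_or_gt (n : ℤ) k with hk | hk
    · rw [hrec k hk, map_zero]
    · have e := (flowEquation_iff dx β D).mp h (k - n)
      have hr : recur dx α k = recur dx β (k - n) := by
        simp only [recur]
        rw [hα k (by omega), hα (k - 1) (by omega), hα (k + 1) (by omega),
          show k - 1 - (n : ℤ) = k - n - 1 by ring, show k + 1 - (n : ℤ) = k - n + 1 by ring]
      rw [hr, ← e, coeff_formalQ, if_neg (by omega), if_neg (by omega)]
      split_ifs <;> simp
  · ext1
    funext k
    rw [coeff_polyPart]
    split_ifs with hk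
    · rw [hα _ (by omega), add_sub_cancel_right]
    · exact hhigh k (by omega)

/-! ### The normalized solution -/

theorem constantCoeff_recur (dx : Derivation 𝕜 K K) (α : Series K) (k : ℤ) :
    constantCoeff (recur dx α k) =
      dx (constantCoeff (α.coeff k)) - constantCoeff (α.coeff (k + 1)) := by
  simp [recur, constantCoeff_totalX, uu, vv]

theorem IsNormalizedSolution.dx_constantCoeff {dx : Derivation 𝕜 K K} {α : Series K}
    (hα : IsNormalizedSolution dx α) (k : ℤ) : dx (constantCoeff (α.coeff k)) = 0 := by
  rcases lt_trichotomy k 0 with hk | rfl | hk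
  · rw [hα.1.1 k hk, map_zero, map_zero]
  · rw [hα.2.1, map_one, Derivation.map_one_eq_zero]
  · rw [hα.2.2 k hk, map_zero]

/-- The defect lies in the kernel of $D_x$, hence in $K$, and the normalization makes its constant
term vanish; so the recursion holds without integration constants. -/
theorem IsNormalizedSolution.coeff_succ [IsDomain K] {dx : Derivation 𝕜 K K} {α : Series K}
    (hα : IsNormalizedSolution dx α) {k : ℤ} (hk : 0 ≤ k) :
    α.coeff (k + 1) =
      totalX dx (α.coeff k) + uu K * α.coeff k + vv K * α.coeff (k - 1) := by
  have h := eq_C_of_totalX_eq_zero dx (((isAsymptoticSolution_iff dx α).mp hα.1).2 k)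
  rw [constantCoeff_recur, hα.dx_constantCoeff, hα.2.2 (k + 1) (by omega), sub_zero, map_zero] at h
  exact (sub_eq_zero.mp h.1).symm

/-- Running the exact recursion from $\alpha_0=1$, each constant term is the $\partial_x$-derivative
of the preceding one, so all later ones vanish. Uniqueness holds because any normalized solution
obeys the same recursion. -/
theorem existsUnique_normalizedSolution [IsDomain K] (dx : Derivation 𝕜 K K) :
    ∃! α : Series K, IsNormalizedSolution dx α := by
  obtain ⟨α, hα, hrec⟩ := exists_series_extending dx 0 (fun k => if k = 0 then 1 else 0)
    (fun k hk => if_neg (by omega))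
  have hneg : ∀ k < 0, α.coeff k = 0 := fun k hk => by
    rw [hα k (by simpa using hk.le)]; exact if_neg (by omega)
  have h0 : α.coeff 0 = 1 := by rw [hα 0 (by simp)]; rfl
  have hconst : ∀ m : ℕ, constantCoeff (α.coeff (m + 1)) = dx (constantCoeff (α.coeff m)) := by
    intro m
    have h := constantCoeff_recur dx α m
    rw [hrec m (by simp), map_zero] at h
    exact (sub_eq_zero.mp h.symm).symm
  have hpos : ∀ m : ℕ, constantCoeff (α.coeff (m + 1)) = 0 := by
    intro m
    induction m with
    | zero => rw [hconst, Nat.cast_zero, h0, map_one, Derivation.map_one_eq_zero]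
    | succ m ih => rw [hconst, Nat.cast_succ, ih, map_zero]
  refine ⟨α, ⟨(isAsymptoticSolution_iff dx α).mpr ⟨hneg, fun k => ?_⟩, h0, fun k hk => ?_⟩, ?_⟩
  · rcases le_or_gt 0 k with hk | hk
    · rw [hrec k (by simpa using hk), map_zero]
    · rw [recur, hneg k hk, hneg (k - 1) (by omega)]
      -- At index $-1$ the defect is $-\alpha_0=-1$, nonzero but annihilated by $D_x$.
      rcases eq_or_ne k (-1) with rfl | hk1
      · simp [h0]
      · simp [hneg (k + 1) (by omega)]
  · obtain ⟨m, rfl⟩ : ∃ m : ℕ, k = m + 1 := ⟨(k - 1).toNat, by omega⟩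
    exact hpos m
  · intro β hβ
    have hβrec : ∀ m : ℕ, β.coeff m = α.coeff m ∧ β.coeff (m - 1) = α.coeff (m - 1) := by
      intro m
      induction m with
      | zero =>
        refine ⟨?_, ?_⟩
        · rw [Nat.cast_zero, hβ.2.1, h0]
        · rw [hβ.1.1 _ (by simp), hneg _ (by simp)]
      | succ m ih =>
        have e := hrec m (by simp)
        rw [recur, sub_eq_zero] at e
        rw [Nat.cast_succ, hβ.coeff_succ (by omega), add_sub_cancel_right, ih.1, ih.2, e]
        exact ⟨rfl, rfl⟩
    ext1
    funext k
    rcases le_or_gt 0 k with hk | hk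
    · obtain ⟨m, rfl⟩ := Int.eq_ofNat_of_zero_le hk
      exact (hβrec m).1
    · rw [hβ.1.1 k hk, hneg k hk]

theorem coeff_single_mul_X (p : DiffPoly K) (i j : Fin 2 × ℕ) :
    (p * X i).coeff (Finsupp.single j 1) = if j = i then constantCoeff p else 0 := by
  rw [coeff_mul_X']
  by_cases h : j = i
  · subst h; simp [constantCoeff_eq]
  · rw [if_neg h, if_neg]
    rw [Finsupp.mem_support_single]
    exact fun hh => h hh.1.symm

/-- The linear part of a total derivative. -/
theorem coeff_single_succ_totalX (dx : Derivation 𝕜 K K) (i : Fin 2) (j : ℕ) (p : DiffPoly K) :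
    (totalX dx p).coeff (Finsupp.single (i, j + 1) 1) =
      dx (p.coeff (Finsupp.single (i, j + 1) 1)) + p.coeff (Finsupp.single (i, j) 1) := by
  induction p using MvPolynomial.induction_on with
  | C c =>
    have h0 : ∀ k : Fin 2 × ℕ, (0 : Fin 2 × ℕ →₀ ℕ) ≠ Finsupp.single k 1 := fun k =>
      (Finsupp.single_ne_zero.mpr one_ne_zero).symm
    rw [totalX_C, coeff_C, coeff_C, coeff_C, if_neg (h0 _), if_neg (h0 _), if_neg (h0 _), map_zero,
      add_zero]
  | add p q hp hq => rw [map_add, coeff_add, hp, hq, coeff_add, coeff_add, map_add]; ring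
  | mul_X p k hp =>
    obtain ⟨k, l⟩ := k
    rw [Derivation.leibniz, smul_eq_mul, smul_eq_mul, totalX_X, mul_comm (X (k, l)), coeff_add,
      coeff_single_mul_X, coeff_single_mul_X, coeff_single_mul_X, coeff_single_mul_X,
      constantCoeff_totalX]
    simp only [Prod.mk.injEq, add_left_inj]
    split_ifs <;> simp_all

theorem coeff_single_zero_totalX (dx : Derivation 𝕜 K K) (i : Fin 2) (p : DiffPoly K) :
    (totalX dx p).coeff (Finsupp.single (i, 0) 1) = dx (p.coeff (Finsupp.single (i, 0) 1)) := by
  induction p using MvPolynomial.induction_on with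
  | C c =>
    have h0 : ∀ k : Fin 2 × ℕ, (0 : Fin 2 × ℕ →₀ ℕ) ≠ Finsupp.single k 1 := fun k =>
      (Finsupp.single_ne_zero.mpr one_ne_zero).symm
    rw [totalX_C, coeff_C, coeff_C, if_neg (h0 _), if_neg (h0 _), map_zero]
  | add p q hp hq => rw [map_add, coeff_add, hp, hq, coeff_add, map_add]
  | mul_X p k hp =>
    obtain ⟨k, l⟩ := k
    rw [Derivation.leibniz, smul_eq_mul, smul_eq_mul, totalX_X, mul_comm (X (k, l)), coeff_add,
      coeff_single_mul_X, coeff_single_mul_X, coeff_single_mul_X, constantCoeff_totalX]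
    simp only [Prod.mk.injEq]
    split_ifs <;> simp_all

/-- In the recursion, $u\alpha_m$ contributes to the linear part only through the constant term of
$\alpha_m$, nonzero only for $m=0$, and $v\alpha_{m-1}$ gives no $u_j$. So the $u$-linear part
starts as $u$ and is afterwards just differentiated. -/
theorem IsNormalizedSolution.coeff_single [IsDomain K] {dx : Derivation 𝕜 K K} {α : Series K}
    (hα : IsNormalizedSolution dx α) (m j : ℕ) :
    (α.coeff (m + 1)).coeff (Finsupp.single (0, j) 1) = if j = m then 1 else 0 := by
  have hlin : ∀ (j : ℕ) (i : Fin 2) (p : DiffPoly K), (X (i, 0) * p).coeff (Finsupp.single (0, j) 1) =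
      if ((0 : Fin 2), j) = (i, 0) then constantCoeff p else 0 := fun j i p => by
    rw [mul_comm, coeff_single_mul_X]
  induction m generalizing j with
  | zero =>
    rw [Nat.cast_zero, hα.coeff_succ le_rfl, hα.2.1, hα.1.1 _ (by simp), uu, mul_zero,
      Derivation.map_one_eq_zero, zero_add, add_zero, hlin, map_one]
    simp
  | succ m ih =>
    rw [Nat.cast_succ, hα.coeff_succ (by omega), uu, vv, coeff_add, coeff_add, hlin, hlin,
      hα.2.2 (m + 1) (by omega), if_neg (by simp : ¬ (((0 : Fin 2), j) = (1, 0)))]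
    rcases j with _ | j
    · rw [coeff_single_zero_totalX, ih]
      split_ifs <;> simp_all
    · rw [coeff_single_succ_totalX, ih, ih]
      simp only [add_left_inj]
      split_ifs <;> simp

theorem normalized_flows [IsDomain K] (dx : Derivation 𝕜 K K) {α : Series K}
    (hα : IsNormalizedSolution dx α) (D : ℕ → Derivation K (DiffPoly K) (DiffPoly K))
    (hD : ∀ n : ℕ, IsFlow dx (D n) ∧ FlowEquation dx (polyPart (lamPow K n * α)) (D n)) :
    (D 0 (uu K) = totalX dx (uu K) ∧ D 0 (vv K) = totalX dx (vv K)) ∧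
    polyPart (lamPow K 1 * α) = HahnSeries.C (uu K) + lamPow K 1 ∧
    (D 1 (uu K) = burgersField dx 0 ∧ D 1 (vv K) = burgersField dx 1) ∧
    (∀ n, ∃ a : DiffPoly K, totalX dx a = D n (uu K) ∧ constantCoeff a = 0 ∧
      D (n + 1) (uu K) = totalX dx (D n (uu K)) + totalX dx (uu K * a) + D n (vv K) ∧
      D (n + 1) (vv K) = totalX dx (vv K * a)) ∧
    LinearIndependent K D := by
  -- Thus $\alpha_{n+1}$ is the primitive $D_x^{-1}D_{t_n}u$ without constant term, and the
  -- recursion operator is the recursion for $\alpha$ rewritten.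
  have hDu : ∀ n : ℕ, D n (uu K) = totalX dx (α.coeff (n + 1)) := fun n => by
    rw [((flowEquation_polyPart_iff dx hα.1 n (D n)).mp (hD n).2).1, hα.coeff_succ (by omega)]
  have hDv : ∀ n : ℕ, D n (vv K) = totalX dx (vv K * α.coeff n) := fun n =>
    ((flowEquation_polyPart_iff dx hα.1 n (D n)).mp (hD n).2).2
  have hα1 : α.coeff 1 = uu K := by
    have h := hα.coeff_succ (k := 0) le_rfl
    rwa [hα.2.1, hα.1.1 (0 - 1) (by simp), mul_zero, Derivation.map_one_eq_zero, zero_add, add_zero,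
      mul_one, zero_add] at h
  have hα2 : α.coeff (1 + 1) = totalX dx (uu K) + uu K * uu K + vv K := by
    have h := hα.coeff_succ (k := 1) (by omega)
    rwa [hα1, sub_self, hα.2.1, mul_one] at h
  refine ⟨⟨?_, ?_⟩, ?_, ⟨?_, ?_⟩, fun n => ⟨α.coeff (n + 1), (hDu n).symm, hα.2.2 _ (by omega),
    ?_, ?_⟩, ?_⟩
  · rw [hDu, Nat.cast_zero, zero_add, hα1]
  · rw [hDv, Nat.cast_zero, hα.2.1, mul_one]
  · ext1
    funext k
    rw [coeff_polyPart, HahnSeries.coeff_add, HahnSeries.C_apply, lamPow, HahnSeries.coeff_single,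
      HahnSeries.coeff_single]
    rcases lt_trichotomy k 0 with hk | rfl | hk
    · rw [if_pos hk.le, if_neg hk.ne, zero_add]
      rcases eq_or_ne k (-1) with rfl | hk1
      · simp [hα.2.1]
      · rw [if_neg hk1, hα.1.1 _ (by omega)]
    · simp [hα1]
    · rw [if_neg (by omega), if_neg (by omega), if_neg (by omega), add_zero]
  · rw [hDu, Nat.cast_one, hα2, burgersField_zero, uu, vv]
    simp only [map_add, Derivation.leibniz, totalX_X, smul_eq_mul]
    ring
  · rw [hDv, Nat.cast_one, hα1, burgersField_one, uu, vv]
    simp only [Derivation.leibniz, totalX_X, smul_eq_mul]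
    ring
  · rw [hDu, hDu, hDv, Nat.cast_succ, hα.coeff_succ (by omega), add_sub_cancel_right, map_add,
      map_add]
  · rw [hDv, Nat.cast_succ]
  · rw [linearIndependent_iff']
    intro s g hg k hk
    -- The coefficient of $u_{k+1}$ in $D_{t_n}u=D_x\alpha_{n+1}$ is 1 for $n=k$ and 0 otherwise, so
    -- it extracts the $k$-th coefficient of a relation.
    have h := congrArg (coeff (Finsupp.single (0, k + 1) 1)) (DFunLike.congr_fun hg (uu K))
    rw [derivation_sum_apply, coeff_sum, Derivation.zero_apply, coeff_zero] at h
    rw [← h, Finset.sum_eq_single_of_mem k hk]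
    · rw [Derivation.smul_apply, coeff_smul, hDu, coeff_single_succ_totalX, hα.coeff_single,
        hα.coeff_single, if_neg (by omega), if_pos rfl, map_zero, zero_add, smul_eq_mul, mul_one]
    · intro n _ hn
      rw [Derivation.smul_apply, coeff_smul, hDu, coeff_single_succ_totalX, hα.coeff_single,
        hα.coeff_single, if_neg (fun h : k = n => hn h.symm)]
      split_ifs <;> simp

end Hierarchy

/-! ## Adjoining solutions of the Lax pair -/

section LogDerivation

variable {𝕜 : Type*} [RCLike 𝕜] {R : Type*} [CommRing R] [Algebra 𝕜 R] {M : Type*}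
  [AddCommMonoid M]

open AddMonoidAlgebra

/-- The derivation of a monoid algebra that extends `d` and has prescribed logarithmic derivatives
on the monomials, as a linear map. -/
def logLinear (d : Derivation 𝕜 R R) (w : M →+ AddMonoidAlgebra R M) :
    AddMonoidAlgebra R M →ₗ[𝕜] AddMonoidAlgebra R M :=
  (Finsupp.lsum 𝕜 fun m => (lsingle m : R →ₗ[𝕜] AddMonoidAlgebra R M) ∘ₗ d.toLinearMap +
    LinearMap.mulRight 𝕜 (w m) ∘ₗ (lsingle m : R →ₗ[𝕜] AddMonoidAlgebra R M)) ∘ₗ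
    (coeffLinearEquiv 𝕜).toLinearMap

theorem logLinear_single (d : Derivation 𝕜 R R) (w : M →+ AddMonoidAlgebra R M) (m : M) (r : R) :
    logLinear d w (single m r) = single m (d r) + single m r * w m := by
  change (Finsupp.lsum 𝕜 _) (Finsupp.single m r) = _
  rw [Finsupp.lsum_single]
  rfl

/-- The derivation of a monoid algebra that extends `d` and has prescribed logarithmic derivatives
on the monomials. -/
def logDerivation (d : Derivation 𝕜 R R) (w : M →+ AddMonoidAlgebra R M) :
    Derivation 𝕜 (AddMonoidAlgebra R M) (AddMonoidAlgebra R M) :=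
  Derivation.mk' (logLinear d w) (by
    intro p q
    simp only [smul_eq_mul]
    induction p using induction_linear with
    | zero => simp
    | add p p' hp hp' => rw [add_mul, map_add, hp, hp', map_add]; ring
    | single m r =>
      induction q using induction_linear with
      | zero => simp
      | add q q' hq hq' => rw [mul_add, map_add, hq, hq', map_add]; ring
      | single n s =>
        rw [single_mul_single, logLinear_single, logLinear_single, logLinear_single, mul_add,
          mul_add, single_mul_single, single_mul_single, map_add, ← single_mul_single,
          Derivation.leibniz, single_add, smul_eq_mul, smul_eq_mul, add_comm n m]
        ring)

theorem logDerivation_single (d : Derivation 𝕜 R R) (w : M →+ AddMonoidAlgebra R M) (m : M)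
    (r : R) : logDerivation d w (single m r) = single m (d r) + single m r * w m :=
  logLinear_single d w m r

theorem logDerivation_algebraMap (d : Derivation 𝕜 R R) (w : M →+ AddMonoidAlgebra R M) (r : R) :
    logDerivation d w (algebraMap R _ r) = algebraMap R _ (d r) := by
  have h : ∀ s : R, algebraMap R (AddMonoidAlgebra R M) s = single 0 s := fun s => rfl
  rw [h, h, logDerivation_single, map_zero, mul_zero, add_zero]

/-- On a monomial both orders produce the same products of logarithmic derivatives, so commutation
reduces to the closedness condition $D_1w_2=D_2w_1$. -/
theorem logDerivation_comm {d₁ d₂ : Derivation 𝕜 R R} {w₁ w₂ : M →+ AddMonoidAlgebra R M}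
    (hd : ∀ r, d₁ (d₂ r) = d₂ (d₁ r))
    (hw : ∀ m, logDerivation d₁ w₁ (w₂ m) = logDerivation d₂ w₂ (w₁ m))
    (p : AddMonoidAlgebra R M) :
    logDerivation d₁ w₁ (logDerivation d₂ w₂ p) = logDerivation d₂ w₂ (logDerivation d₁ w₁ p) := by
  induction p using induction_linear with
  | zero => simp
  | add p q hp hq => simp only [map_add, hp, hq]
  | single m r =>
    simp only [logDerivation_single, map_add, Derivation.leibniz, smul_eq_mul, hd, hw]
    ring

end LogDerivation

/-! ### The Lax pair over the reduced ring and its solution in Laurent polynomials -/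

section Solvable

variable {𝕜 : Type*} [RCLike 𝕜] {K : Type u} [CommRing K] [Algebra 𝕜 K]

open AddMonoidAlgebra

/-- The additive map on exponents given by the logarithmic derivatives of the two generators. -/
def logPair {A : Type*} [AddCommGroup A] (a b : A) : ℤ × ℤ →+ A where
  toFun m := m.1 • a + m.2 • b
  map_zero' := by simp
  map_add' m n := by simp only [Prod.fst_add, Prod.snd_add, add_smul]; abel

theorem logPair_apply {A : Type*} [AddCommGroup A] (a b : A) (m : ℤ × ℤ) :
    logPair a b m = m.1 • a + m.2 • b := rfl

theorem totalX_algebraMap (dx : Derivation 𝕜 K K) (c : 𝕜) :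
    totalX dx (algebraMap 𝕜 (DiffPoly K) c) = 0 :=
  Derivation.map_algebraMap _ _

theorem totalT_algebraMap (dx dt : Derivation 𝕜 K K) (c : 𝕜) :
    totalT dx dt (algebraMap 𝕜 (DiffPoly K) c) = 0 :=
  Derivation.map_algebraMap _ _

theorem totalT_spectralQ (dx dt : Derivation 𝕜 K K) {lam : 𝕜} (hlam : lam ≠ 0) :
    totalT dx dt (spectralQ K lam) = totalX dx (totalX dx (spectralAlpha K lam)
      + spectralQ K lam * spectralAlpha K lam) := by
  have hinv : algebraMap 𝕜 (DiffPoly K) lam⁻¹ * algebraMap 𝕜 (DiffPoly K) lam = 1 := by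
    rw [← map_mul, inv_mul_cancel₀ hlam, map_one]
  simp only [spectralQ, spectralAlpha, uu, vv, map_add, map_sub, Derivation.leibniz, totalX_X,
    totalT_X, totalX_algebraMap, totalT_algebraMap, smul_eq_mul, mul_zero, add_zero, sub_zero,
    Function.iterate_zero, id, burgersField_zero, burgersField_one]
  linear_combination (-MvPolynomial.X (1, 1) : DiffPoly K) * hinv

theorem curvature_burgers (dx dt : Derivation 𝕜 K K) {lam : 𝕜} (hlam : lam ≠ 0) :
    curvature (totalX dx) (totalT dx dt) (laxL 𝕜 (spectralQ K lam))
      (laxP 𝕜 (spectralQ K lam) (spectralAlpha K lam) (totalX dx (spectralAlpha K lam))) = 0 :=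
  (curvature_lax_eq_zero_iff (𝕜 := 𝕜) (totalX dx).toLinearMap.toAddMonoidHom
    (totalT dx dt).toLinearMap.toAddMonoidHom (totalT dx dt).map_one_eq_zero _ _).mpr
    (totalT_spectralQ dx dt hlam)

/-- The extension is the ring of Laurent polynomials in $f$ and $h=\hat ff$, with exponents in
$\mathbb Z\times\mathbb Z$. In these variables the system is logarithmic: $f_x/f=q/2$, $f_t/f=b$,
$h_x/h=f^2/h$ and $h_t/h=\alpha f^2/h$, while $\hat f=hf^{-1}$. Only the scalar conservation law for
$q$ is used. -/
theorem laxSolvableInExtension (dx dt : Derivation 𝕜 K K) (hcomm : ∀ c, dx (dt c) = dt (dx c))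
    {lam : 𝕜} (hlam : lam ≠ 0) : LaxSolvableInExtension dx dt lam := by
  have two : ∀ x : DiffPoly K, (2⁻¹ : 𝕜) • x + (2⁻¹ : 𝕜) • x = x := fun x => by
    rw [← add_smul, ← two_mul, mul_inv_cancel₀ two_ne_zero, one_smul]
  have hqα := totalT_spectralQ dx dt hlam
  unfold LaxSolvableInExtension
  generalize spectralQ K lam = q at *
  generalize spectralAlpha K lam = α at *
  obtain ⟨a, ha⟩ : ∃ a : DiffPoly K, a = (2⁻¹ : 𝕜) • q := ⟨_, rfl⟩
  obtain ⟨b, hb⟩ : ∃ b : DiffPoly K, b = (2⁻¹ : 𝕜) • totalX dx α + (2⁻¹ : 𝕜) • (α * q) := ⟨_, rfl⟩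
  have hab : totalX dx b = totalT dx dt a := by
    rw [ha, hb, Derivation.map_smul, hqα, map_add, Derivation.map_smul,
      Derivation.map_smul, map_add, smul_add, mul_comm α q]
  have hrel : totalX dx α + (2 * (a * α)) = 2 * b := by
    have h1 := two (totalX dx α)
    have h2 := two (α * q)
    have h3 : a * α = (2⁻¹ : 𝕜) • (α * q) := by rw [ha, smul_mul_assoc, mul_comm]
    rw [h3, hb]
    linear_combination -h1
  let E := AddMonoidAlgebra (DiffPoly K) (ℤ × ℤ)
  -- $S=f^2/h=f/\hat f$, the logarithmic $x$-derivative of $h$.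
  obtain ⟨S, hS⟩ : ∃ S : E, S = single (2, -1) 1 := ⟨_, rfl⟩
  obtain ⟨wx, hwx⟩ : ∃ w : ℤ × ℤ →+ E, w = logPair (algebraMap _ E a) S := ⟨_, rfl⟩
  obtain ⟨wt, hwt⟩ : ∃ w : ℤ × ℤ →+ E, w = logPair (algebraMap _ E b) (algebraMap _ E α * S) :=
    ⟨_, rfl⟩
  have hone : ∀ (d : Derivation 𝕜 (DiffPoly K) (DiffPoly K)) (w : ℤ × ℤ →+ E) (m : ℤ × ℤ),
      logDerivation d w (single m 1) = single m 1 * w m := fun d w m => by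
    rw [logDerivation_single, Derivation.map_one_eq_zero, single_zero, zero_add]
  -- Closedness for the generator $h$: from $S_x=S(2a-S)$ and $S_t=S(2b-\alpha S)$, the identity
  -- $(\alpha S)_x=S_t$ reduces to $\alpha_x+2a\alpha=2b$.
  have hDS : logDerivation (totalX dx) wx (algebraMap _ E α * S) =
      logDerivation (totalT dx dt) wt S := by
    have h := congrArg (algebraMap (DiffPoly K) E) hrel
    simp only [map_add, map_mul, map_ofNat] at h
    have h1 : logDerivation (totalX dx) wx S = S * (2 * algebraMap _ E a - S) := by
      conv_lhs => rw [hS]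
      rw [hone, ← hS, hwx, logPair_apply, zsmul_eq_mul, zsmul_eq_mul]
      push_cast
      ring
    have h2 : logDerivation (totalT dx dt) wt S =
        S * (2 * algebraMap _ E b - algebraMap _ E α * S) := by
      conv_lhs => rw [hS]
      rw [hone, ← hS, hwt, logPair_apply, zsmul_eq_mul, zsmul_eq_mul]
      push_cast
      ring
    rw [Derivation.leibniz, logDerivation_algebraMap, h1, h2, smul_eq_mul, smul_eq_mul]
    linear_combination S * h
  have hw : ∀ m, logDerivation (totalX dx) wx (wt m) = logDerivation (totalT dx dt) wt (wx m) := by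
    intro m
    have h1 : wt m = m.1 • algebraMap _ E b + m.2 • (algebraMap _ E α * S) := by rw [hwt]; rfl
    have h2 : wx m = m.1 • algebraMap _ E a + m.2 • S := by rw [hwx]; rfl
    rw [h1, h2, map_add, map_add, map_zsmul, map_zsmul, map_zsmul, map_zsmul,
      logDerivation_algebraMap, logDerivation_algebraMap, hab, hDS]
  have hf : (single (-1, 1) 1 : E) * S = single (1, 0) 1 := by
    rw [hS, single_mul_single, one_mul]
    rfl
  have halg : ∀ s : DiffPoly K, algebraMap (DiffPoly K) E s = single 0 s := fun s => rfl
  refine ⟨E, inferInstance, inferInstance, inferInstance, inferInstance,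
    logDerivation (totalX dx) wx, logDerivation (totalT dx dt) wt, single (1, 0) 1,
    single (-1, 1) 1, inferInstance, ?_, logDerivation_algebraMap _ _, logDerivation_algebraMap _ _,
    logDerivation_comm (fun r => (totalT_totalX dx dt hcomm r).symm) hw, ?_, ?_, ?_⟩
  · intro r s hrs
    rw [halg, halg] at hrs
    simpa using congrArg (fun p => p.coeff 0) hrs
  · refine IsUnit.of_mul_eq_one (single (-1, 0) 1) ?_
    rw [single_mul_single, one_mul]
    rfl
  · rw [hone, hone, hwx, logPair_apply, logPair_apply, laxL, smul_neg, ← ha]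
    funext i
    fin_cases i
    · simp [Matrix.mulVec, dotProduct, mul_comm]
    · simp [Matrix.mulVec, dotProduct, mul_add, hf]
      ring
  · have hb' : -((2⁻¹ : 𝕜) • totalX dx α) + (2⁻¹ : 𝕜) • (α * -q) = -b := by
      rw [hb, mul_neg, smul_neg]; ring
    rw [hone, hone, hwt, logPair_apply, logPair_apply, laxP, hb', ← hb]
    funext i
    fin_cases i
    · simp [Matrix.mulVec, dotProduct, mul_comm]
    · simp [Matrix.mulVec, dotProduct]
      linear_combination algebraMap (DiffPoly K) E α * hf

end Solvable

/-! ## Calculus on `ℝ × I` -/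

section Calculus

variable {E : Type*} [NormedAddCommGroup E] [NormedSpace ℝ E] {I : Set ℝ}

theorem isOpen_strip (hI : IsOpen I) : IsOpen (Set.univ ×ˢ I : Set (ℝ × ℝ)) :=
  isOpen_univ.prod hI

theorem mem_strip {t : ℝ} (ht : t ∈ I) (x : ℝ) : (x, t) ∈ (Set.univ ×ˢ I : Set (ℝ × ℝ)) :=
  ⟨trivial, ht⟩

theorem hasDerivAt_slice_fst {w : ℝ → ℝ → E} {x t : ℝ} {w' : ℝ × ℝ →L[ℝ] E}
    (h : HasFDerivAt (Function.uncurry w) w' (x, t)) :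
    HasDerivAt (fun y => w y t) (w' (1, 0)) x :=
  h.comp_hasDerivAt (f := fun y => (y, t)) x ((hasDerivAt_id x).prodMk (hasDerivAt_const x t))

theorem hasDerivAt_slice_snd {w : ℝ → ℝ → E} {x t : ℝ} {w' : ℝ × ℝ →L[ℝ] E}
    (h : HasFDerivAt (Function.uncurry w) w' (x, t)) :
    HasDerivAt (fun s => w x s) (w' (0, 1)) t :=
  h.comp_hasDerivAt t ((hasDerivAt_const t x).prodMk (hasDerivAt_id t))

namespace SmoothOn

variable {w : ℝ → ℝ → E} {x t : ℝ}

theorem hasFDerivAt (hw : SmoothOn I w) (hI : IsOpen I) (x : ℝ) (ht : t ∈ I) :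
    HasFDerivAt (Function.uncurry w) (fderiv ℝ (Function.uncurry w) (x, t)) (x, t) :=
  ((hw.differentiableOn (by simp)).differentiableAt
    ((isOpen_strip hI).mem_nhds (mem_strip ht x))).hasFDerivAt

theorem hasDerivAt_dX (hw : SmoothOn I w) (hI : IsOpen I) (x : ℝ) (ht : t ∈ I) :
    HasDerivAt (fun y => w y t) (Burgers.dX w x t) x :=
  (hasDerivAt_slice_fst (hw.hasFDerivAt hI x ht)).differentiableAt.hasDerivAt

theorem hasDerivAt_dT (hw : SmoothOn I w) (hI : IsOpen I) (x : ℝ) (ht : t ∈ I) :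
    HasDerivAt (fun s => w x s) (Burgers.dT w x t) t :=
  (hasDerivAt_slice_snd (hw.hasFDerivAt hI x ht)).differentiableAt.hasDerivAt

theorem dX_eq_fderiv (hw : SmoothOn I w) (hI : IsOpen I) (x : ℝ) (ht : t ∈ I) :
    Burgers.dX w x t = fderiv ℝ (Function.uncurry w) (x, t) (1, 0) :=
  (hasDerivAt_slice_fst (hw.hasFDerivAt hI x ht)).deriv

theorem dT_eq_fderiv (hw : SmoothOn I w) (hI : IsOpen I) (x : ℝ) (ht : t ∈ I) :
    Burgers.dT w x t = fderiv ℝ (Function.uncurry w) (x, t) (0, 1) :=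
  (hasDerivAt_slice_snd (hw.hasFDerivAt hI x ht)).deriv

theorem dX (hw : SmoothOn I w) (hI : IsOpen I) : SmoothOn I (Burgers.dX w) :=
  ((hw.fderiv_of_isOpen (m := ∞) (isOpen_strip hI) (by simp)).clm_apply
    contDiffOn_const).congr fun p hp => hw.dX_eq_fderiv hI p.1 hp.2

theorem congr {w' : ℝ → ℝ → E} (hw : SmoothOn I w) (h : ∀ x, ∀ t ∈ I, w' x t = w x t) :
    SmoothOn I w' :=
  ContDiffOn.congr hw fun p hp => h p.1 p.2 hp.2

end SmoothOn

theorem dX_congr {w w' : ℝ → ℝ → E} (h : ∀ x, ∀ t ∈ I, w x t = w' x t) (x : ℝ) {t : ℝ}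
    (ht : t ∈ I) : dX w x t = dX w' x t := by
  unfold dX
  rw [show (fun y => w y t) = fun y => w' y t from funext fun y => h y t ht]

/-- Openness of $I$ is needed because the $t$-derivative sees nearby times; the $x$-derivative stays
within one time slice. -/
theorem dT_congr {w w' : ℝ → ℝ → E} (hI : IsOpen I) (h : ∀ x, ∀ t ∈ I, w x t = w' x t) (x : ℝ)
    {t : ℝ} (ht : t ∈ I) : dT w x t = dT w' x t :=
  Filter.EventuallyEq.deriv_eq (Filter.mem_of_superset (hI.mem_nhds ht) fun s hs => h x s hs)

theorem SmoothOn.dT_dX {w : ℝ → ℝ → E} (hw : SmoothOn I w) (hI : IsOpen I) (x : ℝ) {t : ℝ}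
    (ht : t ∈ I) : Burgers.dT (Burgers.dX w) x t = Burgers.dX (Burgers.dT w) x t := by
  have hmem := (isOpen_strip hI).mem_nhds (mem_strip ht x)
  have hd : HasFDerivAt (fderiv ℝ (Function.uncurry w))
      (fderiv ℝ (fderiv ℝ (Function.uncurry w)) (x, t)) (x, t) :=
    (((hw.fderiv_of_isOpen (m := ∞) (isOpen_strip hI) (by simp)).differentiableOn
      (by simp)).differentiableAt hmem).hasFDerivAt
  have hsymm : IsSymmSndFDerivAt ℝ (Function.uncurry w) (x, t) :=
    (hw.contDiffAt hmem).isSymmSndFDerivAt <| by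
      rw [minSmoothness_of_isRCLikeNormedField]
      exact WithTop.coe_le_coe.mpr (le_top (a := (2 : ℕ∞)))
  have hX : Burgers.dT (Burgers.dX w) x t =
      fderiv ℝ (fderiv ℝ (Function.uncurry w)) (x, t) (0, 1) (1, 0) := by
    rw [dT_congr hI (w' := fun x t => fderiv ℝ (Function.uncurry w) (x, t) (1, 0))
      (fun x t ht => hw.dX_eq_fderiv hI x ht) x ht]
    exact (hasDerivAt_slice_snd (w := fun x t => fderiv ℝ (Function.uncurry w) (x, t) (1, 0))
      (((ContinuousLinearMap.apply ℝ E ((1, 0) : ℝ × ℝ)).hasFDerivAt).comp (x, t) hd)).deriv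
  have hT : Burgers.dX (Burgers.dT w) x t =
      fderiv ℝ (fderiv ℝ (Function.uncurry w)) (x, t) (1, 0) (0, 1) := by
    rw [dX_congr (w' := fun x t => fderiv ℝ (Function.uncurry w) (x, t) (0, 1))
      (fun x t ht => hw.dT_eq_fderiv hI x ht) x ht]
    exact (hasDerivAt_slice_fst (w := fun x t => fderiv ℝ (Function.uncurry w) (x, t) (0, 1))
      (((ContinuousLinearMap.apply ℝ E ((0, 1) : ℝ × ℝ)).hasFDerivAt).comp (x, t) hd)).deriv
  rw [hX, hT, hsymm.eq]

/-- A smooth closed one-form `a dx + b dt` on `ℝ × I` is the differential of a smooth function. -/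
theorem exists_potential [CompleteSpace E] (hI : IsOpen I) (hI' : I.OrdConnected)
    {a b : ℝ → ℝ → E} (ha : SmoothOn I a) (hb : SmoothOn I b)
    (hab : ∀ x, ∀ t ∈ I, dT a x t = dX b x t) :
    ∃ φ, SmoothOn I φ ∧ ∀ x, ∀ t ∈ I, dX φ x t = a x t ∧ dT φ x t = b x t := by
  let A := ContinuousLinearMap.smulRightL ℝ (ℝ × ℝ) E (ContinuousLinearMap.fst ℝ ℝ ℝ)
  let B := ContinuousLinearMap.smulRightL ℝ (ℝ × ℝ) E (ContinuousLinearMap.snd ℝ ℝ ℝ)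
  let θ : ℝ × ℝ → ℝ × ℝ →L[ℝ] E := fun p => A (Function.uncurry a p) + B (Function.uncurry b p)
  have hθ : ContDiffOn ℝ ∞ θ (Set.univ ×ˢ I) :=
    (A.contDiff.comp_contDiffOn ha).add (B.contDiff.comp_contDiffOn hb)
  have hsymm : ∀ p ∈ (Set.univ ×ˢ I : Set (ℝ × ℝ)), ∀ y z,
      fderiv ℝ θ p y z = fderiv ℝ θ p z y := by
    rintro ⟨x, t⟩ ⟨-, ht⟩ ⟨y₁, y₂⟩ ⟨z₁, z₂⟩
    have hd : HasFDerivAt θ (A ∘L fderiv ℝ (Function.uncurry a) (x, t) +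
        B ∘L fderiv ℝ (Function.uncurry b) (x, t)) (x, t) :=
      (A.hasFDerivAt.comp _ (ha.hasFDerivAt hI x ht)).add
        (B.hasFDerivAt.comp _ (hb.hasFDerivAt hI x ht))
    have hlin : ∀ (l : ℝ × ℝ →L[ℝ] E) (r s : ℝ), l (r, s) = r • l (1, 0) + s • l (0, 1) := by
      intro l r s
      rw [← map_smul, ← map_smul, ← map_add]
      simp
    have h := hab x t ht
    rw [ha.dT_eq_fderiv hI x ht, hb.dX_eq_fderiv hI x ht] at h
    rw [hd.fderiv]
    change z₁ • fderiv ℝ (Function.uncurry a) (x, t) (y₁, y₂) +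
      z₂ • fderiv ℝ (Function.uncurry b) (x, t) (y₁, y₂) =
      y₁ • fderiv ℝ (Function.uncurry a) (x, t) (z₁, z₂) +
      y₂ • fderiv ℝ (Function.uncurry b) (x, t) (z₁, z₂)
    rw [hlin _ y₁ y₂, hlin _ y₁ y₂, hlin _ z₁ z₂, hlin _ z₁ z₂, h]
    module
  -- The strip is convex because $I$ is an interval, so the Poincaré lemma applies to the form with
  -- symmetric derivative.
  obtain ⟨f, hf⟩ := (convex_univ.prod hI'.convex).exists_forall_hasFDerivAt_of_fderiv_symmetric
    (isOpen_strip hI) (hθ.differentiableOn (by simp)) hsymm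
  refine ⟨Function.curry f, ?_, fun x t ht => ⟨?_, ?_⟩⟩
  · refine (contDiffOn_infty_iff_fderiv_of_isOpen (isOpen_strip hI)).mpr
      ⟨fun p hp => (hf p hp).differentiableAt.differentiableWithinAt, ?_⟩
    exact hθ.congr fun p hp => (hf p hp).fderiv
  · refine (hasDerivAt_slice_fst (w := Function.curry f) (hf (x, t) (mem_strip ht x))).deriv.trans ?_
    change (1 : ℝ) • a x t + (0 : ℝ) • b x t = a x t
    rw [one_smul, zero_smul, add_zero]
  · refine (hasDerivAt_slice_snd (w := Function.curry f) (hf (x, t) (mem_strip ht x))).deriv.trans ?_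
    change (0 : ℝ) • a x t + (1 : ℝ) • b x t = b x t
    rw [one_smul, zero_smul, zero_add]

end Calculus

/-! ## The Hopf-Cole type transformation -/

section HopfCole

variable {I : Set ℝ} {u v : ℝ → ℝ → ℝ}

theorem SmoothOn.ofReal (hu : SmoothOn I u) : SmoothOn I (fun x t => (u x t : ℂ)) :=
  Complex.ofRealCLM.contDiff.comp_contDiffOn hu

/-- The flux `u_x + u² + v` of the first equation. -/
def flux (u v : ℝ → ℝ → ℝ) (x t : ℝ) : ℝ := dX u x t + u x t ^ 2 + v x t

theorem smoothOn_flux (hI : IsOpen I) (hu : SmoothOn I u) (hv : SmoothOn I v) :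
    SmoothOn I (flux u v) :=
  ((hu.dX hI).add (ContDiffOn.pow hu 2)).add hv

theorem dX_flux (hI : IsOpen I) (hu : SmoothOn I u) (hv : SmoothOn I v) (x : ℝ) {t : ℝ}
    (ht : t ∈ I) : dX (flux u v) x t = dX (dX u) x t + 2 * u x t * dX u x t + dX v x t := by
  have h := (((hu.dX hI).hasDerivAt_dX hI x ht).add
    ((hu.hasDerivAt_dX hI x ht).pow 2)).add (hv.hasDerivAt_dX hI x ht)
  refine h.deriv.trans ?_
  push_cast
  ring

theorem firstEquation_iff (hI : IsOpen I) (hu : SmoothOn I u) (hv : SmoothOn I v) :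
    FirstEquation I u v ↔ ∀ x, ∀ t ∈ I, dT u x t = dX (flux u v) x t :=
  forall₃_congr fun x _ ht => by rw [dX_flux hI hu hv x ht]

/-- The logarithm of a solution of the linear equation is a potential of the first equation. -/
theorem IsHopfCole.potential (hI : IsOpen I) {g : ℝ → ℝ → ℝ}
    (hu : SmoothOn I u) (hg : IsHopfCole I u v g) :
    SmoothOn I (fun x t => Real.log (g x t)) ∧ ∀ x, ∀ t ∈ I,
      dX (fun x t => Real.log (g x t)) x t = u x t ∧
      dT (fun x t => Real.log (g x t)) x t = flux u v x t := by
  obtain ⟨hs, hpos, hlog, heq⟩ := hg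
  refine ⟨ContDiffOn.log hs fun p hp => (hpos p.1 p.2 hp.2).ne', fun x t ht => ⟨(hlog x t ht).symm,
    ?_⟩⟩
  have hgx : ∀ x, ∀ t ∈ I, dX g x t = u x t * g x t := by
    intro x t ht
    have h := ((hs.hasDerivAt_dX hI x ht).log (hpos x t ht).ne').deriv
    rw [hlog x t ht]
    refine (div_eq_iff (hpos x t ht).ne').mp ?_
    exact h.symm
  have hgxx : dX (dX g) x t = dX u x t * g x t + u x t * dX g x t := by
    rw [dX_congr hgx x ht]
    exact ((hu.hasDerivAt_dX hI x ht).mul (hs.hasDerivAt_dX hI x ht)).deriv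
  refine ((hs.hasDerivAt_dT hI x ht).log (hpos x t ht).ne').deriv.trans ?_
  rw [heq x t ht, hgxx, hgx x t ht, div_eq_iff (hpos x t ht).ne', flux]
  ring

/-- The first equation is the closedness of $u\,dx+(u_x+u^2+v)\,dt$. The exponential of a potential
satisfies the linear equation; conversely $\ln\tilde g$ is a potential, and its mixed derivatives
agree. -/
theorem firstEquation_iff_exists_isHopfCole (hI : IsOpen I) (hI' : I.OrdConnected)
    (hu : SmoothOn I u) (hv : SmoothOn I v) :
    FirstEquation I u v ↔ ∃ g, IsHopfCole I u v g := by
  rw [firstEquation_iff hI hu hv]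
  constructor
  · intro h
    obtain ⟨φ, hφ, hd⟩ := exists_potential hI hI' hu (smoothOn_flux hI hu hv) h
    have hg : SmoothOn I (fun x t => Real.exp (φ x t)) := ContDiffOn.exp hφ
    have hgx : ∀ x, ∀ t ∈ I, dX (fun x t => Real.exp (φ x t)) x t =
        u x t * Real.exp (φ x t) := fun x t ht => by
      refine (hφ.hasDerivAt_dX hI x ht).exp.deriv.trans ?_
      rw [(hd x t ht).1, mul_comm]
    refine ⟨_, hg, fun x t _ => Real.exp_pos _, fun x t ht => ?_, fun x t ht => ?_⟩
    · simp only [Real.log_exp]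
      exact (hd x t ht).1.symm
    · rw [dX_congr hgx x ht]
      refine (hφ.hasDerivAt_dT hI x ht).exp.deriv.trans ?_
      rw [show dX (fun x t => u x t * Real.exp (φ x t)) x t = _ from
        ((hu.hasDerivAt_dX hI x ht).mul (hg.hasDerivAt_dX hI x ht)).deriv, hgx x t ht,
        (hd x t ht).2, flux]
      ring
  · rintro ⟨g, hg⟩ x t ht
    obtain ⟨hs, hd⟩ := hg.potential hI hu
    rw [← dT_congr hI (fun x t ht => (hd x t ht).1) x ht, hs.dT_dX hI x ht,
      dX_congr (fun x t ht => (hd x t ht).2) x ht]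

end HopfCole

/-! ## The Lax pair on `ℝ × I` -/

section Lax

variable {I : Set ℝ} {u v : ℝ → ℝ → ℝ} {lam : ℂ}

/-- The function `q = u + λ⁻¹ v - λ`. -/
def laxQ (u v : ℝ → ℝ → ℝ) (lam : ℂ) (x t : ℝ) : ℂ := (u x t : ℂ) + lam⁻¹ * v x t - lam

/-- The function `α_x + α q` with `α = u + λ`. -/
def laxFlux (u v : ℝ → ℝ → ℝ) (lam : ℂ) (x t : ℝ) : ℂ :=
  dX (fun x t => (u x t : ℂ) + lam) x t + ((u x t : ℂ) + lam) * laxQ u v lam x t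

theorem smoothOn_laxAlpha (hu : SmoothOn I u) (lam : ℂ) :
    SmoothOn I (fun x t => (u x t : ℂ) + lam) :=
  ContDiffOn.add hu.ofReal contDiffOn_const

theorem smoothOn_laxQ (hu : SmoothOn I u) (hv : SmoothOn I v) (lam : ℂ) :
    SmoothOn I (laxQ u v lam) :=
  (ContDiffOn.add hu.ofReal (contDiffOn_const.mul hv.ofReal)).sub contDiffOn_const

theorem smoothOn_laxFlux (hI : IsOpen I) (hu : SmoothOn I u) (hv : SmoothOn I v) (lam : ℂ) :
    SmoothOn I (laxFlux u v lam) :=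
  ((smoothOn_laxAlpha hu lam).dX hI).add ((smoothOn_laxAlpha hu lam).mul (smoothOn_laxQ hu hv lam))

theorem dX_laxAlpha (hI : IsOpen I) (hu : SmoothOn I u) (lam : ℂ) (x : ℝ) {t : ℝ} (ht : t ∈ I) :
    dX (fun x t => (u x t : ℂ) + lam) x t = ((dX u x t : ℝ) : ℂ) :=
  ((hu.hasDerivAt_dX hI x ht).ofReal_comp.add_const lam).deriv

theorem laxFlux_eq (hI : IsOpen I) (hu : SmoothOn I u) (hlam : lam ≠ 0) (x : ℝ) {t : ℝ}
    (ht : t ∈ I) :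
    laxFlux u v lam x t = (flux u v x t : ℂ) + lam⁻¹ * (u x t * v x t : ℝ) - lam ^ 2 := by
  rw [laxFlux, laxQ, flux, dX_laxAlpha hI hu lam x ht]
  push_cast
  field_simp
  ring

theorem dT_laxQ (hI : IsOpen I) (hu : SmoothOn I u) (hv : SmoothOn I v) (x : ℝ) {t : ℝ}
    (ht : t ∈ I) : dT (laxQ u v lam) x t = ((dT u x t : ℝ) : ℂ) + lam⁻¹ * ((dT v x t : ℝ) : ℂ) :=
  ((((hu.hasDerivAt_dT hI x ht).ofReal_comp).add
    (((hv.hasDerivAt_dT hI x ht).ofReal_comp).const_mul lam⁻¹)).sub_const lam).deriv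

theorem dX_laxFlux (hI : IsOpen I) (hu : SmoothOn I u) (hv : SmoothOn I v) (hlam : lam ≠ 0)
    (x : ℝ) {t : ℝ} (ht : t ∈ I) : dX (laxFlux u v lam) x t =
      ((dX (flux u v) x t : ℝ) : ℂ) + lam⁻¹ * (dX u x t * v x t + u x t * dX v x t : ℝ) := by
  rw [dX_congr (fun x t ht => laxFlux_eq hI hu hlam x ht) x ht]
  exact ((((smoothOn_flux hI hu hv).hasDerivAt_dX hI x ht).ofReal_comp.add
    ((((hu.hasDerivAt_dX hI x ht).mul (hv.hasDerivAt_dX hI x ht)).ofReal_comp).const_mul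
      lam⁻¹)).sub_const (lam ^ 2)).deriv

/-- The system is equivalent to the conservation law `q_t = (α_x + α q)_x` for all `λ`. -/
theorem system_iff_laxFlux (hI : IsOpen I) (hu : SmoothOn I u) (hv : SmoothOn I v) :
    (FirstEquation I u v ∧ SecondEquation I u v) ↔
      ∀ lam : ℂ, lam ≠ 0 → ∀ x, ∀ t ∈ I, dT (laxQ u v lam) x t = dX (laxFlux u v lam) x t := by
  rw [firstEquation_iff hI hu hv]
  constructor
  · rintro ⟨h₁, h₂⟩ lam hlam x t ht
    rw [dT_laxQ hI hu hv x ht, dX_laxFlux hI hu hv hlam x ht, h₁ x t ht, h₂ x t ht]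
  · intro h
    have both : ∀ x, ∀ t ∈ I, dT u x t = dX (flux u v) x t ∧
        dT v x t = dX u x t * v x t + u x t * dX v x t := by
      intro x t ht
      -- The conservation law is affine in $\lambda^{-1}$, so the values at $\lambda=\pm1$ separate
      -- its two coefficients.
      have h₁ := h 1 one_ne_zero x t ht
      have h₂ := h (-1) (neg_ne_zero.mpr one_ne_zero) x t ht
      rw [dT_laxQ hI hu hv x ht, dX_laxFlux hI hu hv (by norm_num) x ht, inv_neg, inv_one] at h₂
      rw [dT_laxQ hI hu hv x ht, dX_laxFlux hI hu hv one_ne_zero x ht, inv_one] at h₁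
      constructor <;> apply Complex.ofReal_injective
      · linear_combination (h₁ + h₂) / 2
      · linear_combination (h₁ - h₂) / 2
    exact ⟨fun x t ht => (both x t ht).1, fun x t ht => (both x t ht).2⟩

theorem curvature_matL_matP (x t : ℝ) :
    (Matrix.of fun i j => dT (fun x t => matL u v lam x t i j) x t)
      - (Matrix.of fun i j => dX (fun x t => matP u v lam x t i j) x t)
      + (matL u v lam x t * matP u v lam x t - matP u v lam x t * matL u v lam x t) =
    !![2⁻¹ * (dT (laxQ u v lam) x t - dX (laxFlux u v lam) x t), 0;
      0, -(2⁻¹ * (dT (laxQ u v lam) x t - dX (laxFlux u v lam) x t))] := by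
  have hL : ∀ x t, matL u v lam x t = !![2⁻¹ * laxQ u v lam x t, 0; 1, -(2⁻¹ * laxQ u v lam x t)] :=
    fun x t => by
      rw [matL, laxL, smul_eq_mul, smul_eq_mul, mul_neg]
      rfl
  have hP : ∀ x t, matP u v lam x t = !![2⁻¹ * laxFlux u v lam x t, 0;
      (u x t : ℂ) + lam, -(2⁻¹ * laxFlux u v lam x t)] := fun x t => by
    simp only [matP, laxP, laxFlux, laxQ, smul_eq_mul]
    congr 1
    ext i j
    fin_cases i <;> fin_cases j <;> simp <;> ring
  have h₅ : laxFlux u v lam x t = dX (fun x t => (u x t : ℂ) + lam) x t +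
    ((u x t : ℂ) + lam) * laxQ u v lam x t := rfl
  ext i j
  fin_cases i <;> fin_cases j
  · simp only [hL, hP, Matrix.add_apply, Matrix.sub_apply, Matrix.of_apply, Matrix.mul_apply,
      Fin.sum_univ_two]
    simp only [dT, dX]
    simp
    ring
  · simp [hL, hP, dT, dX]
  · simp only [hL, hP, Matrix.add_apply, Matrix.sub_apply, Matrix.of_apply, Matrix.mul_apply,
      Fin.sum_univ_two]
    simp [h₅]
    simp [dT]
    ring
  · simp only [hL, hP, Matrix.add_apply, Matrix.sub_apply, Matrix.of_apply, Matrix.mul_apply,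
      Fin.sum_univ_two]
    simp only [dT, dX]
    simp
    ring

theorem zeroCurvature_iff (lam : ℂ) :
    ZeroCurvature I u v lam ↔
      ∀ x, ∀ t ∈ I, dT (laxQ u v lam) x t = dX (laxFlux u v lam) x t := by
  refine forall₃_congr fun x t ht => ?_
  rw [curvature_matL_matP]
  constructor
  · intro h
    have h0 := congrFun (congrFun h 0) 0
    simpa [sub_eq_zero] using h0
  · intro h
    rw [h, sub_self, mul_zero, neg_zero]
    ext i j
    fin_cases i <;> fin_cases j <;> rfl

theorem solvesLax_iff {f fh : ℝ → ℝ → ℂ} : SolvesLax I u v lam f fh ↔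
    SmoothOn I f ∧ SmoothOn I fh ∧ ∀ x, ∀ t ∈ I,
      (dX f x t = 2⁻¹ * laxQ u v lam x t * f x t ∧
        dX fh x t = f x t - 2⁻¹ * laxQ u v lam x t * fh x t) ∧
      (dT f x t = 2⁻¹ * laxFlux u v lam x t * f x t ∧
        dT fh x t = ((u x t : ℂ) + lam) * f x t - 2⁻¹ * laxFlux u v lam x t * fh x t) := by
  refine and_congr_right fun _ => and_congr_right fun _ => forall₃_congr fun x t ht => ?_
  have hL : (matL u v lam x t).mulVec ![f x t, fh x t] = ![2⁻¹ * laxQ u v lam x t * f x t,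
      f x t - 2⁻¹ * laxQ u v lam x t * fh x t] := by
    funext i
    fin_cases i
    · simp [matL, laxL, laxQ, Matrix.mulVec, dotProduct]
    · simp [matL, laxL, laxQ, Matrix.mulVec, dotProduct]
      ring
  have hP : (matP u v lam x t).mulVec ![f x t, fh x t] = ![2⁻¹ * laxFlux u v lam x t * f x t,
      ((u x t : ℂ) + lam) * f x t - 2⁻¹ * laxFlux u v lam x t * fh x t] := by
    funext i
    simp only [matP, laxP, laxFlux, laxQ]
    generalize dX (fun x t => (u x t : ℂ) + lam) x t = z
    fin_cases i <;> simp [Matrix.mulVec, dotProduct, -mul_eq_mul_right_iff] <;> ring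
  rw [hL, hP]
  simp [Matrix.vecCons_inj]

/-- A potential of `q dx + (α_x + α q) dt` yields the general solution of the Lax pair. -/
theorem exists_solvesLax (hI : IsOpen I) (hI' : I.OrdConnected) (hu : SmoothOn I u)
    {Φ : ℝ → ℝ → ℂ} (hΦ : SmoothOn I Φ)
    (hd : ∀ x, ∀ t ∈ I, dX Φ x t = laxQ u v lam x t ∧ dT Φ x t = laxFlux u v lam x t) :
    ∃ H : ℝ → ℝ → ℂ, SmoothOn I H ∧
      (∀ x, ∀ t ∈ I, dX H x t = Complex.exp (Φ x t) ∧
        dT H x t = ((u x t : ℂ) + lam) * Complex.exp (Φ x t)) ∧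
      ∀ c₁ c₂ : ℂ, SolvesLax I u v lam (fun x t => c₁ * Complex.exp (2⁻¹ * Φ x t))
        (fun x t => Complex.exp (-(2⁻¹ * Φ x t)) * (c₁ * H x t + c₂)) := by
  have hα := smoothOn_laxAlpha hu lam
  have hE : SmoothOn I (fun x t => Complex.exp (Φ x t)) := ContDiffOn.cexp hΦ
  have hX : ∀ x, ∀ t ∈ I, HasDerivAt (fun y => Φ y t) (laxQ u v lam x t) x := fun x t ht =>
    (hd x t ht).1 ▸ hΦ.hasDerivAt_dX hI x ht
  have hT : ∀ x, ∀ t ∈ I, HasDerivAt (fun s => Φ x s) (laxFlux u v lam x t) t := fun x t ht =>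
    (hd x t ht).2 ▸ hΦ.hasDerivAt_dT hI x ht
  -- The form $e^\Phi dx+\alpha e^\Phi dt$ is closed, since $\partial_te^\Phi=(\alpha_x+\alpha
  -- q)e^\Phi=\partial_x(\alpha e^\Phi)$.
  obtain ⟨H, hH, hHd⟩ := exists_potential hI hI'
    (b := fun x t => ((u x t : ℂ) + lam) * Complex.exp (Φ x t)) hE (ContDiffOn.mul hα hE) (fun x t ht => by
    rw [show dT (fun x t => Complex.exp (Φ x t)) x t = _ from (hT x t ht).cexp.deriv]
    refine Eq.trans ?_ ((hα.hasDerivAt_dX hI x ht).mul (hX x t ht).cexp).deriv.symm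
    rw [laxFlux]
    ring)
  refine ⟨H, hH, hHd, fun c₁ c₂ => solvesLax_iff.mpr ⟨?_, ?_, fun x t ht => ?_⟩⟩
  · exact contDiffOn_const.mul (ContDiffOn.cexp (contDiffOn_const.mul hΦ))
  · exact (ContDiffOn.cexp (contDiffOn_const.mul hΦ).neg).mul
      ((contDiffOn_const.mul hH).add contDiffOn_const)
  · have hexp : Complex.exp (-(2⁻¹ * Φ x t)) * Complex.exp (Φ x t) =
        Complex.exp (2⁻¹ * Φ x t) := by
      rw [← Complex.exp_add]
      congr 1
      ring
    have hHX : HasDerivAt (fun y => H y t) (Complex.exp (Φ x t)) x :=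
      (hHd x t ht).1 ▸ hH.hasDerivAt_dX hI x ht
    have hHT : HasDerivAt (fun s => H x s) (((u x t : ℂ) + lam) * Complex.exp (Φ x t)) t :=
      (hHd x t ht).2 ▸ hH.hasDerivAt_dT hI x ht
    refine ⟨⟨?_, ?_⟩, ?_, ?_⟩
    · refine ((((hX x t ht).const_mul (2⁻¹ : ℂ)).cexp).const_mul c₁).deriv.trans ?_
      ring
    · refine ((((hX x t ht).const_mul (2⁻¹ : ℂ)).neg.cexp).mul
        ((hHX.const_mul c₁).add_const c₂)).deriv.trans ?_
      simp only [Pi.neg_apply]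
      linear_combination c₁ * hexp
    · refine ((((hT x t ht).const_mul (2⁻¹ : ℂ)).cexp).const_mul c₁).deriv.trans ?_
      ring
    · refine ((((hT x t ht).const_mul (2⁻¹ : ℂ)).neg.cexp).mul
        ((hHT.const_mul c₁).add_const c₂)).deriv.trans ?_
      simp only [Pi.neg_apply]
      linear_combination c₁ * ((u x t : ℂ) + lam) * hexp

/-- The system is equivalent to the solvability of the Lax pair for all initial data. -/
theorem system_iff_exists_solvesLax (hI : IsOpen I) (hI' : I.OrdConnected) (hu : SmoothOn I u)
    (hv : SmoothOn I v) :
    (FirstEquation I u v ∧ SecondEquation I u v) ↔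
      ∀ lam : ℂ, lam ≠ 0 → ∀ x₀, ∀ t₀ ∈ I, ∀ c d : ℂ,
        ∃ f fh, SolvesLax I u v lam f fh ∧ f x₀ t₀ = c ∧ fh x₀ t₀ = d := by
  rw [system_iff_laxFlux hI hu hv]
  refine forall₂_congr fun lam hlam => ⟨fun h x₀ t₀ _ c d => ?_, fun h x t ht => ?_⟩
  · obtain ⟨Φ, hΦ, hd⟩ := exists_potential hI hI' (smoothOn_laxQ hu hv lam)
      (smoothOn_laxFlux hI hu hv lam) h
    obtain ⟨H, -, -, hsol⟩ := exists_solvesLax hI hI' hu hΦ hd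
    set e := Complex.exp (2⁻¹ * Φ x₀ t₀) with he
    have he0 : e ≠ 0 := Complex.exp_ne_zero _
    -- The two constants solve $c_1e=c$ and $e^{-1}(c_1H+c_2)=d$ at the initial point.
    refine ⟨_, _, hsol (c / e) (e * d - c / e * H x₀ t₀), ?_, ?_⟩
    · exact div_mul_cancel₀ c he0
    · rw [Complex.exp_neg, ← he, add_sub_cancel, inv_mul_cancel_left₀ he0]
  -- A solution with $f=1$ at the given point suffices: in $f_{xt}=f_{tx}$ the quadratic terms
  -- cancel and the conservation law at that point remains.
  · obtain ⟨f, fh, hf, hf1, -⟩ := h x t ht 1 0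
    obtain ⟨hs, -, hd⟩ := solvesLax_iff.mp hf
    have hq := smoothOn_laxQ hu hv lam
    have hB := smoothOn_laxFlux hI hu hv lam
    have key := hs.dT_dX hI x ht
    rw [dT_congr hI (fun x t ht => (hd x t ht).1.1) x ht,
      dX_congr (fun x t ht => (hd x t ht).2.1) x ht,
      show dT (fun x t => 2⁻¹ * laxQ u v lam x t * f x t) x t = _ from
        (((hq.hasDerivAt_dT hI x ht).const_mul (2⁻¹ : ℂ)).mul (hs.hasDerivAt_dT hI x ht)).deriv,
      show dX (fun x t => 2⁻¹ * laxFlux u v lam x t * f x t) x t = _ from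
        (((hB.hasDerivAt_dX hI x ht).const_mul (2⁻¹ : ℂ)).mul (hs.hasDerivAt_dX hI x ht)).deriv,
      (hd x t ht).1.1, (hd x t ht).2.1, hf1] at key
    linear_combination 2 * key

theorem SolvesLax.congr {f fh f' fh' : ℝ → ℝ → ℂ} (hI : IsOpen I) (h : SolvesLax I u v lam f fh)
    (hf : ∀ x, ∀ t ∈ I, f' x t = f x t) (hfh : ∀ x, ∀ t ∈ I, fh' x t = fh x t) :
    SolvesLax I u v lam f' fh' :=
  ⟨h.1.congr hf, h.2.1.congr hfh, fun x t ht => by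
    rw [dX_congr hf x ht, dX_congr hfh x ht, dT_congr hI hf x ht, dT_congr hI hfh x ht, hf x t ht,
      hfh x t ht]
    exact h.2.2 x t ht⟩

/-- Passage from the Hopf-Cole type linearization to the Lax pair. -/
theorem adjoint_extension (hI : IsOpen I) (hI' : I.OrdConnected) (hu : SmoothOn I u)
    (hv : SmoothOn I v) (h₂ : SecondEquation I u v) {g : ℝ → ℝ → ℝ} (hg : IsHopfCole I u v g) :
    ∃ w : ℝ → ℝ → ℝ, SmoothOn I w ∧
      (∀ x, ∀ t ∈ I, dX w x t = v x t ∧ dT w x t = u x t * v x t) ∧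
      ∀ lam : ℂ, lam ≠ 0 → ∃ f fh : ℝ → ℝ → ℂ,
        (∀ x t, f x t = (Real.sqrt (g x t) : ℂ) *
          Complex.exp ((lam⁻¹ * w x t - lam * x - lam ^ 2 * t) / 2)) ∧
        (∀ x, ∀ t ∈ I, dX (fun x t => fh x t * f x t) x t = f x t ^ 2 ∧
          dT (fun x t => fh x t * f x t) x t = ((u x t : ℂ) + lam) * f x t ^ 2) ∧
        SolvesLax I u v lam f fh := by
  obtain ⟨w, hw, hwd⟩ := exists_potential hI hI' (b := fun x t => u x t * v x t) hv
    (ContDiffOn.mul hu hv) (fun x t ht => by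
    rw [h₂ x t ht]
    exact ((hu.hasDerivAt_dX hI x ht).mul (hv.hasDerivAt_dX hI x ht)).deriv.symm)
  refine ⟨w, hw, hwd, fun lam hlam => ?_⟩
  obtain ⟨hl, hld⟩ := hg.potential hI hu
  set φ : ℝ → ℝ → ℝ := fun x t => Real.log (g x t) with hφ
  -- Adding to $\ln\tilde g$ the potential of the $\lambda$-dependent terms gives a potential of
  -- $q\,dx+(\alpha_x+\alpha q)\,dt$, so the prescribed $f$ is $e^{\Phi/2}$.
  let Φ : ℝ → ℝ → ℂ := fun x t => φ x t + (lam⁻¹ * w x t - lam * x - lam ^ 2 * t)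
  have hΦ : SmoothOn I Φ :=
    ContDiffOn.add hl.ofReal (((contDiffOn_const.mul hw.ofReal).sub
      (contDiffOn_const.mul (Complex.ofRealCLM.contDiff.comp contDiff_fst).contDiffOn)).sub
      (contDiffOn_const.mul (Complex.ofRealCLM.contDiff.comp contDiff_snd).contDiffOn))
  have hd : ∀ x, ∀ t ∈ I, dX Φ x t = laxQ u v lam x t ∧ dT Φ x t = laxFlux u v lam x t := by
    intro x t ht
    constructor
    · refine (((hl.hasDerivAt_dX hI x ht).ofReal_comp).add
        ((((hw.hasDerivAt_dX hI x ht).ofReal_comp.const_mul lam⁻¹).sub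
          ((hasDerivAt_id x).ofReal_comp.const_mul lam)).sub_const (lam ^ 2 * t))).deriv.trans ?_
      rw [(hld x t ht).1, (hwd x t ht).1, laxQ]
      push_cast
      ring
    · refine (((hl.hasDerivAt_dT hI x ht).ofReal_comp).add
        ((((hw.hasDerivAt_dT hI x ht).ofReal_comp.const_mul lam⁻¹).sub_const (lam * x)).sub
          ((hasDerivAt_id t).ofReal_comp.const_mul (lam ^ 2)))).deriv.trans ?_
      rw [(hld x t ht).2, (hwd x t ht).2, laxFlux_eq hI hu hlam x ht]
      push_cast
      ring
  obtain ⟨H, -, hHd, hsol⟩ := exists_solvesLax hI hI' hu hΦ hd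
  have hf : ∀ x, ∀ t ∈ I, (Real.sqrt (g x t) : ℂ) *
      Complex.exp ((lam⁻¹ * w x t - lam * x - lam ^ 2 * t) / 2) =
      Complex.exp (2⁻¹ * Φ x t) := by
    intro x t ht
    have hpos := hg.2.1 x t ht
    have h1 : (Real.sqrt (g x t) : ℂ) = Complex.exp (φ x t / 2) := by
      rw [Real.sqrt_eq_rpow, Real.rpow_def_of_pos hpos]
      push_cast
      congr 1
      rw [hφ]
      ring
    rw [h1, ← Complex.exp_add]
    congr 1
    simp only [Φ]
    ring
  have hmul : ∀ x, ∀ t ∈ I, Complex.exp (-(2⁻¹ * Φ x t)) * H x t * ((Real.sqrt (g x t) : ℂ) *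
      Complex.exp ((lam⁻¹ * w x t - lam * x - lam ^ 2 * t) / 2)) = H x t := by
    intro x t ht
    rw [hf x t ht, mul_right_comm, ← Complex.exp_add, neg_add_cancel, Complex.exp_zero, one_mul]
  have hsq : ∀ x, ∀ t ∈ I, ((Real.sqrt (g x t) : ℂ) *
      Complex.exp ((lam⁻¹ * w x t - lam * x - lam ^ 2 * t) / 2)) ^ 2 = Complex.exp (Φ x t) := by
    intro x t ht
    rw [hf x t ht, ← Complex.exp_nat_mul]
    congr 1
    push_cast
    ring
  -- The prescribed $f$ equals $e^{\Phi/2}$ only for $t\in I$, where $\tilde g>0$, hence the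
  -- transfer by congruence. The constants 1 and 0 make $\hat ff=H$.
  refine ⟨_, fun x t => Complex.exp (-(2⁻¹ * Φ x t)) * H x t, fun x t => rfl,
    fun x t ht => ⟨?_, ?_⟩, (hsol 1 0).congr hI (fun x t ht => ?_) (fun x t ht => ?_)⟩
  · rw [dX_congr hmul x ht, (hHd x t ht).1, hsq x t ht]
  · rw [dT_congr hI hmul x ht, (hHd x t ht).2, hsq x t ht]
  · rw [hf x t ht, one_mul]
  · rw [one_mul, add_zero]

end Lax

end Burgers

end

/-! ### Assembly of the four parts of the theorem -/

theorem theorem1p1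
    {𝕜 : Type*} [RCLike 𝕜] {K : Type*} [CommRing K] [IsDomain K] [Algebra 𝕜 K]
    (dx dt : Derivation 𝕜 K K) (hcomm : ∀ c, dx (dt c) = dt (dx c))
    (I : Set ℝ) (hI : IsOpen I) (hI' : I.OrdConnected)
    (u v : ℝ → ℝ → ℝ) (hu : Burgers.SmoothOn I u) (hv : Burgers.SmoothOn I v) :
    -- The conserved densities are, up to trivial ones, the combinations of `u` and `v`.
    (∀ γ : Burgers.DiffPoly K,
      (∃ ρ, Burgers.totalT dx dt γ + Burgers.totalX dx ρ = 0) ↔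
        ∃ (a b k l : K) (h : Burgers.DiffPoly K),
          dx a = 0 ∧ dt a = 0 ∧ dx b = 0 ∧ dt b = 0 ∧ dt k = dx l ∧
          γ = MvPolynomial.C a * Burgers.uu K + MvPolynomial.C b * Burgers.vv K
            + MvPolynomial.C k + Burgers.totalX dx h) ∧
    -- `∫ u dx` and `∫ v dx` are nontrivial and independent.
    (∀ (a b k : K) (h : Burgers.DiffPoly K), dx a = 0 → dt a = 0 → dx b = 0 → dt b = 0 →
      MvPolynomial.C a * Burgers.uu K + MvPolynomial.C b * Burgers.vv K
        = MvPolynomial.C k + Burgers.totalX dx h → a = 0 ∧ b = 0) ∧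
    -- For rational densities the gradient is that of a combination of `∫ u dx` and `∫ v dx`.
    (∀ γ ρ : Burgers.DiffFrac K,
      Burgers.fracDer (Burgers.totalT dx dt) γ + Burgers.fracDer (Burgers.totalX dx) ρ = 0 →
        ∃ a b : Burgers.DiffFrac K,
          Burgers.fracDer (Burgers.totalX dx) a = 0 ∧ Burgers.fracDer (Burgers.totalT dx dt) a = 0 ∧
          Burgers.fracDer (Burgers.totalX dx) b = 0 ∧ Burgers.fracDer (Burgers.totalT dx dt) b = 0 ∧
          Burgers.grad dx 0 γ = a ∧ Burgers.grad dx 1 γ = b) ∧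
    -- Linearization by the Hopf-Cole type transformation.
    (Burgers.FirstEquation I u v ↔ ∃ g, Burgers.IsHopfCole I u v g) ∧
    -- The system is the compatibility condition of the Lax pair.
    ((Burgers.FirstEquation I u v ∧ Burgers.SecondEquation I u v) ↔
      ∀ lam : ℂ, lam ≠ 0 → Burgers.ZeroCurvature I u v lam) ∧
    ((Burgers.FirstEquation I u v ∧ Burgers.SecondEquation I u v) ↔
      ∀ lam : ℂ, lam ≠ 0 → ∀ x₀, ∀ t₀ ∈ I, ∀ c d : ℂ,
        ∃ f fh, Burgers.SolvesLax I u v lam f fh ∧ f x₀ t₀ = c ∧ fh x₀ t₀ = d) ∧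
    -- Passage from the Hopf-Cole linearization to the Lax pair by the adjoint extension.
    (Burgers.SecondEquation I u v → ∀ g, Burgers.IsHopfCole I u v g →
      ∃ w : ℝ → ℝ → ℝ, Burgers.SmoothOn I w ∧
        (∀ x, ∀ t ∈ I, Burgers.dX w x t = v x t ∧ Burgers.dT w x t = u x t * v x t) ∧
        ∀ lam : ℂ, lam ≠ 0 → ∃ f fh : ℝ → ℝ → ℂ,
          (∀ x t, f x t = (Real.sqrt (g x t) : ℂ) *
            Complex.exp ((lam⁻¹ * w x t - lam * x - lam ^ 2 * t) / 2)) ∧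
          (∀ x, ∀ t ∈ I, Burgers.dX (fun x t => fh x t * f x t) x t = f x t ^ 2 ∧
            Burgers.dT (fun x t => fh x t * f x t) x t = ((u x t : ℂ) + lam) * f x t ^ 2) ∧
          Burgers.SolvesLax I u v lam f fh) ∧
    -- The Lax pair is compatible in the reduced differential ring, and solvable in an extension.
    (∀ lam : 𝕜, lam ≠ 0 →
      Burgers.curvature (Burgers.totalX dx) (Burgers.totalT dx dt)
        (Burgers.laxL 𝕜 (Burgers.spectralQ K lam))
        (Burgers.laxP 𝕜 (Burgers.spectralQ K lam) (Burgers.spectralAlpha K lam)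
          (Burgers.totalX dx (Burgers.spectralAlpha K lam))) = 0 ∧
      Burgers.LaxSolvableInExtension dx dt lam) ∧
    -- The hierarchy: the flows isospectral for the Lax operator, polynomial in `λ`, are exactly
    -- those generated by asymptotic solutions.
    (∀ (n : ℕ) (β : Burgers.Series K), (∀ k : ℤ, β.coeff k ≠ 0 → -(n : ℤ) ≤ k ∧ k ≤ 0) →
      ∀ D : Derivation K (Burgers.DiffPoly K) (Burgers.DiffPoly K), Burgers.IsFlow dx D →
        (Burgers.curvature (Burgers.seriesX dx) (fun s => s.map D)
            (Burgers.laxL 𝕜 (Burgers.formalQ K))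
            (Burgers.laxP 𝕜 (Burgers.formalQ K) β (Burgers.seriesX dx β)) = 0 ↔
          (∃ α, Burgers.IsAsymptoticSolution dx α ∧
            β = Burgers.polyPart (Burgers.lamPow K n * α)) ∧
          Burgers.FlowEquation dx β D)) ∧
    (∀ α, Burgers.IsAsymptoticSolution dx α → ∀ n : ℕ,
      ∃! D : Derivation K (Burgers.DiffPoly K) (Burgers.DiffPoly K), Burgers.IsFlow dx D ∧
        Burgers.FlowEquation dx (Burgers.polyPart (Burgers.lamPow K n * α)) D) ∧
    (∃! α, Burgers.IsNormalizedSolution dx α) ∧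
    -- The flows of the normalized solution: translation, the given system, the recursion
    -- operator, and independence.
    (∀ α, Burgers.IsNormalizedSolution dx α →
      ∀ D : ℕ → Derivation K (Burgers.DiffPoly K) (Burgers.DiffPoly K),
        (∀ n : ℕ, Burgers.IsFlow dx (D n) ∧
          Burgers.FlowEquation dx (Burgers.polyPart (Burgers.lamPow K n * α)) (D n)) →
        (D 0 (Burgers.uu K) = Burgers.totalX dx (Burgers.uu K) ∧
          D 0 (Burgers.vv K) = Burgers.totalX dx (Burgers.vv K)) ∧
        Burgers.polyPart (Burgers.lamPow K 1 * α)
          = HahnSeries.C (Burgers.uu K) + Burgers.lamPow K 1 ∧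
        (D 1 (Burgers.uu K) = Burgers.burgersField dx 0 ∧
          D 1 (Burgers.vv K) = Burgers.burgersField dx 1) ∧
        (∀ n, ∃ a : Burgers.DiffPoly K, Burgers.totalX dx a = D n (Burgers.uu K) ∧
          MvPolynomial.constantCoeff a = 0 ∧
          D (n + 1) (Burgers.uu K) = Burgers.totalX dx (D n (Burgers.uu K))
            + Burgers.totalX dx (Burgers.uu K * a) + D n (Burgers.vv K) ∧
          D (n + 1) (Burgers.vv K) = Burgers.totalX dx (Burgers.vv K * a)) ∧
        LinearIndependent K D) := by
  refine ⟨Burgers.conserved_iff dx dt hcomm,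
    fun a b k h _ _ _ _ heq => Burgers.linear_density_independent dx a b k h heq,
    fun γ ρ h => ?_, Burgers.firstEquation_iff_exists_isHopfCole hI hI' hu hv, ?_,
    Burgers.system_iff_exists_solvesLax hI hI' hu hv,
    fun h₂ g hg => Burgers.adjoint_extension hI hI' hu hv h₂ hg,
    fun lam hlam => ⟨Burgers.curvature_burgers dx dt hlam,
      Burgers.laxSolvableInExtension dx dt hcomm hlam⟩,
    fun n β hβ D _ => Burgers.isospectral_iff dx n β hβ D,
    fun α hα n => Burgers.existsUnique_flow dx hα n,
    Burgers.existsUnique_normalizedSolution dx,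
    fun α hα D hD => Burgers.normalized_flows dx hα D hD⟩
  · obtain ⟨h₁, h₂, h₃, h₄⟩ := (Burgers.gradientSystem_grad dx dt hcomm h).constant
    exact ⟨_, _, h₁, h₃, h₂, h₄, rfl, rfl⟩
  · rw [Burgers.system_iff_laxFlux hI hu hv]
    exact forall₂_congr fun lam _ => (Burgers.zeroCurvature_iff lam).symm
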